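/- Let $D\ge 3$ and let $\mathcal L(g^{ab},R_{abcd})$ be any diffeomorphism-invariant (higher-order) theory of gravity in $D$ dimensions, i.e. a smooth scalar function of the inverse metric and of the Riemann tensor (not of its covariant derivatives), defined on an open set of pairs $(g^{ab},R_{abcd})$, where both this set and the value of $\mathcal L$ are invariant under all linear changes of frame. Let $\mathcal E_{ab}=\frac{1}{\sqrt{|g|}}\frac{\delta S}{\delta g^{ab}}$, $S=\int\sqrt{|g|}\,\mathcal L$, be the tensor of its field equations $\mathcal E_{ab}=0$, i.e. the continuous symmetric tensor with $\delta S=\int \sqrt{|g|}\,\mathcal E_{ab}\,\delta g^{ab}$ for all smooth compactly supported variations of the metric. Let $k\in\{-1,0,1\}$, let $a,F$ be smooth positive functions on an open interval, and consider the FLRW metric $$ds^2_{a,F}=-F(t)\,dt^2+\frac{a^2(t)}{1-kr^2}\,dr^2+a^2(t)\,r^2\,d\Omega^2_{D-2}$$ (on the region $1-kr^2>0$), whose inverse metric and Riemann tensor are assumed to lie in the domain of $\mathcal L$. Write the spatial part in the coordinates $x=r\omega\in\mathbb R^{D-1}$, $\omega\in S^{D-2}$, so that $\sqrt{|g|}=\sqrt{F/(1-kr^2)}\,a^{D-1}$,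 and let $\hat L_{a,F}=\sqrt{|g|}\,\mathcal L\big|_{a,F}$ be the reduced Lagrangian obtained by evaluation on this metric. Then $\hat L_{a,F}$ is a function of $a,\dot a,\ddot a,F,\dot F$ and of the spatial point $x$ only; the tensor $\mathcal E_{ab}$ exists; and on the FLRW metric $\mathcal E_{ab}$ has the form $$\mathcal E_{ab}=(s_1(t)+F(t)s_2(t))\,\delta_a^t\delta_b^t+s_2(t)\,g_{ab},$$ where $$\frac{\delta\hat L_{a,F}}{\delta F}=\frac{\partial\hat L_{a,F}}{\partial F}-\frac{d}{dt}\frac{\partial\hat L_{a,F}}{\partial\dot F}=\sqrt{|g|}\,\frac{1}{F^2}\,s_1(t),$$ $$\frac{\delta\hat L_{a,F}}{\delta a}=\frac{\partial\hat L_{a,F}}{\partial a}-\frac{d}{dt}\frac{\partial\hat L_{a,F}}{\partial\dot a}+\frac{d^2}{dt^2}\frac{\partial\hat L_{a,F}}{\partial\ddot a}=-\sqrt{|g|}\,\frac{2(D-1)}{a}\,s_2(t).$$ Consequently the full field equations $\mathcal E_{ab}=0$ on the FLRW metric are equivalent to $\delta\hat L_{a,F}/\delta F=0$ and $\delta\hat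 L_{a,F}/\delta a=0$. Moreover, after the variation one can reparametrize time to set $F=1$: there are a smooth strictly increasing $\tau$ with $\dot\tau=\sqrt F$ and a smooth $b$ on the image of $\tau$ with $b(\tau(t))=a(t)$, such that each of the two equations holds for $(a,F)$ at time $t$ if and only if it holds for $(b,1)$ at time $\tau(t)$. -/

import Mathlib

open scoped ContDiff

noncomputable section

namespace Gravity

/-! ### Tensor fields in a coordinate chart of a spacetime of dimension `D = n + 1`

The coordinate with index `0` is the time `t`, the other `n = D - 1` coordinates are spatial. -/

/-- Coordinates of a point in a chart. -/
abbrev Coord (n : ℕ) := Fin (n + 1) → ℝ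

/-- Components of a tensor with two indices. -/
abbrev Tensor2 (n : ℕ) := Fin (n + 1) → Fin (n + 1) → ℝ

/-- Components of a tensor with four indices. -/
abbrev Tensor4 (n : ℕ) := Fin (n + 1) → Fin (n + 1) → Fin (n + 1) → Fin (n + 1) → ℝ

/-- The partial derivative `∂_μ f` at the point `p`. -/
def pd {n : ℕ} (μ : Fin (n + 1)) (f : Coord n → ℝ) (p : Coord n) : ℝ :=
  fderiv ℝ f p (Pi.single μ 1)

/-- The inverse metric `g^{ab}` of a metric `g_{ab}`. -/
def inverseMetric {n : ℕ} (g : Coord n → Tensor2 n) (p : Coord n) : Tensor2 n :=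
  fun a b => (Matrix.of (g p))⁻¹ a b

/-- `√|g|`, where `g` is the determinant of the metric. -/
def volumeFactor {n : ℕ} (g : Coord n → Tensor2 n) (p : Coord n) : ℝ :=
  Real.sqrt |(Matrix.of (g p)).det|

/-- The Christoffel symbols; `christoffel g p a b c` is
`Γ_{ab}^c = ½ g^{cd} (∂_a g_{bd} + ∂_b g_{ad} - ∂_d g_{ab})`. -/
def christoffel {n : ℕ} (g : Coord n → Tensor2 n) (p : Coord n) (a b c : Fin (n + 1)) : ℝ :=
  (1 / 2) * ∑ d, inverseMetric g p c d *
    (pd a (fun q => g q b d) p + pd b (fun q => g q a d) p - pd d (fun q => g q a b) p)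

/-- The Riemann tensor with its last index up (Wald's conventions); `riemannUp g p a b c d` is
`R_{abc}^d = ∂_b Γ_{ac}^d - ∂_a Γ_{bc}^d + Γ_{ca}^e Γ_{be}^d - Γ_{cb}^e Γ_{ae}^d`. -/
def riemannUp {n : ℕ} (g : Coord n → Tensor2 n) (p : Coord n) (a b c d : Fin (n + 1)) : ℝ :=
  pd b (fun q => christoffel g q a c d) p - pd a (fun q => christoffel g q b c d) p
    + ∑ e, (christoffel g p c a e * christoffel g p b e d
      - christoffel g p c b e * christoffel g p a e d)

/-- The Riemann tensor `R_{abcd} = R_{abc}^e g_{ed}`. -/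
def riemann {n : ℕ} (g : Coord n → Tensor2 n) (p : Coord n) : Tensor4 n :=
  fun a b c d => ∑ e, riemannUp g p a b c e * g p e d

/-! ### Higher-order gravities -/

/-- The pair `(g^{ab}, R_{abcd})` at a point. -/
def curvatureData {n : ℕ} (g : Coord n → Tensor2 n) (p : Coord n) : Tensor2 n × Tensor4 n :=
  (inverseMetric g p, riemann g p)

/-- The action of a linear change of frame on a pair `(g^{ab}, R_{abcd})`: upper indices transform
with `A`, lower indices with `A⁻¹`. -/
def changeFrame {n : ℕ} (A : Matrix.GeneralLinearGroup (Fin (n + 1)) ℝ)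
    (w : Tensor2 n × Tensor4 n) : Tensor2 n × Tensor4 n :=
  (fun a b => ∑ c, ∑ d, A.1 a c * A.1 b d * w.1 c d,
   fun a b c d => ∑ e, ∑ f, ∑ i, ∑ j,
     (A⁻¹).1 e a * (A⁻¹).1 f b * (A⁻¹).1 i c * (A⁻¹).1 j d * w.2 e f i j)

/-- A diffeomorphism-invariant theory of gravity `𝓛(g^{ab}, R_{abcd})` in dimension `n + 1`: a
smooth scalar function of the inverse metric and of the Riemann tensor. It may be defined on an
open set only (for instance where a series in the curvature converges). It is written as a function
on all pairs of a 2-tensor and a 4-tensor; a function that is given only on pairs with the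
symmetries of a metric and of a Riemann tensor extends by composing it with the (frame-equivariant,
linear) projection onto such pairs. -/
structure GravityTheory (n : ℕ) where
  /-- where the Lagrangian is defined -/
  domain : Set (Tensor2 n × Tensor4 n)
  /-- the Lagrangian `𝓛(g^{ab}, R_{abcd})` -/
  lagrangian : Tensor2 n × Tensor4 n → ℝ
  isOpen_domain : IsOpen domain
  smooth : ContDiffOn ℝ ∞ lagrangian domain
  domain_invariant : ∀ A : Matrix.GeneralLinearGroup (Fin (n + 1)) ℝ, ∀ w ∈ domain,
    changeFrame A w ∈ domain
  scalar : ∀ A : Matrix.GeneralLinearGroup (Fin (n + 1)) ℝ, ∀ w ∈ domain,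
    lagrangian (changeFrame A w) = lagrangian w

/-- The Lagrangian density `√|g| 𝓛(g^{ab}, R_{abcd})` of the metric `g`. -/
def density {n : ℕ} (T : GravityTheory n) (g : Coord n → Tensor2 n) (p : Coord n) : ℝ :=
  volumeFactor g p * T.lagrangian (curvatureData g p)

/-- The first variation `δg^{ab} = - g^{ac} g^{bd} δg_{cd}` of the inverse metric under
`δg_{ab} = h_{ab}`. -/
def inverseVariation {n : ℕ} (g h : Coord n → Tensor2 n) (p : Coord n) : Tensor2 n :=
  fun a b => - ∑ c, ∑ d, inverseMetric g p a c * inverseMetric g p b d * h p c d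

/-- `E` is the tensor `𝓔_{ab} = (1/√|g|) δS/δg^{ab}` of the field equations of the theory at the
metric `g` on the open set `Ω` of the chart: it is symmetric and continuous, and for every smooth
variation `δg_{ab} = h_{ab}` with compact support in `Ω` the action `S = ∫ √|g| 𝓛` (over any
compact region of `Ω` that contains the support) has the first variation
`δS = ∫ √|g| 𝓔_{ab} δg^{ab}`. The field equations are `𝓔_{ab} = 0`. -/
structure IsFieldEquationTensor {n : ℕ} (T : GravityTheory n) (g : Coord n → Tensor2 n)
    (Ω : Set (Coord n)) (E : Coord n → Tensor2 n) : Prop where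
  symm : ∀ p ∈ Ω, ∀ a b, E p a b = E p b a
  continuousOn : ContinuousOn E Ω
  firstVariation : ∀ h : Coord n → Tensor2 n, ContDiff ℝ ∞ h → (∀ p a b, h p a b = h p b a) →
    ∀ K : Set (Coord n), IsCompact K → K ⊆ Ω → tsupport h ⊆ K →
      HasDerivAt (fun ε : ℝ => ∫ p in K, density T (fun q => g q + ε • h q) p)
        (∫ p in K, volumeFactor g p * ∑ a, ∑ b, E p a b * inverseVariation g h p a b) 0

/-! ### The FLRW ansatz -/

/-- `r² = x_1² + ⋯ + x_n²`. -/
def radiusSq {n : ℕ} (x : Fin n → ℝ) : ℝ := ∑ i, x i ^ 2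

/-- The FLRW metric `-F(t) dt² + a(t)² (dr² / (1 - k r²) + r² dΩ²)`, written in the coordinates
`x = r ω`, `ω` in the unit sphere of dimension `n - 1`: as `dr² + r² dΩ² = |dx|²` and
`r dr = x · dx`, its spatial part is `a² (|dx|² + k (x · dx)² / (1 - k r²))`. -/
def flrw {n : ℕ} (k : ℝ) (a F : ℝ → ℝ) (p : Coord n) : Tensor2 n := fun μ ν =>
  if μ = 0 ∧ ν = 0 then - F (p 0)
  else if μ = 0 ∨ ν = 0 then 0
  else a (p 0) ^ 2 *
    ((if μ = ν then 1 else 0) + k * p μ * p ν / (1 - k * radiusSq (Fin.tail p)))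

/-- The coordinate domain of the FLRW metric: `t ∈ I` and `1 - k r² > 0`. -/
def flrwDomain (n : ℕ) (k : ℝ) (I : Set ℝ) : Set (Coord n) :=
  {p | p 0 ∈ I ∧ 0 < 1 - k * radiusSq (Fin.tail p)}

/-- The reduced Lagrangian `√|g| 𝓛` on the FLRW ansatz, as a function of the values of
`a, ȧ, ä, F, Ḟ` at an instant (and of the spatial point `x`): the density of the FLRW metric whose
scale factor and lapse function have these derivatives at time zero. -/
def reducedLagrangian {n : ℕ} (T : GravityTheory n) (k : ℝ) (x : Fin n → ℝ)
    (a₀ a₁ a₂ F₀ F₁ : ℝ) : ℝ :=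
  density T (flrw k (fun s => a₀ + a₁ * s + a₂ * s ^ 2 / 2) (fun s => F₀ + F₁ * s))
    (Fin.cons 0 x)

/-! ### Euler–Lagrange expressions of a Lagrangian `Λ(a, ȧ, ä, F, Ḟ)` -/

/-- `δΛ/δF = ∂Λ/∂F - d/dt (∂Λ/∂Ḟ)` along the curve `(a, F)`, at time `t`. -/
def eulerLagrangeF (Λ : ℝ → ℝ → ℝ → ℝ → ℝ → ℝ) (a F : ℝ → ℝ) (t : ℝ) : ℝ :=
  deriv (fun y => Λ (a t) (deriv a t) (deriv (deriv a) t) y (deriv F t)) (F t)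
    - deriv (fun s =>
        deriv (fun y => Λ (a s) (deriv a s) (deriv (deriv a) s) (F s) y) (deriv F s)) t

/-- `δΛ/δa = ∂Λ/∂a - d/dt (∂Λ/∂ȧ) + d²/dt² (∂Λ/∂ä)` along the curve `(a, F)`, at time `t`. -/
def eulerLagrangeA (Λ : ℝ → ℝ → ℝ → ℝ → ℝ → ℝ) (a F : ℝ → ℝ) (t : ℝ) : ℝ :=
  deriv (fun y => Λ y (deriv a t) (deriv (deriv a) t) (F t) (deriv F t)) (a t)
    - deriv (fun s =>
        deriv (fun y => Λ (a s) y (deriv (deriv a) s) (F s) (deriv F s)) (deriv a s)) t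
    + deriv (deriv (fun s =>
        deriv (fun y => Λ (a s) (deriv a s) y (F s) (deriv F s)) (deriv (deriv a) s))) t

end Gravity

end

/-! The theorem is an instance of symmetric criticality. It is proved without averaging over a
symmetry group: the first variation of the action at the FLRW metric is computed for an arbitrary
compactly supported variation `h`, and it turns out that only two scalars built from `h` survive.
Below, `n = D - 1`, `γ` is the spatial metric of constant curvature `k`, and `H = γ^{ij} h_{ij}`.

Locality. The curvature, hence the density, is a smooth function of the 2-jet of the metric
(`riemann_eq_riemannJet`, `density_eq_densityJet`). The family `g + ε h` is a line in jet space, so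
one may differentiate under the integral over a compact set (`IsTestTensor.hasDerivAt_action`). The
derivative of the density is `√|g| (½ g^{ab} h_{ab} 𝓛 + d𝓛(δg^{-1}, δRiem))`.

Symmetry. In an orthonormal frame the FLRW data become `stdPair X Y`, where `X = ä/(aF) - ȧḞ/(2aF²)`
and `Y = (k + ȧ²/F)/a²`, so on the ansatz `𝓛` is a function `ℓ(X, Y)`. The differential of `𝓛` at
this pair is invariant under reflections of all axes and permutations of the spatial ones. It
therefore sees only two traces of `δRiem` and two of `δg^{-1}`. The coefficients of the curvature
traces are multiples of `∂ℓ/∂X` and `∂ℓ/∂Y`; those of the metric traces follow from invariance under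
rescaling the axes (`fderiv_scaling`). The result is `fderiv_stdPair`, transported to the coordinate
frame in `fderiv_flrwPair`.

Linearization. The two traces of the linearized Riemann tensor contain `h_{00}`, `H` and their time
derivatives, plus terms that are spatial divergences with coefficients depending on `t` alone. The
first group, together with the metric terms, is exactly the variation of the reduced Lagrangian
under `δF = -h_{00}`, `δa = H/(2na)` (`AdmissibleCurve.densityVariation_eq`). The divergences
integrate to zero, and integration by parts in `t` turns the rest into the Euler-Lagrange
expressions (`IsTestTensor.hasZeroIntegral_densityVariation`). As only `h_{00}` and `H` are left,
the field equations are a combination of `dt²` and `g`, whose coefficients are read off in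
`AdmissibleCurve.pairing_flrw`. The fundamental lemma of the calculus of variations makes this
tensor the only one (`IsFieldEquationTensor.eqOn`).

Time. Up to non-vanishing factors both Euler-Lagrange expressions can be written with `a`, `X`, `Y`
and the proper-time derivative `F^{-1/2} d/dt` only (`AdmissibleCurve.eulerLagrangeF_eq_proper`,
`AdmissibleCurve.eulerLagrangeA_eq_proper`), so their vanishing does not depend on the time
coordinate. -/

namespace Gravity

/-! ### Gradients in a chart -/

section Gradient

variable {n : ℕ}

/-- The linear form with the given components. -/
noncomputable def gradCLM (v : Fin (n + 1) → ℝ) : Coord n →L[ℝ] ℝ :=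
  ∑ μ, v μ • ContinuousLinearMap.proj μ

theorem gradCLM_apply (v w : Fin (n + 1) → ℝ) : gradCLM v w = ∑ μ, v μ * w μ := by
  simp [gradCLM]

theorem gradCLM_single (v : Fin (n + 1) → ℝ) (μ : Fin (n + 1)) :
    gradCLM v (Pi.single μ 1) = v μ := by
  simp [gradCLM_apply, Pi.single_apply]

/-- `f` is differentiable at `p`, with partial derivatives `v`. -/
def HasGrad (f : Coord n → ℝ) (v : Fin (n + 1) → ℝ) (p : Coord n) : Prop :=
  HasFDerivAt f (gradCLM v) p

theorem eq_gradCLM (L : Coord n →L[ℝ] ℝ) : L = gradCLM (fun μ => L (Pi.single μ 1)) := by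
  ext w
  rw [gradCLM_apply]
  conv_lhs => rw [← Finset.univ_sum_single w]
  rw [map_sum]
  refine Finset.sum_congr rfl fun μ _ => ?_
  have : (Pi.single μ (w μ) : Coord n) = w μ • Pi.single μ 1 := by
    rw [← Pi.single_smul]; simp
  rw [this, map_smul, smul_eq_mul, mul_comm]

variable {f g : Coord n → ℝ} {v w : Fin (n + 1) → ℝ} {p : Coord n}

theorem HasGrad.pd (h : HasGrad f v p) (μ : Fin (n + 1)) : pd μ f p = v μ := by
  rw [Gravity.pd, HasFDerivAt.fderiv h, gradCLM_single]

theorem hasGrad_pd (h : DifferentiableAt ℝ f p) : HasGrad f (fun μ => Gravity.pd μ f p) p := by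
  have := h.hasFDerivAt
  rw [eq_gradCLM (fderiv ℝ f p)] at this
  exact this

theorem hasGrad_of_hasFDerivAt {L : Coord n →L[ℝ] ℝ} (h : HasFDerivAt f L p) :
    HasGrad f (fun μ => L (Pi.single μ 1)) p := by
  rw [eq_gradCLM L] at h
  exact h

theorem HasGrad.congr_grad (h : HasGrad f v p) (hv : ∀ μ, v μ = w μ) : HasGrad f w p := by
  rwa [← show v = w from funext hv]

theorem HasGrad.congr (h : HasGrad f v p) (hg : g =ᶠ[nhds p] f) : HasGrad g v p :=
  HasFDerivAt.congr_of_eventuallyEq h hg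

theorem hasGrad_const (c : ℝ) : HasGrad (fun _ : Coord n => c) (fun _ => 0) p := by
  have : gradCLM (fun _ : Fin (n + 1) => (0 : ℝ)) = 0 := by ext; simp [gradCLM_apply]
  rw [HasGrad, this]; exact hasFDerivAt_const c p

theorem hasGrad_coord (μ : Fin (n + 1)) :
    HasGrad (fun q : Coord n => q μ) (fun ν => if ν = μ then 1 else 0) p := by
  have := (ContinuousLinearMap.proj (R := ℝ) (φ := fun _ : Fin (n + 1) => ℝ) μ).hasFDerivAt (x := p)
  refine (hasGrad_of_hasFDerivAt this).congr_grad fun ν => ?_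
  simp [Pi.single_apply, eq_comm]

theorem HasGrad.add (hf : HasGrad f v p) (hg : HasGrad g w p) :
    HasGrad (fun q => f q + g q) (fun μ => v μ + w μ) p := by
  refine (hasGrad_of_hasFDerivAt (HasFDerivAt.add hf hg)).congr_grad fun ν => ?_
  simp [gradCLM_single]

theorem HasGrad.sub (hf : HasGrad f v p) (hg : HasGrad g w p) :
    HasGrad (fun q => f q - g q) (fun μ => v μ - w μ) p := by
  refine (hasGrad_of_hasFDerivAt (HasFDerivAt.sub hf hg)).congr_grad fun ν => ?_
  simp [gradCLM_single]

theorem HasGrad.mul (hf : HasGrad f v p) (hg : HasGrad g w p) :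
    HasGrad (fun q => f q * g q) (fun μ => v μ * g p + f p * w μ) p := by
  refine (hasGrad_of_hasFDerivAt (HasFDerivAt.mul hf hg)).congr_grad fun ν => ?_
  simp [gradCLM_single]; ring

theorem HasGrad.const_mul (c : ℝ) (hg : HasGrad g w p) :
    HasGrad (fun q => c * g q) (fun μ => c * w μ) p :=
  ((hasGrad_const c).mul hg).congr_grad fun ν => by simp

theorem HasGrad.comp {u : ℝ → ℝ} {u' : ℝ} (hu : HasDerivAt u u' (f p)) (hf : HasGrad f v p) :
    HasGrad (fun q => u (f q)) (fun μ => u' * v μ) p := by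
  refine (hasGrad_of_hasFDerivAt (HasFDerivAt.comp p hu.hasFDerivAt hf)).congr_grad fun ν => ?_
  simp [gradCLM_single]; ring

theorem HasGrad.sum {ι : Type*} {s : Finset ι} {f : ι → Coord n → ℝ}
    {v : ι → Fin (n + 1) → ℝ} (h : ∀ i ∈ s, HasGrad (f i) (v i) p) :
    HasGrad (fun q => ∑ i ∈ s, f i q) (fun μ => ∑ i ∈ s, v i μ) p := by
  refine (hasGrad_of_hasFDerivAt (HasFDerivAt.fun_sum h)).congr_grad fun ν => ?_
  simp [gradCLM_single]

end Gradient

/-! ### Determinants and inverses of matrices of functions -/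

section Inverse

variable {E : Type*} [NormedAddCommGroup E] [NormedSpace ℝ E]
  {ι : Type*} [Fintype ι] [DecidableEq ι] {M : E → Matrix ι ι ℝ} {p : E} {m : WithTop ℕ∞}

theorem contDiffAt_det (hM : ∀ a b, ContDiffAt ℝ m (fun q => M q a b) p) :
    ContDiffAt ℝ m (fun q => (M q).det) p := by
  simp only [Matrix.det_apply]
  refine ContDiffAt.sum fun σ _ => ContDiffAt.const_smul _ ?_
  exact contDiffAt_prod fun i _ => hM _ _

/-- By Cramer's rule the entries of the inverse are determinants in the entries of `M`, divided by
the non-zero `det M`. -/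
theorem contDiffAt_inv_apply (hM : ∀ a b, ContDiffAt ℝ m (fun q => M q a b) p)
    (hdet : (M p).det ≠ 0) (a b : ι) : ContDiffAt ℝ m (fun q => (M q)⁻¹ a b) p := by
  simp only [Matrix.inv_def, Ring.inverse_eq_inv', Matrix.smul_apply, smul_eq_mul,
    Matrix.adjugate_apply]
  refine ((contDiffAt_det hM).inv hdet).mul (contDiffAt_det fun i j => ?_)
  by_cases h : i = b
  · subst h; simpa using contDiffAt_const
  · simpa [Matrix.updateRow_ne h] using hM i j

/-- Differentiating `M⁻¹ M = 1` gives a linear equation for the derivative of `M⁻¹`, which is then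
solved by multiplying with `M⁻¹` on the right. Differentiability of the inverse is an input here;
Cramer's rule supplies it in the next lemma. -/
theorem hasFDerivAt_inv_apply {M' : ι → ι → E →L[ℝ] ℝ}
    (hM : ∀ a b, HasFDerivAt (fun q => M q a b) (M' a b) p) (hdet : (M p).det ≠ 0)
    (hdiff : ∀ a b, DifferentiableAt ℝ (fun q => (M q)⁻¹ a b) p)
    (hev : ∀ᶠ q in nhds p, (M q).det ≠ 0) (a b : ι) :
    HasFDerivAt (fun q => (M q)⁻¹ a b)
      (-(∑ c, ∑ d, ((M p)⁻¹ a c * (M p)⁻¹ d b) • M' c d)) p := by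
  have hmul : ∀ i j, ∀ v, ∑ c, ((M p)⁻¹ i c * M' c j v
      + fderiv ℝ (fun q => (M q)⁻¹ i c) p v * M p c j) = 0 := by
    intro i j v
    have h1 : HasFDerivAt (fun q => ∑ c, (M q)⁻¹ i c * M q c j)
        (∑ c, ((M p)⁻¹ i c • M' c j + M p c j • fderiv ℝ (fun q => (M q)⁻¹ i c) p)) p :=
      HasFDerivAt.fun_sum fun c _ => (hdiff i c).hasFDerivAt.mul (hM c j)
    have h2 : HasFDerivAt (fun q => ∑ c, (M q)⁻¹ i c * M q c j) (0 : E →L[ℝ] ℝ) p := by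
      refine (hasFDerivAt_const ((1 : Matrix ι ι ℝ) i j) p).congr_of_eventuallyEq ?_
      filter_upwards [hev] with q hq
      rw [← Matrix.nonsing_inv_mul (M q) (isUnit_iff_ne_zero.2 hq), Matrix.mul_apply]
    have h3 := congrArg (fun L : E →L[ℝ] ℝ => L v) (h1.unique h2)
    simpa [sum_apply, mul_comm] using h3
  have key : fderiv ℝ (fun q => (M q)⁻¹ a b) p
      = -(∑ c, ∑ d, ((M p)⁻¹ a c * (M p)⁻¹ d b) • M' c d) := by
    ext v
    set N : Matrix ι ι ℝ := Matrix.of fun i j => M' i j v with hN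
    set D : Matrix ι ι ℝ := Matrix.of fun i j => fderiv ℝ (fun q => (M q)⁻¹ i j) p v with hD
    have h1 : (M p)⁻¹ * N + D * M p = 0 := by
      ext i j
      have := hmul i j v
      rw [Finset.sum_add_distrib] at this
      simpa [Matrix.mul_apply, hN, hD] using this
    have h2 : D = - ((M p)⁻¹ * N * (M p)⁻¹) := by
      have h3 : D * M p = - ((M p)⁻¹ * N) := by
        rw [add_comm] at h1; exact eq_neg_of_add_eq_zero_left h1
      calc D = D * M p * (M p)⁻¹ := by
            rw [Matrix.mul_assoc, Matrix.mul_nonsing_inv _ (isUnit_iff_ne_zero.2 hdet),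
              Matrix.mul_one]
        _ = _ := by rw [h3, Matrix.neg_mul]
    have h4 := congrFun (congrFun h2 a) b
    have h5 : D a b = fderiv ℝ (fun q => (M q)⁻¹ a b) p v := rfl
    rw [← h5, h4]
    simp only [Matrix.neg_apply, Matrix.mul_apply, neg_apply,
      sum_apply, smul_apply, smul_eq_mul, Finset.sum_mul]
    rw [Finset.sum_comm]
    congr 1
    refine Finset.sum_congr rfl fun c _ => Finset.sum_congr rfl fun d _ => ?_
    simp [hN]; ring
  rw [← key]
  exact (hdiff a b).hasFDerivAt

theorem hasFDerivAt_inv_apply_of_contDiffAt {M' : ι → ι → E →L[ℝ] ℝ}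
    (hc : ∀ a b, ContDiffAt ℝ 1 (fun q => M q a b) p)
    (hM : ∀ a b, HasFDerivAt (fun q => M q a b) (M' a b) p) (hdet : (M p).det ≠ 0) (a b : ι) :
    HasFDerivAt (fun q => (M q)⁻¹ a b)
      (-(∑ c, ∑ d, ((M p)⁻¹ a c * (M p)⁻¹ d b) • M' c d)) p :=
  hasFDerivAt_inv_apply hM hdet
    (fun i j => (contDiffAt_inv_apply hc hdet i j).differentiableAt one_ne_zero)
    ((contDiffAt_det hc).continuousAt.eventually_ne hdet) a b

end Inverse

/-! ### The Riemann tensor and the Lagrangian density as functions of the 2-jet of the metric -/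

/-- The values of `g_{ab}`, `∂_c g_{ab}` and `∂_c ∂_d g_{ab}` at a point. -/
abbrev Jet (n : ℕ) := Tensor2 n × (Fin (n + 1) → Tensor2 n) ×
  (Fin (n + 1) → Fin (n + 1) → Tensor2 n)

section Jets

variable {n : ℕ}

/-- The 2-jet at `p` of a field of 2-tensors. -/
noncomputable def jet (g : Coord n → Tensor2 n) (p : Coord n) : Jet n :=
  (g p, fun c a b => pd c (fun q => g q a b) p,
    fun c d a b => pd c (fun q => pd d (fun r => g r a b) q) p)

/-- `∂_a g_{bd} + ∂_b g_{ad} - ∂_d g_{ab}`. -/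
def lowerChristoffel (j : Jet n) (a b d : Fin (n + 1)) : ℝ :=
  j.2.1 a b d + j.2.1 b a d - j.2.1 d a b

/-- The Riemann tensor `R_{abcd}` as a function of the 2-jet of the metric. -/
noncomputable def riemannJet (j : Jet n) : Tensor4 n := fun a b c d =>
  (1 / 2) * (j.2.2 b c a d - j.2.2 b d a c - j.2.2 a c b d + j.2.2 a d b c)
    + (1 / 4) * ∑ e, ∑ f, (Matrix.of j.1)⁻¹ e f *
      (lowerChristoffel j a d e * lowerChristoffel j b c f
        - lowerChristoffel j b d e * lowerChristoffel j a c f)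

/-- The pair `(g^{ab}, R_{abcd})` as a function of the 2-jet of the metric. -/
noncomputable def curvatureJet (j : Jet n) : Tensor2 n × Tensor4 n :=
  (fun a b => (Matrix.of j.1)⁻¹ a b, riemannJet j)

/-- The Lagrangian density as a function of the 2-jet of the metric. -/
noncomputable def densityJet (T : GravityTheory n) (j : Jet n) : ℝ :=
  Real.sqrt |(Matrix.of j.1).det| * T.lagrangian (curvatureJet j)

/-- The 2-jets at which the Lagrangian density is defined. -/
def jetDomain (T : GravityTheory n) : Set (Jet n) :=
  {j | (Matrix.of j.1).det ≠ 0 ∧ curvatureJet j ∈ T.domain}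

theorem pd_comm {f : Coord n → ℝ} {p : Coord n} (hf : ContDiffAt ℝ 2 f p) (μ ν : Fin (n + 1)) :
    pd μ (fun q => pd ν f q) p = pd ν (fun q => pd μ f q) p := by
  have hd : DifferentiableAt ℝ (fderiv ℝ f) p :=
    (hf.fderiv_right (m := 1) (by norm_num)).differentiableAt one_ne_zero
  have h : ∀ v w : Coord n, fderiv ℝ (fun q => fderiv ℝ f q v) p w
      = fderiv ℝ (fderiv ℝ f) p w v := by
    intro v w
    rw [fderiv_clm_apply hd (differentiableAt_const v)]
    simp
  have hs : IsSymmSndFDerivAt ℝ f p := hf.isSymmSndFDerivAt (by simp)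
  simp only [pd]
  rw [h, h]
  exact hs.eq _ _

theorem contDiffAt_pd {f : Coord n → ℝ} {p : Coord n} {m m' : WithTop ℕ∞}
    (hf : ContDiffAt ℝ m' f p) (hm : m + 1 ≤ m') (μ : Fin (n + 1)) :
    ContDiffAt ℝ m (fun q => pd μ f q) p :=
  (hf.fderiv_right hm).clm_apply contDiffAt_const

variable {g : Coord n → Tensor2 n} {p : Coord n}

theorem hasGrad_inverseMetric (hg : ∀ a b, ContDiffAt ℝ 1 (fun q => g q a b) p)
    (hdet : (Matrix.of (g p)).det ≠ 0) (a b : Fin (n + 1)) :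
    HasGrad (fun q => inverseMetric g q a b)
      (fun μ => - ∑ c, ∑ d, inverseMetric g p a c * inverseMetric g p d b *
        pd μ (fun q => g q c d) p) p := by
  have h := hasFDerivAt_inv_apply_of_contDiffAt (M := fun q => Matrix.of (g q)) (p := p) hg
    (fun c d => hasGrad_pd ((hg c d).differentiableAt one_ne_zero)) hdet a b
  refine (hasGrad_of_hasFDerivAt h).congr_grad fun μ => ?_
  simp [gradCLM_single, inverseMetric]

theorem inverseMetric_symm (hs : ∀ a b, g p a b = g p b a) (a b : Fin (n + 1)) :
    inverseMetric g p a b = inverseMetric g p b a := by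
  have h : (Matrix.of (g p)).transpose = Matrix.of (g p) := by
    ext i j; exact hs j i
  have h2 := Matrix.transpose_nonsing_inv (Matrix.of (g p))
  rw [h] at h2
  exact congrFun (congrFun h2 b) a

theorem sum_inverseMetric_mul (hdet : (Matrix.of (g p)).det ≠ 0) (a b : Fin (n + 1)) :
    ∑ c, inverseMetric g p a c * g p c b = if a = b then 1 else 0 := by
  have := congrFun (congrFun (Matrix.nonsing_inv_mul _ (isUnit_iff_ne_zero.2 hdet)) a) b
  rw [Matrix.mul_apply, Matrix.one_apply] at this
  exact this

/-- The gradient of the Christoffel symbols. -/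
theorem hasGrad_christoffel (hg : ∀ a b, ContDiffAt ℝ 2 (fun q => g q a b) p)
    (hdet : (Matrix.of (g p)).det ≠ 0) (a b c : Fin (n + 1)) :
    HasGrad (fun q => christoffel g q a b c)
      (fun μ => (1 / 2) * ∑ d, ((- ∑ e, ∑ f, inverseMetric g p c e * inverseMetric g p f d *
        pd μ (fun q => g q e f) p) * lowerChristoffel (jet g p) a b d
        + inverseMetric g p c d * ((jet g p).2.2 μ a b d + (jet g p).2.2 μ b a d
          - (jet g p).2.2 μ d a b))) p := by
  have h1 : ∀ a b, ContDiffAt ℝ 1 (fun q => g q a b) p := fun a b => (hg a b).of_le (by norm_num)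
  have h2 : ∀ a b d, HasGrad (fun q => pd d (fun r => g r a b) q)
      (fun μ => (jet g p).2.2 μ d a b) p := fun a b d =>
    hasGrad_pd ((contDiffAt_pd (m := 1) (hg a b) (by norm_num) d).differentiableAt one_ne_zero)
  exact HasGrad.const_mul _ (HasGrad.sum fun d _ =>
    (hasGrad_inverseMetric h1 hdet c d).mul (((h2 _ _ _).add (h2 _ _ _)).sub (h2 _ _ _)))

theorem christoffel_eq (a b c : Fin (n + 1)) : christoffel g p a b c =
    (1 / 2) * ∑ d, inverseMetric g p c d * lowerChristoffel (jet g p) a b d := rfl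

/-- Lowering the upper index removes the inverse metric. Differentiating this relation gives the
derivative of the Christoffel symbols with no derivative of the inverse metric in it. -/
theorem sum_christoffel_mul (hdet : (Matrix.of (g p)).det ≠ 0)
    (hs : ∀ a b, g p a b = g p b a) (a b f : Fin (n + 1)) :
    ∑ d, christoffel g p a b d * g p d f = (1 / 2) * lowerChristoffel (jet g p) a b f := by
  have h : ∀ d, christoffel g p a b d * g p d f
      = ∑ e, (1 / 2) * lowerChristoffel (jet g p) a b e * (inverseMetric g p e d * g p d f) := by
    intro d
    rw [christoffel_eq, Finset.mul_sum, Finset.sum_mul]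
    refine Finset.sum_congr rfl fun e _ => ?_
    rw [inverseMetric_symm hs d e]; ring
  simp_rw [h]
  rw [Finset.sum_comm]
  simp_rw [← Finset.mul_sum, sum_inverseMetric_mul hdet]
  simp

/-- The Riemann tensor at a point is a function of the 2-jet of the metric. -/
theorem riemann_eq_riemannJet (hg : ∀ a b, ContDiffAt ℝ 2 (fun q => g q a b) p)
    (hdet : (Matrix.of (g p)).det ≠ 0) (hs : ∀ q a b, g q a b = g q b a) :
    riemann g p = riemannJet (jet g p) := by
  have hlow := sum_christoffel_mul hdet (hs p)
  have hcomm : ∀ c d a b, (jet g p).2.2 c d a b = (jet g p).2.2 d c a b := fun c d a b =>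
    pd_comm (hg a b) c d
  have hsym2 : ∀ c d a b, (jet g p).2.2 c d a b = (jet g p).2.2 c d b a := by
    intro c d a b; simp only [jet]; simp_rw [hs _ a b]
  have hsym1 : ∀ c a b, (jet g p).2.1 c a b = (jet g p).2.1 c b a := by
    intro c a b; simp only [jet]; simp_rw [hs _ a b]
  -- the derivative of the Christoffel symbol with its upper index lowered
  have hpd : ∀ μ a b f, ∑ d, pd μ (fun q => christoffel g q a b d) p * g p d f
      = (1 / 2) * ((jet g p).2.2 μ a b f + (jet g p).2.2 μ b a f - (jet g p).2.2 μ f a b)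
        - ∑ d, (jet g p).2.1 μ f d * christoffel g p a b d := by
    intro μ a b f
    have h0 : ∀ d, HasGrad (fun q => christoffel g q a b d * g q d f)
        (fun ν => pd ν (fun q => christoffel g q a b d) p * g p d f
          + christoffel g p a b d * (jet g p).2.1 ν d f) p := fun d =>
      ((hasGrad_christoffel hg hdet a b d).congr_grad fun ν =>
        ((hasGrad_christoffel hg hdet a b d).pd ν).symm).mul
        (hasGrad_pd ((hg d f).differentiableAt two_ne_zero))
    have h1 := HasGrad.sum (s := Finset.univ) fun d _ => h0 d
    have h2 : ∀ a b d, HasGrad (fun q => pd d (fun r => g r a b) q)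
        (fun μ => (jet g p).2.2 μ d a b) p := fun a b d =>
      hasGrad_pd ((contDiffAt_pd (m := 1) (hg a b) (by norm_num) d).differentiableAt one_ne_zero)
    have h3 : HasGrad (fun q => (1 / 2) * lowerChristoffel (jet g q) a b f) _ p :=
      HasGrad.const_mul _ (((h2 _ _ _).add (h2 _ _ _)).sub (h2 _ _ _))
    -- The lowered symbol is linear in the first derivatives of the metric on a whole neighbourhood
    -- of `p`, so both sides have the same gradient. Leibniz' rule on the left then isolates the
    -- wanted term.
    have hev : (fun q => ∑ d, christoffel g q a b d * g q d f) =ᶠ[nhds p]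
        fun q => (1 / 2) * lowerChristoffel (jet g q) a b f := by
      have : ∀ᶠ q in nhds p, (Matrix.of (g q)).det ≠ 0 :=
        (contDiffAt_det (M := fun q => Matrix.of (g q)) hg).continuousAt.eventually_ne hdet
      filter_upwards [this] with q hq
      exact sum_christoffel_mul hq (hs q) a b f
    have h4 := (h3.congr hev).pd μ
    rw [h1.pd μ, Finset.sum_add_distrib] at h4
    rw [eq_sub_iff_add_eq, ← h4]
    congr 1
    refine Finset.sum_congr rfl fun d _ => ?_
    rw [hsym1 μ f d]; ring
  funext a b c f
  have h1 : ∀ a b, ∑ d, ∑ e, (christoffel g p c a e * christoffel g p b e d) * g p d f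
      = ∑ e, christoffel g p a c e * ((1 / 2) * lowerChristoffel (jet g p) b e f) := by
    intro a b
    rw [Finset.sum_comm]
    refine Finset.sum_congr rfl fun e _ => ?_
    rw [← hlow b e f, Finset.mul_sum]
    refine Finset.sum_congr rfl fun d _ => ?_
    have : christoffel g p c a e = christoffel g p a c e := by
      simp only [christoffel_eq, lowerChristoffel]
      congr 1
      refine Finset.sum_congr rfl fun x _ => ?_
      rw [hsym1 x c a]; ring
    rw [this]; ring
  have h2 : riemann g p a b c f
      = (∑ d, pd b (fun q => christoffel g q a c d) p * g p d f)
        - (∑ d, pd a (fun q => christoffel g q b c d) p * g p d f)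
        + ((∑ d, ∑ e, (christoffel g p c a e * christoffel g p b e d) * g p d f)
        - (∑ d, ∑ e, (christoffel g p c b e * christoffel g p a e d) * g p d f)) := by
    simp only [riemann, riemannUp]
    rw [← Finset.sum_sub_distrib, ← Finset.sum_sub_distrib, ← Finset.sum_add_distrib]
    refine Finset.sum_congr rfl fun d _ => ?_
    rw [← Finset.sum_sub_distrib, add_mul, sub_mul, Finset.sum_mul]
    congr 1
    refine Finset.sum_congr rfl fun e _ => ?_
    ring
  have h3 : ∀ a b, ∑ e, ∑ e', (Matrix.of (g p))⁻¹ e e' * (lowerChristoffel (jet g p) a f e *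
      lowerChristoffel (jet g p) b c e') = 2 * ∑ e, lowerChristoffel (jet g p) a f e *
        christoffel g p b c e := by
    intro a b
    rw [Finset.mul_sum]
    refine Finset.sum_congr rfl fun e _ => ?_
    rw [christoffel_eq, Finset.mul_sum, Finset.mul_sum, Finset.mul_sum]
    refine Finset.sum_congr rfl fun e' _ => ?_
    simp only [inverseMetric]; ring
  rw [h2, hpd, hpd, h1, h1]
  simp only [riemannJet, mul_sub, Finset.sum_sub_distrib]
  have h4 : (jet g p).1 = g p := rfl
  rw [h4, h3, h3]
  -- The quadratic terms in the Christoffel symbols and the terms from lowering the index of their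
  -- derivative recombine into one product, because `∂_b g_{ef}` is half the sum of two lowered
  -- symbols.
  have h5 : ∀ a b, ∑ e, christoffel g p a c e * ((1 / 2) * lowerChristoffel (jet g p) b e f)
      - ∑ d, (jet g p).2.1 b f d * christoffel g p a c d
      = - ((1 / 2) * ∑ e, lowerChristoffel (jet g p) b f e * christoffel g p a c e) := by
    intro a b
    rw [← Finset.sum_sub_distrib, Finset.mul_sum, ← Finset.sum_neg_distrib]
    refine Finset.sum_congr rfl fun e _ => ?_
    simp only [lowerChristoffel]
    rw [hsym1 b e f, hsym1 e b f]; ring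
  have h6 := h5 a b
  have h7 := h5 b a
  linarith [h6, h7, hcomm b a c f]

theorem contDiffAt_riemannJet {j : Jet n} (hdet : (Matrix.of j.1).det ≠ 0) :
    ContDiffAt ℝ ∞ (riemannJet (n := n)) j := by
  have hinv : ∀ e f, ContDiffAt ℝ ∞ (fun j : Jet n => (Matrix.of j.1)⁻¹ e f) j := fun e f =>
    contDiffAt_inv_apply (M := fun j : Jet n => Matrix.of j.1)
      (fun a b => by simp only [Matrix.of_apply]; fun_prop) hdet e f
  have hS : ∀ a b d, ContDiffAt ℝ ∞ (fun j : Jet n => lowerChristoffel j a b d) j := by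
    intro a b d; simp only [lowerChristoffel]; fun_prop
  refine contDiffAt_pi.2 fun a => contDiffAt_pi.2 fun b => contDiffAt_pi.2 fun c =>
    contDiffAt_pi.2 fun d => ?_
  simp only [riemannJet]
  refine ContDiffAt.add (by fun_prop) (contDiffAt_const.mul ?_)
  exact ContDiffAt.sum fun e _ => ContDiffAt.sum fun f _ => (hinv e f).mul
    (((hS _ _ _).mul (hS _ _ _)).sub ((hS _ _ _).mul (hS _ _ _)))

theorem contDiffAt_curvatureJet {j : Jet n} (hdet : (Matrix.of j.1).det ≠ 0) :
    ContDiffAt ℝ ∞ (curvatureJet (n := n)) j := by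
  refine ContDiffAt.prodMk ?_ (contDiffAt_riemannJet hdet)
  exact contDiffAt_pi.2 fun a => contDiffAt_pi.2 fun b =>
    contDiffAt_inv_apply (M := fun j : Jet n => Matrix.of j.1)
      (fun a b => by simp only [Matrix.of_apply]; fun_prop) hdet a b

theorem contDiffAt_detJet (j : Jet n) :
    ContDiffAt ℝ ∞ (fun j : Jet n => (Matrix.of j.1).det) j :=
  contDiffAt_det (M := fun j : Jet n => Matrix.of j.1)
    (fun a b => by simp only [Matrix.of_apply]; fun_prop)

variable {T : GravityTheory n}

/-- Openness is what keeps `g + ε h` in the domain of the Lagrangian for small `ε`, uniformly on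
compact sets. -/
theorem isOpen_jetDomain : IsOpen (jetDomain T) := by
  rw [isOpen_iff_mem_nhds]
  rintro j ⟨hj, hjT⟩
  filter_upwards [(contDiffAt_detJet j).continuousAt.eventually_ne hj,
    (contDiffAt_curvatureJet hj).continuousAt.preimage_mem_nhds (T.isOpen_domain.mem_nhds hjT)]
    with i h1 h2
  exact ⟨h1, h2⟩

theorem contDiffAt_densityJet {j : Jet n} (hj : j ∈ jetDomain T) :
    ContDiffAt ℝ ∞ (densityJet T) j := by
  have h1 := contDiffAt_detJet j
  refine ContDiffAt.mul ?_ ?_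
  · exact ((contDiffAt_abs hj.1).comp j h1).sqrt (by simpa using hj.1)
  · exact ((T.smooth _ hj.2).contDiffAt (T.isOpen_domain.mem_nhds hj.2)).comp j
      (contDiffAt_curvatureJet hj.1)

theorem curvatureData_eq_curvatureJet (hg : ∀ a b, ContDiffAt ℝ 2 (fun q => g q a b) p)
    (hdet : (Matrix.of (g p)).det ≠ 0) (hs : ∀ q a b, g q a b = g q b a) :
    curvatureData g p = curvatureJet (jet g p) := by
  rw [curvatureData, riemann_eq_riemannJet hg hdet hs]
  rfl

theorem density_eq_densityJet (hg : ∀ a b, ContDiffAt ℝ 2 (fun q => g q a b) p)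
    (hdet : (Matrix.of (g p)).det ≠ 0) (hs : ∀ q a b, g q a b = g q b a) :
    density T g p = densityJet T (jet g p) := by
  rw [density, curvatureData_eq_curvatureJet hg hdet hs]
  rfl

/-- Since jets are linear in the field, a linear family of metrics is a straight line in jet space
and the action can be differentiated pointwise along it. -/
theorem jet_add_smul {h : Coord n → Tensor2 n} (hg : ∀ a b, ContDiffAt ℝ 2 (fun q => g q a b) p)
    (hh : ∀ a b, ContDiffAt ℝ 2 (fun q => h q a b) p) (ε : ℝ) :
    jet (fun q => g q + ε • h q) p = jet g p + ε • jet h p := by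
  have h1 : ∀ {u v : Coord n → ℝ} {q : Coord n}, DifferentiableAt ℝ u q →
      DifferentiableAt ℝ v q → ∀ c, pd c (fun r => u r + ε * v r) q = pd c u q + ε * pd c v q :=
    fun hu hv c => ((hasGrad_pd hu).add ((hasGrad_pd hv).const_mul ε)).pd c
  refine Prod.ext rfl (Prod.ext ?_ ?_)
  · funext c a b
    exact h1 ((hg a b).differentiableAt two_ne_zero) ((hh a b).differentiableAt two_ne_zero) c
  · funext c d a b
    have hev : (fun q => pd d (fun r => (g r + ε • h r) a b) q) =ᶠ[nhds p]
        fun q => pd d (fun r => g r a b) q + ε * pd d (fun r => h r a b) q := by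
      filter_upwards [(hg a b).eventually (by simp), (hh a b).eventually (by simp)] with q h2 h3
      exact h1 (h2.differentiableAt two_ne_zero) (h3.differentiableAt two_ne_zero) d
    have h4 : ∀ {u : Coord n → ℝ}, ContDiffAt ℝ 2 u p → DifferentiableAt ℝ (fun q => pd d u q) p :=
      fun hu => (contDiffAt_pd (m := 1) hu (by norm_num) d).differentiableAt one_ne_zero
    change pd c (fun q => pd d (fun r => (g r + ε • h r) a b) q) p = _
    rw [pd, hev.fderiv_eq]
    exact h1 (h4 (hg a b)) (h4 (hh a b)) c

end Jets

/-! ### The spatial metric of constant curvature -/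

section Spatial

variable {n : ℕ}

/-- The spatial metric `|dx|² + k (x · dx)² / (1 - k r²)`. -/
noncomputable def spatialMetric (k : ℝ) (x : Fin n → ℝ) (i j : Fin n) : ℝ :=
  (if i = j then 1 else 0) + k * x i * x j / (1 - k * radiusSq x)

/-- The inverse of the spatial metric. -/
noncomputable def spatialInverse (k : ℝ) (x : Fin n → ℝ) (i j : Fin n) : ℝ :=
  (if i = j then 1 else 0) - k * x i * x j

theorem spatialMetric_symm (k : ℝ) (x : Fin n → ℝ) (i j : Fin n) :
    spatialMetric k x i j = spatialMetric k x j i := by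
  simp only [spatialMetric, eq_comm (a := i)]; ring

theorem spatialInverse_symm (k : ℝ) (x : Fin n → ℝ) (i j : Fin n) :
    spatialInverse k x i j = spatialInverse k x j i := by
  simp only [spatialInverse, eq_comm (a := i)]; ring

theorem sum_sq_eq (x : Fin n → ℝ) : ∑ i, x i * x i = radiusSq x := by
  simp [radiusSq, pow_two]

variable {k : ℝ} {x : Fin n → ℝ}

/-- This is the Sherman-Morrison formula: both tensors are perturbations of the identity by
multiples of `x xᵀ`, and `xᵀ x = r²`. -/
theorem sum_spatialInverse_mul_metric (hx : 1 - k * radiusSq x ≠ 0) (i j : Fin n) :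
    ∑ l, spatialInverse k x i l * spatialMetric k x l j = if i = j then 1 else 0 := by
  have h : ∀ l, spatialInverse k x i l * spatialMetric k x l j
      = (if i = l then (if l = j then 1 else 0) + k * x l * x j / (1 - k * radiusSq x) else 0)
        - (if l = j then k * x i * x l else 0)
        - k * k * x i * x j / (1 - k * radiusSq x) * (x l * x l) := by
    intro l
    simp only [spatialInverse, spatialMetric]
    split_ifs <;> ring
  simp_rw [h, Finset.sum_sub_distrib, ← Finset.mul_sum, sum_sq_eq]
  simp only [Finset.sum_ite_eq, Finset.sum_ite_eq', Finset.mem_univ, if_true]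
  field_simp
  ring

/-- The position vector is an eigenvector of the inverse metric. This collapses the contractions
with `x` that the spatial Christoffel symbols `k x^l γ_{ij}` produce. -/
theorem sum_spatialInverse_mul_coord (i : Fin n) :
    ∑ l, spatialInverse k x i l * x l = (1 - k * radiusSq x) * x i := by
  have h : ∀ l, spatialInverse k x i l * x l
      = (if i = l then x l else 0) - k * x i * (x l * x l) := by
    intro l
    simp only [spatialInverse]
    split_ifs <;> ring
  simp_rw [h, Finset.sum_sub_distrib, ← Finset.mul_sum, sum_sq_eq]
  simp only [Finset.sum_ite_eq, Finset.mem_univ, if_true]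
  ring

theorem sum_spatialMetric_mul_coord (hx : 1 - k * radiusSq x ≠ 0) (i : Fin n) :
    ∑ l, spatialMetric k x i l * x l = x i / (1 - k * radiusSq x) := by
  have h : ∀ l, spatialMetric k x i l * x l
      = (if i = l then x l else 0) + k * x i / (1 - k * radiusSq x) * (x l * x l) := by
    intro l
    simp only [spatialMetric]
    split_ifs <;> ring
  simp_rw [h, Finset.sum_add_distrib, ← Finset.mul_sum, sum_sq_eq]
  simp only [Finset.sum_ite_eq, Finset.mem_univ, if_true]
  field_simp
  ring

end Spatial

/-! ### The FLRW metric -/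

section Flrw

variable {n : ℕ} {k : ℝ} {a F : ℝ → ℝ} {p : Coord n}

@[simp] theorem tail_apply (p : Coord n) (i : Fin n) : Fin.tail p i = p i.succ := rfl

@[simp] theorem flrw_zero_zero : flrw k a F p 0 0 = - F (p 0) := by simp [flrw]

@[simp] theorem flrw_zero_succ (i : Fin n) : flrw k a F p 0 i.succ = 0 := by
  simp [flrw]

@[simp] theorem flrw_succ_zero (i : Fin n) : flrw k a F p i.succ 0 = 0 := by
  simp [flrw]

@[simp] theorem flrw_succ_succ (i j : Fin n) :
    flrw k a F p i.succ j.succ = a (p 0) ^ 2 * spatialMetric k (Fin.tail p) i j := by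
  simp [flrw, spatialMetric]

theorem flrw_symm (p : Coord n) (μ ν : Fin (n + 1)) : flrw k a F p μ ν = flrw k a F p ν μ := by
  refine Fin.cases ?_ (fun i => ?_) μ <;> refine Fin.cases ?_ (fun j => ?_) ν <;> simp
  rw [spatialMetric_symm]
  simp

theorem hasGrad_radiusSq : HasGrad (fun q : Coord n => radiusSq (Fin.tail q))
    (Fin.cons 0 fun i => 2 * p i.succ) p := by
  have h : ∀ i ∈ Finset.univ, HasGrad (fun q : Coord n => (q (Fin.succ i)) ^ 2)
      (fun ν => 2 * p i.succ * if ν = i.succ then 1 else 0) p := fun i _ => by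
    have := (hasGrad_coord (p := p) (Fin.succ i)).mul (hasGrad_coord (p := p) (Fin.succ i))
    simp only [← pow_two] at this
    exact this.congr_grad fun μ => by ring
  refine (HasGrad.sum h).congr_grad fun μ => ?_
  refine Fin.cases ?_ (fun i => ?_) μ
  · simp [Fin.succ_ne_zero, eq_comm (a := (0 : Fin (n + 1)))]
  · simp [Fin.succ_inj]

theorem continuous_radiusSq_tail : Continuous fun q : Coord n => radiusSq (Fin.tail q) := by
  simp only [radiusSq, tail_apply]; fun_prop

/-- The gradient of the spatial metric. -/
theorem hasGrad_spatialMetric (hx : 1 - k * radiusSq (Fin.tail p) ≠ 0) (i j : Fin n) :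
    HasGrad (fun q => spatialMetric k (Fin.tail q) i j)
      (Fin.cons 0 fun l => k / (1 - k * radiusSq (Fin.tail p)) *
        (p i.succ * spatialMetric k (Fin.tail p) j l
          + p j.succ * spatialMetric k (Fin.tail p) i l)) p := by
  have h1 := ((hasGrad_const (p := p) 1).sub (hasGrad_radiusSq.const_mul k))
  have h2 := HasGrad.comp (hasDerivAt_inv hx) h1
  have h3 := (hasGrad_const (if i = j then 1 else 0)).add
    ((((hasGrad_coord (p := p) i.succ).const_mul k).mul (hasGrad_coord j.succ)).mul h2)
  have h4 : HasGrad (fun q => spatialMetric k (Fin.tail q) i j) _ p := h3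
  refine h4.congr_grad fun μ => ?_
  refine Fin.cases ?_ (fun l => ?_) μ
  · simp [eq_comm (a := (0 : Fin (n + 1)))]
  · simp only [Fin.cons_succ, spatialMetric, tail_apply, Fin.succ_inj, eq_comm (a := l)]
    field_simp
    ring

theorem isOpen_flrwDomain {I : Set ℝ} (hI : IsOpen I) : IsOpen (flrwDomain n k I) := by
  refine (hI.preimage (continuous_apply 0)).inter ?_
  exact isOpen_lt continuous_const
    (continuous_const.sub (continuous_const.mul continuous_radiusSq_tail))

/-- The scale factor `a` and the lapse function `F` are smooth and positive on the open set `I`. -/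
structure ScaleLapse (I : Set ℝ) (a F : ℝ → ℝ) : Prop where
  isOpen : IsOpen I
  smooth_scale : ContDiffOn ℝ ∞ a I
  smooth_lapse : ContDiffOn ℝ ∞ F I
  scale_pos : ∀ t ∈ I, 0 < a t
  lapse_pos : ∀ t ∈ I, 0 < F t

theorem ContDiffOn.deriv_infty {I : Set ℝ} {u : ℝ → ℝ} (hI : IsOpen I)
    (hu : ContDiffOn ℝ ∞ u I) : ContDiffOn ℝ ∞ (deriv u) I :=
  hu.deriv_of_isOpen hI (by simp)

theorem ContDiffOn.hasDerivAt_infty {I : Set ℝ} {u : ℝ → ℝ} (hI : IsOpen I)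
    (hu : ContDiffOn ℝ ∞ u I) {t : ℝ} (ht : t ∈ I) : HasDerivAt u (deriv u t) t :=
  ((hu.differentiableOn (by simp)).differentiableAt (hI.mem_nhds ht)).hasDerivAt

theorem hasGrad_time {u : ℝ → ℝ} {u' : ℝ} (hu : HasDerivAt u u' (p 0)) :
    HasGrad (fun q => u (q 0)) (Fin.cons u' fun _ => 0) p := by
  refine (HasGrad.comp hu (hasGrad_coord (p := p) 0)).congr_grad fun μ => ?_
  refine Fin.cases ?_ (fun l => ?_) μ <;> simp

theorem hasGrad_time_mul_spatialMetric {u : ℝ → ℝ} {u' : ℝ} (hu : HasDerivAt u u' (p 0))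
    (hx : 1 - k * radiusSq (Fin.tail p) ≠ 0) (i j : Fin n) :
    HasGrad (fun q => u (q 0) * spatialMetric k (Fin.tail q) i j)
      (Fin.cons (u' * spatialMetric k (Fin.tail p) i j)
        fun l => u (p 0) * (k / (1 - k * radiusSq (Fin.tail p)) *
        (p i.succ * spatialMetric k (Fin.tail p) j l
          + p j.succ * spatialMetric k (Fin.tail p) i l))) p := by
  refine ((hasGrad_time hu).mul (hasGrad_spatialMetric hx i j)).congr_grad fun μ => ?_
  refine Fin.cases ?_ (fun l => ?_) μ <;> simp

section AtPoint

variable {I : Set ℝ}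

theorem ScaleLapse.hasDerivAt_scale (h : ScaleLapse I a F) {t : ℝ} (ht : t ∈ I) :
    HasDerivAt a (deriv a t) t := ContDiffOn.hasDerivAt_infty h.isOpen h.smooth_scale ht

theorem ScaleLapse.hasDerivAt_lapse (h : ScaleLapse I a F) {t : ℝ} (ht : t ∈ I) :
    HasDerivAt F (deriv F t) t := ContDiffOn.hasDerivAt_infty h.isOpen h.smooth_lapse ht

theorem ScaleLapse.hasDerivAt_deriv_scale (h : ScaleLapse I a F) {t : ℝ} (ht : t ∈ I) :
    HasDerivAt (deriv a) (deriv (deriv a) t) t :=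
  ContDiffOn.hasDerivAt_infty h.isOpen (ContDiffOn.deriv_infty h.isOpen h.smooth_scale) ht

theorem ScaleLapse.hasDerivAt_deriv_lapse (h : ScaleLapse I a F) {t : ℝ} (ht : t ∈ I) :
    HasDerivAt (deriv F) (deriv (deriv F) t) t :=
  ContDiffOn.hasDerivAt_infty h.isOpen (ContDiffOn.deriv_infty h.isOpen h.smooth_lapse) ht

theorem contDiffAt_radiusSq_tail {m : WithTop ℕ∞} :
    ContDiffAt ℝ m (fun q : Coord n => radiusSq (Fin.tail q)) p := by
  simp only [radiusSq, tail_apply]; fun_prop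

theorem contDiffAt_spatialMetric {m : WithTop ℕ∞} (hx : 1 - k * radiusSq (Fin.tail p) ≠ 0)
    (i j : Fin n) : ContDiffAt ℝ m (fun q : Coord n => spatialMetric k (Fin.tail q) i j) p := by
  simp only [spatialMetric, tail_apply]
  exact contDiffAt_const.add ((by fun_prop : ContDiffAt ℝ m _ p).div
    (contDiffAt_const.sub (contDiffAt_const.mul contDiffAt_radiusSq_tail)) hx)

theorem contDiffAt_time {u : ℝ → ℝ} (hI : IsOpen I) (hu : ContDiffOn ℝ ∞ u I) (hp : p 0 ∈ I) :
    ContDiffAt ℝ ∞ (fun q : Coord n => u (q 0)) p :=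
  ContDiffAt.comp (g := u) p (hu.contDiffAt (hI.mem_nhds hp)) (by fun_prop)

theorem ScaleLapse.contDiffAt_flrw (h : ScaleLapse I a F) (hp : p ∈ flrwDomain n k I)
    (μ ν : Fin (n + 1)) : ContDiffAt ℝ ∞ (fun q => flrw k a F q μ ν) p := by
  refine Fin.cases ?_ (fun i => ?_) μ <;> refine Fin.cases ?_ (fun j => ?_) ν <;> simp
  · exact (contDiffAt_time h.isOpen h.smooth_lapse hp.1).neg
  · exact contDiffAt_const
  · exact contDiffAt_const
  · exact ((contDiffAt_time h.isOpen h.smooth_scale hp.1).pow 2).mul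
      (contDiffAt_spatialMetric hp.2.ne' i j)

/-- The determinant of the spatial metric. -/
theorem det_spatialMetric {x : Fin n → ℝ} (hx : 1 - k * radiusSq x ≠ 0) :
    (Matrix.of (spatialMetric k x)).det = 1 / (1 - k * radiusSq x) := by
  -- A rank one perturbation of the identity, prepared for the matrix determinant lemma.
  have h : Matrix.of (spatialMetric k x) = 1 + Matrix.replicateCol Unit
      (fun i => k / (1 - k * radiusSq x) * x i) * Matrix.replicateRow Unit x := by
    ext i j
    simp [spatialMetric, Matrix.mul_apply, Matrix.one_apply]
    ring
  rw [h, Matrix.det_one_add_replicateCol_mul_replicateRow]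
  have : x ⬝ᵥ (fun i => k / (1 - k * radiusSq x) * x i)
      = k / (1 - k * radiusSq x) * radiusSq x := by
    calc _ = ∑ i, k / (1 - k * radiusSq x) * (x i * x i) :=
          Finset.sum_congr rfl fun i _ => by ring
      _ = _ := by rw [← Finset.mul_sum, sum_sq_eq]
  rw [this]
  field_simp
  ring

theorem det_flrw (hx : 1 - k * radiusSq (Fin.tail p) ≠ 0) :
    (Matrix.of (flrw k a F p)).det
      = - (F (p 0) * (a (p 0) ^ 2) ^ n / (1 - k * radiusSq (Fin.tail p))) := by
  rw [Matrix.det_succ_row_zero, Fin.sum_univ_succ]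
  have h : (Matrix.of (flrw k a F p)).submatrix Fin.succ (Fin.succAbove 0)
      = a (p 0) ^ 2 • Matrix.of (spatialMetric k (Fin.tail p)) := by
    ext i j; simp
  rw [h, Matrix.det_smul, det_spatialMetric hx]
  simp
  ring

theorem ScaleLapse.det_flrw_ne_zero (h : ScaleLapse I a F) (hp : p ∈ flrwDomain n k I) :
    (Matrix.of (flrw k a F p)).det ≠ 0 := by
  have h1 := h.scale_pos _ hp.1
  have h2 := h.lapse_pos _ hp.1
  have h3 := hp.2
  rw [det_flrw h3.ne']
  have : 0 < F (p 0) * (a (p 0) ^ 2) ^ n / (1 - k * radiusSq (Fin.tail p)) := by positivity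
  linarith

theorem ScaleLapse.volumeFactor_flrw (h : ScaleLapse I a F) (hp : p ∈ flrwDomain n k I) :
    volumeFactor (flrw k a F) p
      = Real.sqrt (F (p 0)) * a (p 0) ^ n / Real.sqrt (1 - k * radiusSq (Fin.tail p)) := by
  have h1 := h.scale_pos _ hp.1
  have h2 := h.lapse_pos _ hp.1
  have h3 := hp.2
  have h4 : 0 < F (p 0) * (a (p 0) ^ 2) ^ n / (1 - k * radiusSq (Fin.tail p)) := by positivity
  rw [volumeFactor, det_flrw h3.ne', abs_neg, abs_of_pos h4, Real.sqrt_div' _ h3.le,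
    Real.sqrt_mul h2.le, ← pow_mul, mul_comm 2 n, pow_mul, Real.sqrt_sq (by positivity)]

/-- The inverse of the FLRW metric. -/
noncomputable def flrwInverse (k : ℝ) (a F : ℝ → ℝ) (p : Coord n) : Tensor2 n :=
  Fin.cons (Fin.cons (- 1 / F (p 0)) fun _ => 0)
    fun i => Fin.cons 0 fun j => spatialInverse k (Fin.tail p) i j / a (p 0) ^ 2

theorem ScaleLapse.inverseMetric_flrw (h : ScaleLapse I a F) (hp : p ∈ flrwDomain n k I) :
    inverseMetric (flrw k a F) p = flrwInverse k a F p := by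
  have h1 := (h.scale_pos _ hp.1).ne'
  have h2 := (h.lapse_pos _ hp.1).ne'
  have h3 : (Matrix.of (flrw k a F p))⁻¹ = Matrix.of (flrwInverse k a F p) := by
    refine Matrix.inv_eq_left_inv ?_
    ext μ ν
    rw [Matrix.mul_apply, Fin.sum_univ_succ, Matrix.one_apply]
    refine Fin.cases ?_ (fun i => ?_) μ <;> refine Fin.cases ?_ (fun j => ?_) ν
    · simp [flrwInverse]; field_simp
    · simp [flrwInverse, eq_comm (a := (0 : Fin (n + 1)))]
    · simp [flrwInverse]
    · simp only [flrwInverse, Matrix.of_apply, Fin.cons_succ, Fin.cons_zero, flrw_succ_succ,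
        Fin.succ_inj, flrw_zero_succ]
      rw [← sum_spatialInverse_mul_metric hp.2.ne' i j, mul_zero, zero_add]
      exact Finset.sum_congr rfl fun l _ => by field_simp
  funext μ ν
  exact congrFun (congrFun h3 μ) ν

end AtPoint

end Flrw

/-! ### Christoffel symbols and Riemann tensor of the FLRW metric -/

section FlrwCurvature

variable {n : ℕ} {k : ℝ} {a F : ℝ → ℝ} {p : Coord n} {I : Set ℝ}

theorem ScaleLapse.pd_flrw_zero_zero (h : ScaleLapse I a F) (hp : p ∈ flrwDomain n k I)
    (μ : Fin (n + 1)) : pd μ (fun q => flrw k a F q 0 0) p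
      = (Fin.cons (- deriv F (p 0)) fun _ => 0 : Fin (n + 1) → ℝ) μ := by
  simp only [flrw_zero_zero]
  exact (hasGrad_time (u := fun t => - F t) (h.hasDerivAt_lapse hp.1).neg).pd μ

theorem pd_flrw_zero_succ (μ : Fin (n + 1)) (i : Fin n) :
    pd μ (fun q => flrw k a F q 0 i.succ) p = 0 := by
  simp only [flrw_zero_succ]
  exact (hasGrad_const 0).pd μ

theorem pd_flrw_succ_zero (μ : Fin (n + 1)) (i : Fin n) :
    pd μ (fun q => flrw k a F q i.succ 0) p = 0 := by
  simp only [flrw_succ_zero]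
  exact (hasGrad_const 0).pd μ

theorem ScaleLapse.pd_flrw_succ_succ (h : ScaleLapse I a F) (hp : p ∈ flrwDomain n k I)
    (μ : Fin (n + 1)) (i j : Fin n) : pd μ (fun q => flrw k a F q i.succ j.succ) p
      = (Fin.cons (2 * a (p 0) * deriv a (p 0) * spatialMetric k (Fin.tail p) i j)
        fun l => a (p 0) ^ 2 * (k / (1 - k * radiusSq (Fin.tail p)) *
        (p i.succ * spatialMetric k (Fin.tail p) j l
          + p j.succ * spatialMetric k (Fin.tail p) i l)) : Fin (n + 1) → ℝ) μ := by
  simp only [flrw_succ_succ]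
  refine (hasGrad_time_mul_spatialMetric (u := fun t => a t ^ 2) ?_ hp.2.ne' i j).pd μ
  simpa using (h.hasDerivAt_scale hp.1).fun_pow 2

/-- The Christoffel symbols of the FLRW metric. -/
theorem ScaleLapse.christoffel_flrw (h : ScaleLapse I a F) (hp : p ∈ flrwDomain n k I) :
    christoffel (flrw k a F) p 0 0 0 = deriv F (p 0) / (2 * F (p 0)) ∧
    (∀ l : Fin n, christoffel (flrw k a F) p 0 0 l.succ = 0) ∧
    (∀ j : Fin n, christoffel (flrw k a F) p 0 (Fin.succ j) 0 = 0) ∧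
    (∀ j : Fin n, christoffel (flrw k a F) p (Fin.succ j) 0 0 = 0) ∧
    (∀ j l : Fin n, christoffel (flrw k a F) p 0 (Fin.succ j) l.succ
      = deriv a (p 0) / a (p 0) * if j = l then 1 else 0) ∧
    (∀ j l : Fin n, christoffel (flrw k a F) p (Fin.succ j) 0 l.succ
      = deriv a (p 0) / a (p 0) * if j = l then 1 else 0) ∧
    (∀ i j : Fin n, christoffel (flrw k a F) p (Fin.succ i) (Fin.succ j) 0
      = a (p 0) * deriv a (p 0) / F (p 0) * spatialMetric k (Fin.tail p) i j) ∧
    (∀ i j l : Fin n, christoffel (flrw k a F) p (Fin.succ i) (Fin.succ j) l.succ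
      = k * p l.succ * spatialMetric k (Fin.tail p) i j) := by
  have h1 := (h.scale_pos _ hp.1).ne'
  have h2 := (h.lapse_pos _ hp.1).ne'
  have h3 := hp.2.ne'
  have hδ := sum_spatialInverse_mul_metric h3
  have hx : ∀ l, ∑ m, spatialInverse k (Fin.tail p) l m * p m.succ
      = (1 - k * radiusSq (Fin.tail p)) * p l.succ := fun l =>
    sum_spatialInverse_mul_coord (x := Fin.tail p) l
  simp only [christoffel, h.inverseMetric_flrw hp, Fin.sum_univ_succ, flrwInverse, Fin.cons_zero,
    Fin.cons_succ, h.pd_flrw_zero_zero hp, pd_flrw_zero_succ, pd_flrw_succ_zero,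
    h.pd_flrw_succ_succ hp]
  refine ⟨?_, ?_, ?_, ?_, ?_, ?_, ?_, ?_⟩
  · simp; field_simp
  · simp
  · simp
  · simp
  · intro j l
    -- Expanding the Kronecker delta as the contraction of `γ` with its inverse lets the two sides
    -- be compared summand by summand.
    have e : (if j = l then (1 : ℝ) else 0) = _ := (if_congr eq_comm rfl rfl).trans (hδ l j).symm
    rw [e, Finset.mul_sum]
    simp only [mul_zero, zero_add, add_zero, sub_zero, Finset.mul_sum]
    refine Finset.sum_congr rfl fun m _ => ?_
    rw [spatialMetric_symm k _ j m]
    field_simp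
  · intro j l
    have e : (if j = l then (1 : ℝ) else 0) = _ := (if_congr eq_comm rfl rfl).trans (hδ l j).symm
    rw [e, Finset.mul_sum]
    simp only [mul_zero, zero_add, add_zero, sub_zero, Finset.mul_sum]
    refine Finset.sum_congr rfl fun m _ => ?_
    rw [spatialMetric_symm k _ j m]
    field_simp
  · intro i j
    simp; field_simp
  · intro i j l
    have : ∀ m, spatialInverse k (Fin.tail p) l m / a (p 0) ^ 2 *
        (a (p 0) ^ 2 * (k / (1 - k * radiusSq (Fin.tail p)) *
          (p j.succ * spatialMetric k (Fin.tail p) m i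
            + p m.succ * spatialMetric k (Fin.tail p) j i))
        + a (p 0) ^ 2 * (k / (1 - k * radiusSq (Fin.tail p)) *
          (p i.succ * spatialMetric k (Fin.tail p) m j
            + p m.succ * spatialMetric k (Fin.tail p) i j))
        - a (p 0) ^ 2 * (k / (1 - k * radiusSq (Fin.tail p)) *
          (p i.succ * spatialMetric k (Fin.tail p) j m
            + p j.succ * spatialMetric k (Fin.tail p) i m)))
        = 2 * k / (1 - k * radiusSq (Fin.tail p)) * spatialMetric k (Fin.tail p) i j
          * (spatialInverse k (Fin.tail p) l m * p m.succ) := by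
      intro m
      rw [spatialMetric_symm k _ j i, spatialMetric_symm k _ m i, spatialMetric_symm k _ m j]
      field_simp
      ring
    simp_rw [this, ← Finset.mul_sum, hx]
    field_simp
    ring

/-- `a'' / (a F) - a' F' / (2 a F²)` as a function of `a, a', a'', F, F'`. -/
noncomputable def accel (a₀ a₁ a₂ F₀ F₁ : ℝ) : ℝ :=
  a₂ / (a₀ * F₀) - a₁ * F₁ / (2 * a₀ * F₀ ^ 2)

/-- `(k + a'² / F) / a²` as a function of `a, a', F`. -/
noncomputable def hubbleSq (k a₀ a₁ F₀ : ℝ) : ℝ := (k + a₁ ^ 2 / F₀) / a₀ ^ 2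

/-- The gradients of the Christoffel symbols of the FLRW metric. -/
theorem ScaleLapse.pd_christoffel_flrw (h : ScaleLapse I a F) (hp : p ∈ flrwDomain n k I) :
    (∀ i : Fin n, pd i.succ (fun q => christoffel (flrw k a F) q 0 0 0) p = 0) ∧
    (∀ μ (l : Fin n), pd μ (fun q => christoffel (flrw k a F) q 0 0 l.succ) p = 0) ∧
    (∀ μ (j : Fin n), pd μ (fun q => christoffel (flrw k a F) q 0 (Fin.succ j) 0) p = 0) ∧
    (∀ μ (j : Fin n), pd μ (fun q => christoffel (flrw k a F) q (Fin.succ j) 0 0) p = 0) ∧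
    (∀ i j l : Fin n, pd i.succ (fun q => christoffel (flrw k a F) q 0 (Fin.succ j) l.succ) p
      = 0) ∧
    (∀ j l : Fin n, pd 0 (fun q => christoffel (flrw k a F) q (Fin.succ j) 0 l.succ) p
      = (deriv (deriv a) (p 0) / a (p 0) - (deriv a (p 0) / a (p 0)) ^ 2) *
        if j = l then 1 else 0) ∧
    (∀ i j l : Fin n, pd i.succ (fun q => christoffel (flrw k a F) q (Fin.succ j) 0 l.succ) p
      = 0) ∧
    (∀ i j : Fin n, pd 0 (fun q => christoffel (flrw k a F) q (Fin.succ i) (Fin.succ j) 0) p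
      = (deriv a (p 0) ^ 2 / F (p 0) + a (p 0) * deriv (deriv a) (p 0) / F (p 0)
        - a (p 0) * deriv a (p 0) * deriv F (p 0) / F (p 0) ^ 2)
        * spatialMetric k (Fin.tail p) i j) ∧
    (∀ m i j : Fin n, pd m.succ
        (fun q => christoffel (flrw k a F) q (Fin.succ i) (Fin.succ j) 0) p
      = a (p 0) * deriv a (p 0) / F (p 0) * (k / (1 - k * radiusSq (Fin.tail p)) *
        (p i.succ * spatialMetric k (Fin.tail p) j m
          + p j.succ * spatialMetric k (Fin.tail p) i m))) ∧
    (∀ i j l : Fin n, pd 0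
        (fun q => christoffel (flrw k a F) q (Fin.succ i) (Fin.succ j) l.succ) p = 0) ∧
    (∀ m i j l : Fin n, pd m.succ
        (fun q => christoffel (flrw k a F) q (Fin.succ i) (Fin.succ j) l.succ) p
      = k * (if m = l then 1 else 0) * spatialMetric k (Fin.tail p) i j
        + k * p l.succ * (k / (1 - k * radiusSq (Fin.tail p)) *
        (p i.succ * spatialMetric k (Fin.tail p) j m
          + p j.succ * spatialMetric k (Fin.tail p) i m))) := by
  have h1 := (h.scale_pos _ hp.1).ne'
  have h2 := (h.lapse_pos _ hp.1).ne'
  have h3 := hp.2.ne'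
  have hev : ∀ᶠ q in nhds p, q ∈ flrwDomain n k I := (isOpen_flrwDomain h.isOpen).mem_nhds hp
  -- A symbol that vanishes on the whole open chart has vanishing partial derivatives.
  have hzero : ∀ {f : Coord n → ℝ} (μ : Fin (n + 1)), (∀ q ∈ flrwDomain n k I, f q = 0) →
      pd μ f p = 0 := fun μ hf =>
    ((hasGrad_const 0).congr (hev.mono fun q hq => hf q hq)).pd μ
  have da := h.hasDerivAt_scale hp.1
  have dF := h.hasDerivAt_lapse hp.1
  have da' := h.hasDerivAt_deriv_scale hp.1
  have dF' := h.hasDerivAt_deriv_lapse hp.1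
  have g000 : HasGrad (fun q => christoffel (flrw k a F) q 0 0 0) _ p :=
    (hasGrad_time (u := fun t => deriv F t / (2 * F t))
      (dF'.div (dF.const_mul 2) (by simpa using h2))).congr
      (hev.mono fun q hq => (h.christoffel_flrw hq).1)
  have g0jl : ∀ j l : Fin n, HasGrad (fun q => christoffel (flrw k a F) q 0 (Fin.succ j) l.succ)
      _ p := fun j l =>
    (hasGrad_time (u := fun t => deriv a t / a t * if j = l then 1 else 0)
      ((da'.div da h1).mul_const _)).congr
      (hev.mono fun q hq => (h.christoffel_flrw hq).2.2.2.2.1 j l)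
  have gj0l : ∀ j l : Fin n, HasGrad (fun q => christoffel (flrw k a F) q (Fin.succ j) 0 l.succ)
      _ p := fun j l =>
    (hasGrad_time (u := fun t => deriv a t / a t * if j = l then 1 else 0)
      ((da'.div da h1).mul_const _)).congr
      (hev.mono fun q hq => (h.christoffel_flrw hq).2.2.2.2.2.1 j l)
  have gij0 : ∀ i j : Fin n,
      HasGrad (fun q => christoffel (flrw k a F) q (Fin.succ i) (Fin.succ j) 0) _ p := fun i j =>
    (hasGrad_time_mul_spatialMetric (u := fun t => a t * deriv a t / F t)
      ((da.mul da').div dF h2) h3 i j).congr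
      (hev.mono fun q hq => (h.christoffel_flrw hq).2.2.2.2.2.2.1 i j)
  have gijl : ∀ i j l : Fin n,
      HasGrad (fun q => christoffel (flrw k a F) q (Fin.succ i) (Fin.succ j) l.succ) _ p :=
    fun i j l => (((hasGrad_coord (p := p) l.succ).const_mul k).mul
      (hasGrad_spatialMetric h3 i j)).congr
      (hev.mono fun q hq => (h.christoffel_flrw hq).2.2.2.2.2.2.2 i j l)
  refine ⟨fun i => ?_, fun μ l => hzero μ fun q hq => (h.christoffel_flrw hq).2.1 l,
    fun μ j => hzero μ fun q hq => (h.christoffel_flrw hq).2.2.1 j,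
    fun μ j => hzero μ fun q hq => (h.christoffel_flrw hq).2.2.2.1 j,
    fun i j l => ?_, fun j l => ?_, fun i j l => ?_, fun i j => ?_, fun m i j => ?_,
    fun i j l => ?_, fun m i j l => ?_⟩
  · rw [g000.pd]; simp
  · rw [(g0jl j l).pd]; simp
  · rw [(gj0l j l).pd]; simp only [Fin.cons_zero]; field_simp
  · rw [(gj0l j l).pd]; simp
  · rw [(gij0 i j).pd]; simp only [Fin.cons_zero, Pi.mul_apply]; field_simp
  · rw [(gij0 i j).pd]; simp
  · rw [(gijl i j l).pd]; simp [eq_comm (a := (0 : Fin (n + 1)))]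
  · rw [(gijl i j l).pd]; simp [Fin.succ_inj]

/-- The algebraic curvature tensor made of two symmetric tensors `T` (temporal), `S` (spatial). -/
def isoCurvature (X Y : ℝ) (T S : Tensor2 n) : Tensor4 n := fun a b c d =>
  Y * (S a c * S b d - S a d * S b c)
    - X * (T a c * S b d + S a c * T b d - T a d * S b c - S a d * T b c)

/-- The temporal part of the FLRW metric. -/
noncomputable def temporalPart (F : ℝ → ℝ) (p : Coord n) : Tensor2 n :=
  Fin.cons (Fin.cons (F (p 0)) fun _ => 0) fun _ _ => 0

/-- The spatial part of the FLRW metric. -/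
noncomputable def spatialPart (k : ℝ) (a : ℝ → ℝ) (p : Coord n) : Tensor2 n :=
  Fin.cons (fun _ => 0) fun i => Fin.cons 0 fun j =>
    a (p 0) ^ 2 * spatialMetric k (Fin.tail p) i j

theorem riemannUp_antisymm (g : Coord n → Tensor2 n) (b c d e : Fin (n + 1)) :
    riemannUp g p b c d e = - riemannUp g p c b d e := by
  simp only [riemannUp, Finset.sum_sub_distrib]
  ring

/-- By antisymmetry in the first two indices these eight families determine all components. The
terms with an explicit `x` cancel between the derivatives and the products of the spatial
Christoffel symbols; the cancellation rests on `γ x = x/(1 - k r²)`. -/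
theorem ScaleLapse.riemannUp_flrw (h : ScaleLapse I a F) (hp : p ∈ flrwDomain n k I) :
    (∀ i : Fin n, riemannUp (flrw k a F) p 0 i.succ 0 0 = 0) ∧
    (∀ i l : Fin n, riemannUp (flrw k a F) p 0 i.succ 0 l.succ
      = - (deriv (deriv a) (p 0) / a (p 0)
        - deriv a (p 0) * deriv F (p 0) / (2 * a (p 0) * F (p 0))) * if i = l then 1 else 0) ∧
    (∀ i j : Fin n, riemannUp (flrw k a F) p 0 i.succ j.succ 0
      = - (a (p 0) * deriv (deriv a) (p 0) / F (p 0)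
        - a (p 0) * deriv a (p 0) * deriv F (p 0) / (2 * F (p 0) ^ 2))
        * spatialMetric k (Fin.tail p) i j) ∧
    (∀ i j l : Fin n, riemannUp (flrw k a F) p 0 i.succ j.succ l.succ = 0) ∧
    (∀ i j : Fin n, riemannUp (flrw k a F) p i.succ j.succ 0 0 = 0) ∧
    (∀ i j l : Fin n, riemannUp (flrw k a F) p i.succ j.succ 0 l.succ = 0) ∧
    (∀ i j m : Fin n, riemannUp (flrw k a F) p i.succ j.succ m.succ 0 = 0) ∧
    (∀ i j m l : Fin n, riemannUp (flrw k a F) p i.succ j.succ m.succ l.succ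
      = (k + deriv a (p 0) ^ 2 / F (p 0)) * (spatialMetric k (Fin.tail p) i m
          * (if j = l then 1 else 0)
        - spatialMetric k (Fin.tail p) j m * (if i = l then 1 else 0))) := by
  have h1 := (h.scale_pos _ hp.1).ne'
  have h2 := (h.lapse_pos _ hp.1).ne'
  have h3 := hp.2.ne'
  obtain ⟨c1, c2, c3, c4, c5, c6, c7, c8⟩ := h.christoffel_flrw hp
  obtain ⟨d1, d2, d3, d4, d5, d6, d7, d8, d9, d10, d11⟩ := h.pd_christoffel_flrw hp
  have hx : ∀ l, ∑ m, spatialMetric k (Fin.tail p) l m * p m.succ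
      = p l.succ / (1 - k * radiusSq (Fin.tail p)) := fun l =>
    sum_spatialMetric_mul_coord (x := Fin.tail p) h3 l
  simp only [riemannUp, Fin.sum_univ_succ, c1, c2, c3, c4, c5, c6, c7, c8, d1, d2, d3, d4, d5, d6,
    d7, d8, d9, d10, d11]
  -- The factor `C` is left free because the sum occurs twice: with `C = aȧ/F` for an upper time
  -- index and with `C = k x^l` for an upper spatial index.
  have hsum : ∀ (i j m : Fin n) (C : ℝ), ∑ l, (k * p l.succ * spatialMetric k (Fin.tail p) m i *
      (C * spatialMetric k (Fin.tail p) j l)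
      - k * p l.succ * spatialMetric k (Fin.tail p) m j *
      (C * spatialMetric k (Fin.tail p) i l))
      = C * k / (1 - k * radiusSq (Fin.tail p)) * (p j.succ * spatialMetric k (Fin.tail p) m i
        - p i.succ * spatialMetric k (Fin.tail p) m j) := by
    intro i j m C
    have : ∀ l, k * p (Fin.succ l) * spatialMetric k (Fin.tail p) m i *
      (C * spatialMetric k (Fin.tail p) j l)
      - k * p (Fin.succ l) * spatialMetric k (Fin.tail p) m j *
      (C * spatialMetric k (Fin.tail p) i l)
      = C * k * spatialMetric k (Fin.tail p) m i * (spatialMetric k (Fin.tail p) j l * p l.succ)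
        - C * k * spatialMetric k (Fin.tail p) m j *
          (spatialMetric k (Fin.tail p) i l * p l.succ) := fun l => by ring
    simp_rw [this, Finset.sum_sub_distrib, ← Finset.mul_sum, hx]
    ring
  refine ⟨fun i => by simp, fun i l => ?_, fun i j => ?_, fun i j l => ?_, fun i j => ?_,
    fun i j l => ?_, fun i j m => ?_, fun i j m l => ?_⟩
  · have : ∑ x, deriv a (p 0) / a (p 0) * (if i = x then (1 : ℝ) else 0) *
        (deriv a (p 0) / a (p 0) * if x = l then 1 else 0)
        = deriv a (p 0) / a (p 0) * (deriv a (p 0) / a (p 0) * if i = l then 1 else 0) := by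
      simp
    simp only [zero_mul, zero_sub, Finset.sum_neg_distrib, mul_zero, this]
    field_simp
    ring
  · simp [spatialMetric_symm k _ j i]
    field_simp
    ring
  · simp [spatialMetric_symm k _ j i]
    ring
  · simp [spatialMetric_symm k _ j i]
  · simp [spatialMetric_symm k _ j i]
  · rw [hsum, spatialMetric_symm k _ j i, spatialMetric_symm k _ m i, spatialMetric_symm k _ m j]
    ring
  · have := hsum i j m (k * p l.succ)
    rw [this, spatialMetric_symm k _ j i, spatialMetric_symm k _ m i, spatialMetric_symm k _ m j]
    field_simp
    ring

/-- The Riemann tensor of the FLRW metric. -/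
theorem ScaleLapse.riemann_flrw (h : ScaleLapse I a F) (hp : p ∈ flrwDomain n k I) :
    riemann (flrw k a F) p = isoCurvature
      (accel (a (p 0)) (deriv a (p 0)) (deriv (deriv a) (p 0)) (F (p 0)) (deriv F (p 0)))
      (hubbleSq k (a (p 0)) (deriv a (p 0)) (F (p 0)))
      (temporalPart F p) (spatialPart k a p) := by
  have h1 := (h.scale_pos _ hp.1).ne'
  have h2 := (h.lapse_pos _ hp.1).ne'
  obtain ⟨c1, c2, c3, c4, c5, c6, c7, c8⟩ := h.riemannUp_flrw hp
  have hz : ∀ d e, riemannUp (flrw k a F) p 0 0 d e = 0 := fun d e => by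
    have := riemannUp_antisymm (p := p) (flrw k a F) 0 0 d e
    linarith
  have hswap : ∀ (i : Fin n) d e, riemannUp (flrw k a F) p i.succ 0 d e
      = - riemannUp (flrw k a F) p 0 i.succ d e := fun i d e => riemannUp_antisymm _ _ _ _ _
  funext μ ν ρ τ
  simp only [riemann, Fin.sum_univ_succ]
  refine Fin.cases ?_ (fun i => ?_) μ <;> refine Fin.cases ?_ (fun j => ?_) ν <;>
    refine Fin.cases ?_ (fun m => ?_) ρ <;> refine Fin.cases ?_ (fun l => ?_) τ <;>
    simp [hz, hswap, c1, c2, c3, c4, c5, c6, c7, c8, isoCurvature, temporalPart, spatialPart,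
      accel, hubbleSq]
  all_goals try (field_simp; ring_nf; done)
  -- The purely spatial component is left, where lowering the index acts on a difference of two
  -- Kronecker deltas.
  simp only [mul_assoc, ← Finset.mul_sum, sub_mul, Finset.sum_sub_distrib, ite_mul, zero_mul,
    Finset.sum_ite_eq, Finset.mem_univ, if_true]
  field_simp

end FlrwCurvature

/-! ### Frame-invariant Lagrangians at homogeneous and isotropic curvature -/

section Frames

variable {n : ℕ}

/-- The change of frame as a linear map. -/
noncomputable def changeFrameLinear (A : Matrix.GeneralLinearGroup (Fin (n + 1)) ℝ) :
    Tensor2 n × Tensor4 n →ₗ[ℝ] Tensor2 n × Tensor4 n where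
  toFun := changeFrame A
  map_add' v w := by
    refine Prod.ext ?_ ?_
    · funext a b
      simp only [changeFrame, Prod.fst_add, Pi.add_apply, mul_add, Finset.sum_add_distrib]
    · funext a b c d
      simp only [changeFrame, Prod.snd_add, Pi.add_apply, mul_add, Finset.sum_add_distrib]
  map_smul' r w := by
    refine Prod.ext ?_ ?_
    · funext a b
      simp only [changeFrame, Prod.smul_fst, Pi.smul_apply, smul_eq_mul, Finset.mul_sum,
        RingHom.id_apply, mul_left_comm r]
    · funext a b c d
      simp only [changeFrame, Prod.smul_snd, Pi.smul_apply, smul_eq_mul, Finset.mul_sum,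
        RingHom.id_apply, mul_left_comm r]

theorem GravityTheory.differentiableAt {T : GravityTheory n} {w : Tensor2 n × Tensor4 n}
    (hw : w ∈ T.domain) : DifferentiableAt ℝ T.lagrangian w :=
  ((T.smooth w hw).contDiffAt (T.isOpen_domain.mem_nhds hw)).differentiableAt (by simp)

/-- The scalar property holds on the open domain and the change of frame is linear, so the chain
rule applies with the change of frame as its own derivative. At a pair fixed by `A` this says that
the differential is invariant under `A`. -/
theorem GravityTheory.fderiv_changeFrame {T : GravityTheory n} {w : Tensor2 n × Tensor4 n}
    (hw : w ∈ T.domain) (A : Matrix.GeneralLinearGroup (Fin (n + 1)) ℝ)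
    (v : Tensor2 n × Tensor4 n) :
    fderiv ℝ T.lagrangian (changeFrame A w) (changeFrame A v) = fderiv ℝ T.lagrangian w v := by
  have h1 := (T.differentiableAt (T.domain_invariant A w hw)).hasFDerivAt
  have h2 := HasFDerivAt.comp w h1
    (LinearMap.toContinuousLinearMap (changeFrameLinear A)).hasFDerivAt
  have h3 : T.lagrangian ∘ (LinearMap.toContinuousLinearMap (changeFrameLinear A))
      =ᶠ[nhds w] T.lagrangian := by
    filter_upwards [T.isOpen_domain.mem_nhds hw] with z hz
    exact T.scalar A z hz
  rw [(h2.congr_of_eventuallyEq h3.symm).fderiv]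
  rfl

/-- The action of a frame on tensors with two lower indices. -/
noncomputable def pullTensor (A : Matrix.GeneralLinearGroup (Fin (n + 1)) ℝ) (S : Tensor2 n) :
    Tensor2 n := fun a b => ∑ e, ∑ f, (A⁻¹).1 e a * (A⁻¹).1 f b * S e f

/-- The four-index transformation of a product of two tensors factors into two two-index
transformations. This version pairs the first index with the third and the second with the fourth;
the next one crosses the last two. -/
theorem sum_mul_pair {ι : Type*} [Fintype ι] (M : ι → ι → ℝ) (P Q : ι → ι → ℝ) (a b c d : ι) :
    ∑ e, ∑ f, ∑ i, ∑ j, M e a * M f b * M i c * M j d * (P e i * Q f j)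
      = (∑ e, ∑ i, M e a * M i c * P e i) * (∑ f, ∑ j, M f b * M j d * Q f j) := by
  rw [Finset.sum_mul_sum]
  refine Finset.sum_congr rfl fun e _ => Finset.sum_congr rfl fun f _ => ?_
  rw [Finset.sum_mul_sum]
  refine Finset.sum_congr rfl fun i _ => Finset.sum_congr rfl fun j _ => ?_
  ring

theorem sum_mul_pair' {ι : Type*} [Fintype ι] (M : ι → ι → ℝ) (P Q : ι → ι → ℝ) (a b c d : ι) :
    ∑ e, ∑ f, ∑ i, ∑ j, M e a * M f b * M i c * M j d * (P e j * Q f i)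
      = (∑ e, ∑ i, M e a * M i d * P e i) * (∑ f, ∑ j, M f b * M j c * Q f j) := by
  rw [← sum_mul_pair]
  refine Finset.sum_congr rfl fun e _ => Finset.sum_congr rfl fun f _ => ?_
  rw [Finset.sum_comm]
  refine Finset.sum_congr rfl fun i _ => Finset.sum_congr rfl fun j _ => ?_
  ring

theorem sum_mul_isoCurvature (M : Fin (n + 1) → Fin (n + 1) → ℝ) (X Y : ℝ) (T S : Tensor2 n)
    (a b c d : Fin (n + 1)) :
    ∑ e, ∑ f, ∑ i, ∑ j, M e a * M f b * M i c * M j d * isoCurvature X Y T S e f i j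
      = isoCurvature X Y (fun a b => ∑ e, ∑ f, M e a * M f b * T e f)
        (fun a b => ∑ e, ∑ f, M e a * M f b * S e f) a b c d := by
  have h : ∀ e f i j, M e a * M f b * M i c * M j d * isoCurvature X Y T S e f i j
      = Y * (M e a * M f b * M i c * M j d * (S e i * S f j)
        - M e a * M f b * M i c * M j d * (S e j * S f i))
        - X * (M e a * M f b * M i c * M j d * (T e i * S f j)
        + M e a * M f b * M i c * M j d * (S e i * T f j)
        - M e a * M f b * M i c * M j d * (T e j * S f i)
        - M e a * M f b * M i c * M j d * (S e j * T f i)) := by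
    intro e f i j
    simp only [isoCurvature]; ring
  simp only [h, Finset.sum_sub_distrib, Finset.sum_add_distrib, ← Finset.mul_sum]
  rw [sum_mul_pair, sum_mul_pair, sum_mul_pair, sum_mul_pair', sum_mul_pair', sum_mul_pair']
  rfl

/-- The construction is algebraic in its two symmetric tensors, hence natural under changes of
frame; from here on frames need to be computed on two-index tensors only. -/
theorem changeFrame_isoCurvature (A : Matrix.GeneralLinearGroup (Fin (n + 1)) ℝ) (u : Tensor2 n)
    (X Y : ℝ) (T S : Tensor2 n) : (changeFrame A (u, isoCurvature X Y T S)).2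
      = isoCurvature X Y (pullTensor A T) (pullTensor A S) := by
  funext a b c d
  exact sum_mul_isoCurvature (fun e a => (A⁻¹).1 e a) X Y T S a b c d

/-- The diagonal frame with the given non-zero entries. -/
noncomputable def diagonalFrame (d : Fin (n + 1) → ℝ) (hd : ∀ i, d i ≠ 0) :
    Matrix.GeneralLinearGroup (Fin (n + 1)) ℝ where
  val := Matrix.diagonal d
  inv := Matrix.diagonal fun i => (d i)⁻¹
  val_inv := by simp [Matrix.diagonal_mul_diagonal, hd]
  inv_val := by simp [Matrix.diagonal_mul_diagonal, hd]

theorem changeFrame_diagonalFrame (d : Fin (n + 1) → ℝ) (hd : ∀ i, d i ≠ 0)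
    (w : Tensor2 n × Tensor4 n) : changeFrame (diagonalFrame d hd) w
      = (fun a b => d a * d b * w.1 a b,
        fun a b c e => (d a)⁻¹ * (d b)⁻¹ * (d c)⁻¹ * (d e)⁻¹ * w.2 a b c e) := by
  have h1 : (diagonalFrame d hd).1 = Matrix.diagonal d := rfl
  have h2 : ((diagonalFrame d hd)⁻¹).1 = Matrix.diagonal fun i => (d i)⁻¹ := rfl
  refine Prod.ext ?_ ?_
  · funext a b
    simp [changeFrame, h1, Matrix.diagonal_apply]
  · funext a b c e
    simp [changeFrame, h2, Matrix.diagonal_apply]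

/-- The frame that permutes the axes. -/
noncomputable def permFrame (σ : Equiv.Perm (Fin (n + 1))) :
    Matrix.GeneralLinearGroup (Fin (n + 1)) ℝ where
  val := Matrix.of fun a b => if σ a = b then 1 else 0
  inv := Matrix.of fun a b => if σ b = a then 1 else 0
  val_inv := by
    ext a b
    simp [Matrix.mul_apply, Matrix.one_apply, eq_comm (a := a)]
  inv_val := by
    ext a b
    rw [Matrix.mul_apply, Matrix.one_apply, Finset.sum_eq_single (σ.symm a)]
    · simp
    · intro j _ hj
      have : σ j ≠ a := fun h => hj (by rw [← h, Equiv.symm_apply_apply])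
      simp [this]
    · simp

theorem changeFrame_permFrame (σ : Equiv.Perm (Fin (n + 1))) (w : Tensor2 n × Tensor4 n) :
    changeFrame (permFrame σ) w
      = (fun a b => w.1 (σ a) (σ b), fun a b c e => w.2 (σ a) (σ b) (σ c) (σ e)) := by
  have h1 : (permFrame σ).1 = Matrix.of fun a b => if σ a = b then 1 else 0 := rfl
  have h2 : ((permFrame σ)⁻¹).1 = Matrix.of fun a b => if σ b = a then 1 else 0 := rfl
  refine Prod.ext ?_ ?_
  · funext a b
    simp [changeFrame, h1]
  · funext a b c e
    simp [changeFrame, h2]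

/-- The temporal part of the Minkowski metric. -/
def stdTemporal : Tensor2 n := fun a b => if a = b then (if a = 0 then 1 else 0) else 0

/-- The spatial part of the Minkowski metric. -/
def stdSpatial : Tensor2 n := fun a b => if a = b then (if a = 0 then 0 else 1) else 0

/-- The inverse metric and the Riemann tensor of an FLRW metric in an orthonormal frame. -/
def stdPair (X Y : ℝ) : Tensor2 n × Tensor4 n :=
  (fun a b => stdSpatial a b - stdTemporal a b, isoCurvature X Y stdTemporal stdSpatial)

theorem stdTemporal_mul (f : Fin (n + 1) → Fin (n + 1) → ℝ) (hf : ∀ a, f a a = 1)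
    (a b : Fin (n + 1)) : f a b * stdTemporal a b = stdTemporal a b := by
  by_cases h : a = b
  · subst h; simp [hf]
  · simp [stdTemporal, h]

theorem stdSpatial_mul (f : Fin (n + 1) → Fin (n + 1) → ℝ) (hf : ∀ a, f a a = 1)
    (a b : Fin (n + 1)) : f a b * stdSpatial a b = stdSpatial a b := by
  by_cases h : a = b
  · subst h; simp [hf]
  · simp [stdSpatial, h]

/-- Both building blocks are diagonal, so every sign enters squared. Reflections of the time axis
are allowed as well. -/
theorem changeFrame_sign_stdPair {d : Fin (n + 1) → ℝ} (hd : ∀ i, d i * d i = 1) (X Y : ℝ)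
    (hd0 : ∀ i, d i ≠ 0) : changeFrame (diagonalFrame d hd0) (stdPair X Y) = stdPair X Y := by
  have hinv : ∀ i, (d i)⁻¹ = d i := fun i => by
    rw [inv_eq_iff_eq_inv, eq_comm, inv_eq_of_mul_eq_one_left (hd i)]
  have hT := stdTemporal_mul (n := n) (fun a b => d a * d b) hd
  have hS := stdSpatial_mul (n := n) (fun a b => d a * d b) hd
  rw [changeFrame_diagonalFrame]
  refine Prod.ext ?_ ?_
  · funext a b
    simp only [stdPair, mul_sub]
    rw [hT, hS]
  · funext a b c e
    have hT' : (fun a b => d a * d b * stdTemporal a b) = stdTemporal (n := n) :=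
      funext fun a => funext fun b => hT a b
    have hS' : (fun a b => d a * d b * stdSpatial a b) = stdSpatial (n := n) :=
      funext fun a => funext fun b => hS a b
    have h : d a * d b * d c * d e * isoCurvature X Y stdTemporal stdSpatial a b c e
        = isoCurvature X Y (fun a b => d a * d b * stdTemporal a b)
          (fun a b => d a * d b * stdSpatial a b) a b c e := by
      simp only [isoCurvature]; ring
    simp only [hinv, stdPair]
    rw [h, hT', hS']

theorem changeFrame_perm_stdPair {σ : Equiv.Perm (Fin (n + 1))} (hσ : σ 0 = 0) (X Y : ℝ) :
    changeFrame (permFrame σ) (stdPair X Y) = stdPair X Y := by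
  have h0 : ∀ a, σ a = 0 ↔ a = 0 := fun a => by
    constructor
    · intro h; exact σ.injective (h.trans hσ.symm)
    · rintro rfl; exact hσ
  have hT : ∀ a b, stdTemporal (σ a) (σ b) = stdTemporal a b := by
    intro a b; simp [stdTemporal, h0]
  have hS : ∀ a b, stdSpatial (σ a) (σ b) = stdSpatial a b := by
    intro a b; simp [stdSpatial, h0]
  rw [changeFrame_permFrame]
  refine Prod.ext ?_ ?_
  · funext a b; simp [stdPair, hT, hS]
  · funext a b c e; simp [stdPair, isoCurvature, hT, hS]

/-- A unit tensor with two indices. -/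
def unitTensor2 (a b : Fin (n + 1)) : Tensor2 n := fun a' b' =>
  (if a' = a then 1 else 0) * (if b' = b then 1 else 0)

/-- A unit tensor with four indices. -/
def unitTensor4 (a b c e : Fin (n + 1)) : Tensor4 n := fun a' b' c' e' =>
  (if a' = a then 1 else 0) * (if b' = b then 1 else 0) * (if c' = c then 1 else 0) *
    (if e' = e then 1 else 0)

theorem tensor2_eq_sum (u : Tensor2 n) :
    ((u, 0) : Tensor2 n × Tensor4 n) = ∑ a, ∑ b, u a b • (unitTensor2 a b, 0) := by
  refine Prod.ext ?_ ?_
  · funext a b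
    simp [Prod.fst_sum, Finset.sum_apply, unitTensor2]
  · simp [Prod.snd_sum]

theorem tensor4_eq_sum (ρ : Tensor4 n) : ((0, ρ) : Tensor2 n × Tensor4 n)
    = ∑ a, ∑ b, ∑ c, ∑ e, ρ a b c e • (0, unitTensor4 a b c e) := by
  refine Prod.ext ?_ ?_
  · simp [Prod.fst_sum]
  · funext a b c e
    simp [Prod.snd_sum, Finset.sum_apply, unitTensor4]

/-! ### The differential of the Lagrangian at the standard pair -/

section Isotropic

variable {T : GravityTheory n} {X Y : ℝ}

/-- The derivative of the Lagrangian at the standard pair is invariant under the reflections of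
the axes. -/
theorem fderiv_stdPair_diagonal (hw : stdPair X Y ∈ T.domain) {d : Fin (n + 1) → ℝ}
    (hd : ∀ i, d i * d i = 1) (v : Tensor2 n × Tensor4 n) :
    fderiv ℝ T.lagrangian (stdPair X Y) (fun a b => d a * d b * v.1 a b,
        fun a b c e => d a * d b * d c * d e * v.2 a b c e)
      = fderiv ℝ T.lagrangian (stdPair X Y) v := by
  have hd0 : ∀ i, d i ≠ 0 := fun i h => by have := hd i; simp [h] at this
  have hinv : ∀ i, (d i)⁻¹ = d i := fun i => by
    rw [inv_eq_iff_eq_inv, eq_comm, inv_eq_of_mul_eq_one_left (hd i)]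
  have h := T.fderiv_changeFrame hw (diagonalFrame d hd0) v
  rw [changeFrame_sign_stdPair hd, changeFrame_diagonalFrame] at h
  simpa only [hinv] using h

theorem fderiv_stdPair_perm (hw : stdPair X Y ∈ T.domain) {σ : Equiv.Perm (Fin (n + 1))}
    (hσ : σ 0 = 0) (v : Tensor2 n × Tensor4 n) :
    fderiv ℝ T.lagrangian (stdPair X Y) (fun a b => v.1 (σ a) (σ b),
        fun a b c e => v.2 (σ a) (σ b) (σ c) (σ e))
      = fderiv ℝ T.lagrangian (stdPair X Y) v := by
  have h := T.fderiv_changeFrame hw (permFrame σ) v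
  rwa [changeFrame_perm_stdPair hσ, changeFrame_permFrame] at h

/-- The reflection of an axis. -/
def axisSign (i a : Fin (n + 1)) : ℝ := if a = i then -1 else 1

theorem axisSign_mul_self (i a : Fin (n + 1)) : axisSign i a * axisSign i a = 1 := by
  unfold axisSign; split_ifs <;> norm_num

/-- The reflection of the axis `a` changes the sign of this unit tensor and fixes the standard pair.
-/
theorem fderiv_unitTensor2_eq_zero (hw : stdPair X Y ∈ T.domain) {a b : Fin (n + 1)}
    (hab : a ≠ b) : fderiv ℝ T.lagrangian (stdPair X Y) (unitTensor2 a b, 0) = 0 := by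
  have h := fderiv_stdPair_diagonal hw (d := axisSign a) (axisSign_mul_self a) (unitTensor2 a b, 0)
  have h2 : ((fun a' b' => axisSign a a' * axisSign a b' * unitTensor2 a b a' b',
      fun a' b' c' e' => axisSign a a' * axisSign a b' * axisSign a c' * axisSign a e'
        * (0 : Tensor4 n) a' b' c' e') : Tensor2 n × Tensor4 n) = - (unitTensor2 a b, 0) := by
    refine Prod.ext ?_ ?_
    · funext a' b'
      simp only [axisSign, unitTensor2, Prod.neg_mk, Pi.neg_apply]
      split_ifs <;> simp_all
    · funext a' b' c' e'; simp
  rw [h2, map_neg] at h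
  linarith

theorem fderiv_unitTensor4_sign (hw : stdPair X Y ∈ T.domain) (i a b c e : Fin (n + 1)) :
    fderiv ℝ T.lagrangian (stdPair X Y) (0, unitTensor4 a b c e)
      = axisSign i a * axisSign i b * axisSign i c * axisSign i e *
        fderiv ℝ T.lagrangian (stdPair X Y) (0, unitTensor4 a b c e) := by
  have h := fderiv_stdPair_diagonal hw (d := axisSign i) (axisSign_mul_self i)
    (0, unitTensor4 a b c e)
  have h2 : ((fun a' b' => axisSign i a' * axisSign i b' * (0 : Tensor2 n) a' b',
      fun a' b' c' e' => axisSign i a' * axisSign i b' * axisSign i c' * axisSign i e'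
        * unitTensor4 a b c e a' b' c' e') : Tensor2 n × Tensor4 n)
      = (axisSign i a * axisSign i b * axisSign i c * axisSign i e) • (0, unitTensor4 a b c e) := by
    refine Prod.ext ?_ ?_
    · funext a' b'; simp
    · funext a' b' c' e'
      simp only [unitTensor4, Prod.smul_mk, Pi.smul_apply, smul_eq_mul]
      by_cases h1 : a' = a
      · by_cases h2 : b' = b
        · by_cases h3 : c' = c
          · by_cases h4 : e' = e
            · subst h1 h2 h3 h4; rfl
            · simp [h4]
          · simp [h3]
        · simp [h2]
      · simp [h1]
  rw [h2, map_smul, smul_eq_mul] at h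
  exact h.symm

/-- Under these hypotheses `c` or `e` differs from each of the other three indices; the reflection
of that axis changes the sign of the unit tensor. -/
theorem fderiv_unitTensor4_eq_zero (hw : stdPair X Y ∈ T.domain) {a b c e : Fin (n + 1)}
    (hce : c ≠ e) (h1 : ¬ (c = a ∧ e = b)) (h2 : ¬ (c = b ∧ e = a)) :
    fderiv ℝ T.lagrangian (stdPair X Y) (0, unitTensor4 a b c e) = 0 := by
  have hc := fderiv_unitTensor4_sign hw c a b c e
  have he := fderiv_unitTensor4_sign hw e a b c e
  simp only [axisSign] at hc he
  by_cases hca : a = c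
  · subst hca
    have : b ≠ e := fun h => h1 ⟨rfl, h.symm⟩
    simp [hce, this] at he
    linarith
  · by_cases hcb : b = c
    · subst hcb
      have : a ≠ e := fun h => h2 ⟨rfl, h.symm⟩
      simp [hce, this] at he
      linarith
    · simp [hca, hcb, hce.symm] at hc
      linarith

theorem fderiv_unitTensor4_perm (hw : stdPair X Y ∈ T.domain) {σ : Equiv.Perm (Fin (n + 1))}
    (hσ : σ 0 = 0) (a b c e : Fin (n + 1)) :
    fderiv ℝ T.lagrangian (stdPair X Y) (0, unitTensor4 (σ a) (σ b) (σ c) (σ e))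
      = fderiv ℝ T.lagrangian (stdPair X Y) (0, unitTensor4 a b c e) := by
  rw [← fderiv_stdPair_perm hw hσ]
  congr 1
  refine Prod.ext ?_ ?_
  · funext a b; simp
  · funext a' b' c' e'; simp [unitTensor4]

theorem fderiv_unitTensor2_perm (hw : stdPair X Y ∈ T.domain) {σ : Equiv.Perm (Fin (n + 1))}
    (hσ : σ 0 = 0) (a b : Fin (n + 1)) :
    fderiv ℝ T.lagrangian (stdPair X Y) (unitTensor2 (σ a) (σ b), 0)
      = fderiv ℝ T.lagrangian (stdPair X Y) (unitTensor2 a b, 0) := by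
  rw [← fderiv_stdPair_perm hw hσ]
  congr 1
  refine Prod.ext ?_ ?_
  · funext a' b'; simp [unitTensor2]
  · funext a b c d; simp

theorem swap_succ_zero (i j : Fin n) : Equiv.swap i.succ j.succ 0 = 0 :=
  Equiv.swap_apply_of_ne_of_ne (Fin.succ_ne_zero i).symm (Fin.succ_ne_zero j).symm

/-- A quantity attached to pairs of axes that is invariant under the permutations of the spatial
axes takes one value on pairs of distinct spatial axes. -/
theorem eq_of_perm_invariant {q : Fin (n + 1) → Fin (n + 1) → ℝ}
    (hq : ∀ σ : Equiv.Perm (Fin (n + 1)), σ 0 = 0 → ∀ a b, q (σ a) (σ b) = q a b)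
    {i j i' j' : Fin n} (hij : i ≠ j) (hij' : i' ≠ j') :
    q i.succ j.succ = q i'.succ j'.succ := by
  have hs : ∀ a b : Fin n, a ≠ b → a.succ ≠ b.succ := fun a b h h' => h (Fin.succ_injective n h')
  have h1 : ∀ {i j j' : Fin n}, i ≠ j → i ≠ j' → q i.succ j.succ = q i.succ j'.succ := by
    intro i j j' h h'
    have := hq _ (swap_succ_zero j j') i.succ j.succ
    rw [Equiv.swap_apply_left, Equiv.swap_apply_of_ne_of_ne (hs _ _ h) (hs _ _ h')] at this
    exact this.symm
  have h2 : ∀ {i j : Fin n}, q i.succ j.succ = q j.succ i.succ := by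
    intro i j
    have := hq _ (swap_succ_zero i j) i.succ j.succ
    rw [Equiv.swap_apply_left, Equiv.swap_apply_right] at this
    exact this.symm
  by_cases h : i = j'
  · subst h
    by_cases h3 : j = i'
    · subst h3; exact h2
    · rw [h1 hij hij'.symm, h2]
  · rw [h1 hij h, h2, h1 (Ne.symm h) hij'.symm, h2]

theorem eq_of_perm_invariant_zero {q : Fin (n + 1) → ℝ}
    (hq : ∀ σ : Equiv.Perm (Fin (n + 1)), σ 0 = 0 → ∀ a, q (σ a) = q a) (i j : Fin n) :
    q i.succ = q j.succ := by
  have := hq _ (swap_succ_zero i j) i.succ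
  rw [Equiv.swap_apply_left] at this
  exact this.symm

/-- The derivative of the Lagrangian in the direction of a curvature, up to two constants. -/
theorem exists_fderiv_curvature (hn : 2 ≤ n) (hw : stdPair X Y ∈ T.domain) :
    ∃ q₁ q₂ : ℝ, ∀ ρ : Tensor4 n, (∀ a b c e, ρ a b c e = - ρ b a c e) →
      (∀ a b c e, ρ a b c e = - ρ a b e c) →
      fderiv ℝ T.lagrangian (stdPair X Y) (0, ρ)
        = q₁ * ∑ i : Fin n, ρ 0 i.succ 0 i.succ
          + q₂ * ∑ i : Fin n, ∑ j : Fin n, ρ i.succ j.succ i.succ j.succ := by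
  set P : Fin (n + 1) → Fin (n + 1) → Fin (n + 1) → Fin (n + 1) → ℝ := fun a b c e =>
    fderiv ℝ T.lagrangian (stdPair X Y) (0, unitTensor4 a b c e) with hP
  -- The Lagrangian lives on all 4-tensors, so its partial derivatives need not be antisymmetric. A
  -- direction antisymmetric in its last pair detects only this difference.
  set q : Fin (n + 1) → Fin (n + 1) → ℝ := fun a b => P a b a b - P a b b a with hqdef
  have hq : ∀ σ : Equiv.Perm (Fin (n + 1)), σ 0 = 0 → ∀ a b, q (σ a) (σ b) = q a b := by
    intro σ hσ a b
    simp only [hqdef, hP, fderiv_unitTensor4_perm hw hσ]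
  -- Here `n ≥ 2` enters: the coefficient of the purely spatial part is read off at two distinct
  -- spatial axes.
  let i₀ : Fin n := ⟨0, by omega⟩
  let j₀ : Fin n := ⟨1, by omega⟩
  have hij₀ : i₀ ≠ j₀ := by simp [i₀, j₀]
  refine ⟨q 0 i₀.succ + q i₀.succ 0, q i₀.succ j₀.succ, fun ρ hρ₁ hρ₂ => ?_⟩
  have hab0 : ∀ a c e, ρ a a c e = 0 := fun a c e => by linarith [hρ₁ a a c e]
  have hce0 : ∀ a b c, ρ a b c c = 0 := fun a b c => by linarith [hρ₂ a b c c]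
  have hinner : ∀ a b, ∑ c, ∑ e, ρ a b c e * P a b c e = ρ a b a b * q a b := by
    intro a b
    by_cases hab : a = b
    · subst hab; simp [hab0]
    have h1 : ∀ c e, ρ a b c e * P a b c e
        = (if c = a then if e = b then ρ a b a b * P a b a b else 0 else 0)
          + if c = b then if e = a then ρ a b b a * P a b b a else 0 else 0 := by
      intro c e
      by_cases h2 : c = a ∧ e = b
      · obtain ⟨rfl, rfl⟩ := h2
        rw [if_pos rfl, if_pos rfl, if_neg hab, add_zero]
      · by_cases h3 : c = b ∧ e = a
        · obtain ⟨rfl, rfl⟩ := h3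
          rw [if_neg (Ne.symm hab), if_pos rfl, if_pos rfl, zero_add]
        · rw [← ite_and, if_neg h2, ← ite_and, if_neg h3, add_zero]
          by_cases hce : c = e
          · rw [hce, hce0, zero_mul]
          · have : P a b c e = 0 := fderiv_unitTensor4_eq_zero hw hce h2 h3
            rw [this, mul_zero]
    have hsum : ∀ (a b : Fin (n + 1)) (V : ℝ),
        ∑ c, ∑ e, (if c = a then if e = b then V else 0 else 0) = V := by
      intro a b V
      rw [Finset.sum_eq_single a (fun c _ hc => by simp [hc]) (by simp)]
      simp
    rw [Finset.sum_congr rfl fun c _ => Finset.sum_congr rfl fun e _ => h1 c e]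
    simp_rw [Finset.sum_add_distrib]
    rw [hsum, hsum, hρ₂ a b b a]
    simp only [hqdef]; ring
  have hmain : fderiv ℝ T.lagrangian (stdPair X Y) (0, ρ) = ∑ a, ∑ b, ρ a b a b * q a b := by
    rw [tensor4_eq_sum]
    simp only [map_sum, map_smul, smul_eq_mul]
    exact Finset.sum_congr rfl fun a _ => Finset.sum_congr rfl fun b _ => hinner a b
  rw [hmain, Fin.sum_univ_succ]
  simp only [Fin.sum_univ_succ (n := n), hab0, zero_mul, zero_add, Finset.sum_add_distrib]
  rw [← add_assoc, ← Finset.sum_add_distrib, Finset.mul_sum, Finset.mul_sum]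
  congr 1
  · refine Finset.sum_congr rfl fun i _ => ?_
    have e1 : q 0 i.succ = q 0 i₀.succ := eq_of_perm_invariant_zero (q := fun a => q 0 a)
      (fun σ hσ a => by have := hq σ hσ 0 a; rwa [hσ] at this) i i₀
    have e2 : q i.succ 0 = q i₀.succ 0 := eq_of_perm_invariant_zero (q := fun a => q a 0)
      (fun σ hσ a => by have := hq σ hσ a 0; rwa [hσ] at this) i i₀
    rw [e1, e2, hρ₁ i.succ, hρ₂ 0 i.succ]; ring
  · refine Finset.sum_congr rfl fun i _ => ?_
    rw [Finset.mul_sum]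
    refine Finset.sum_congr rfl fun j _ => ?_
    by_cases hij : i = j
    · subst hij; simp [hab0]
    · rw [eq_of_perm_invariant hq hij hij₀, mul_comm]

/-- The Lagrangian as a function of the two curvature scalars of an FLRW metric. -/
noncomputable def isoLagrangian (T : GravityTheory n) (X Y : ℝ) : ℝ := T.lagrangian (stdPair X Y)

/-- The derivative of the Lagrangian with respect to the first curvature scalar. -/
noncomputable def isoLagrangianX (T : GravityTheory n) (X Y : ℝ) : ℝ :=
  fderiv ℝ T.lagrangian (stdPair X Y) (0, isoCurvature 1 0 stdTemporal stdSpatial)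

/-- The derivative of the Lagrangian with respect to the second curvature scalar. -/
noncomputable def isoLagrangianY (T : GravityTheory n) (X Y : ℝ) : ℝ :=
  fderiv ℝ T.lagrangian (stdPair X Y) (0, isoCurvature 0 1 stdTemporal stdSpatial)

theorem isoCurvature_antisymm_left {S S' : Tensor2 n} (a b c e : Fin (n + 1)) :
    isoCurvature X Y S S' a b c e = - isoCurvature X Y S S' b a c e := by
  simp only [isoCurvature]; ring

theorem isoCurvature_antisymm_right {S S' : Tensor2 n} (a b c e : Fin (n + 1)) :
    isoCurvature X Y S S' a b c e = - isoCurvature X Y S S' a b e c := by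
  simp only [isoCurvature]; ring

theorem std_isoCurvature_temporal (i : Fin n) :
    isoCurvature X Y stdTemporal stdSpatial 0 i.succ 0 i.succ = - X := by
  simp [isoCurvature, stdTemporal, stdSpatial, Fin.succ_ne_zero, eq_comm (a := (0 : Fin (n + 1)))]

theorem sum_std_isoCurvature_spatial :
    ∑ i : Fin n, ∑ j : Fin n, isoCurvature X Y stdTemporal stdSpatial i.succ j.succ i.succ j.succ
      = n * (n - 1) * Y := by
  simp [isoCurvature, stdTemporal, stdSpatial, Fin.succ_ne_zero, Fin.succ_inj,
    Finset.sum_sub_distrib, mul_sub]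
  ring

/-- The derivative of the Lagrangian in the direction of a curvature. -/
theorem fderiv_stdPair_curvature (hn : 2 ≤ n) (hw : stdPair X Y ∈ T.domain) {ρ : Tensor4 n}
    (hρ₁ : ∀ a b c e, ρ a b c e = - ρ b a c e) (hρ₂ : ∀ a b c e, ρ a b c e = - ρ a b e c) :
    fderiv ℝ T.lagrangian (stdPair X Y) (0, ρ)
      = - (isoLagrangianX T X Y / n) * ∑ i : Fin n, ρ 0 i.succ 0 i.succ
        + isoLagrangianY T X Y / (n * (n - 1)) *
          ∑ i : Fin n, ∑ j : Fin n, ρ i.succ j.succ i.succ j.succ := by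
  obtain ⟨q₁, q₂, h⟩ := exists_fderiv_curvature hn hw
  have hn0 : (n : ℝ) ≠ 0 := by positivity
  have hn1 : (n : ℝ) - 1 ≠ 0 := by
    have : (2 : ℝ) ≤ n := by exact_mod_cast hn
    linarith
  -- The two unknown constants are found by testing on the curvatures with `(X, Y) = (1, 0)` and
  -- `(0, 1)`, along which the derivatives of `ℓ` are defined.
  have hX : isoLagrangianX T X Y = - (n * q₁) := by
    rw [isoLagrangianX, h _ isoCurvature_antisymm_left isoCurvature_antisymm_right,
      sum_std_isoCurvature_spatial]
    simp [std_isoCurvature_temporal, mul_comm]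
  have hY : isoLagrangianY T X Y = n * (n - 1) * q₂ := by
    rw [isoLagrangianY, h _ isoCurvature_antisymm_left isoCurvature_antisymm_right,
      sum_std_isoCurvature_spatial]
    simp [std_isoCurvature_temporal, mul_comm]
  rw [h ρ hρ₁ hρ₂, hX, hY]
  field_simp

/-- The derivative of the Lagrangian in the direction of an inverse metric, up to two constants. -/
theorem exists_fderiv_inverseMetric (hn : 2 ≤ n) (hw : stdPair X Y ∈ T.domain) :
    ∃ m₁ m₂ : ℝ, ∀ u : Tensor2 n, fderiv ℝ T.lagrangian (stdPair X Y) (u, 0)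
        = m₁ * u 0 0 + m₂ * ∑ i : Fin n, u i.succ i.succ := by
  set m : Fin (n + 1) → ℝ := fun a => fderiv ℝ T.lagrangian (stdPair X Y) (unitTensor2 a a, 0)
    with hm
  refine ⟨m 0, m (Fin.succ ⟨0, by omega⟩), fun u => ?_⟩
  have h1 : ∀ a, ∑ b, u a b * fderiv ℝ T.lagrangian (stdPair X Y) (unitTensor2 a b, 0)
      = u a a * m a := by
    intro a
    rw [Finset.sum_eq_single a (fun b _ hb => by
      rw [fderiv_unitTensor2_eq_zero hw hb.symm, mul_zero]) (by simp)]
  rw [tensor2_eq_sum]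
  simp only [map_sum, map_smul, smul_eq_mul]
  simp_rw [h1]
  rw [Fin.sum_univ_succ, Finset.mul_sum, mul_comm]
  congr 1
  refine Finset.sum_congr rfl fun i _ => ?_
  rw [mul_comm, eq_of_perm_invariant_zero (q := m)
    (fun σ hσ a => fderiv_unitTensor2_perm hw hσ a a) i ⟨0, by omega⟩]

/-- The derivative of the Lagrangian vanishes along infinitesimal changes of scale of the axes. -/
theorem fderiv_scaling {w : Tensor2 n × Tensor4 n} (hw : w ∈ T.domain) (β : Fin (n + 1) → ℝ) :
    fderiv ℝ T.lagrangian w (fun a b => (β a + β b) * w.1 a b,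
      fun a b c e => - (β a + β b + β c + β e) * w.2 a b c e) = 0 := by
  set d : ℝ → Fin (n + 1) → ℝ := fun ε a => 1 + ε * β a with hd
  have hd' : ∀ a, HasDerivAt (fun ε => d ε a) (β a) 0 := fun a => by
    simpa [hd] using ((hasDerivAt_id (0 : ℝ)).mul_const (β a)).const_add 1
  have hd0 : ∀ a, d 0 a = 1 := fun a => by simp [hd]
  have hdi : ∀ a, HasDerivAt (fun ε => (d ε a)⁻¹) (- β a) 0 := fun a => by
    have := (hd' a).fun_inv (by rw [hd0]; exact one_ne_zero)
    simpa [hd0] using this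
  set c : ℝ → Tensor2 n × Tensor4 n := fun ε => (fun a b => d ε a * d ε b * w.1 a b,
    fun a b c e => (d ε a)⁻¹ * (d ε b)⁻¹ * (d ε c)⁻¹ * (d ε e)⁻¹ * w.2 a b c e) with hc
  have hc0 : c 0 = w := by simp [hc, hd0]
  have hc' : HasDerivAt c (fun a b => (β a + β b) * w.1 a b,
      fun a b c e => - (β a + β b + β c + β e) * w.2 a b c e) 0 := by
    refine HasDerivAt.prodMk ?_ ?_
    · refine hasDerivAt_pi.2 fun a => hasDerivAt_pi.2 fun b => ?_
      refine (((hd' a).mul (hd' b)).mul_const (w.1 a b)).congr_deriv ?_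
      simp only [hd0]; ring
    · refine hasDerivAt_pi.2 fun a => hasDerivAt_pi.2 fun b => hasDerivAt_pi.2 fun c =>
        hasDerivAt_pi.2 fun e => ?_
      refine (((((hdi a).mul (hdi b)).mul (hdi c)).mul (hdi e)).mul_const
        (w.2 a b c e)).congr_deriv ?_
      simp only [hd0, Pi.mul_apply]; ring
  have hev : ∀ᶠ ε in nhds (0 : ℝ), ∀ a, d ε a ≠ 0 := by
    refine Filter.eventually_all.2 fun a => (hd' a).continuousAt.eventually_ne ?_
    rw [hd0]; exact one_ne_zero
  -- The diagonal frame with entries `1 + ε β` is invertible for small `ε` only, so constancy along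
  -- the curve is a local statement.
  have hconst : (fun ε => T.lagrangian (c ε)) =ᶠ[nhds 0] fun _ => T.lagrangian w := by
    filter_upwards [hev] with ε hε
    have := T.scalar (diagonalFrame (d ε) hε) w hw
    rwa [changeFrame_diagonalFrame] at this
  have hL : HasFDerivAt T.lagrangian (fderiv ℝ T.lagrangian w) (c 0) := by
    rw [hc0]; exact (T.differentiableAt hw).hasFDerivAt
  exact ((hL.comp_hasDerivAt 0 hc').congr_of_eventuallyEq hconst.symm).unique
    (hasDerivAt_const 0 _)

/-- The derivative of the Lagrangian at the standard pair. -/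
theorem fderiv_stdPair (hn : 2 ≤ n) (hw : stdPair X Y ∈ T.domain) {u : Tensor2 n} {ρ : Tensor4 n}
    (hρ₁ : ∀ a b c e, ρ a b c e = - ρ b a c e) (hρ₂ : ∀ a b c e, ρ a b c e = - ρ a b e c) :
    fderiv ℝ T.lagrangian (stdPair X Y) (u, ρ)
      = - (X * isoLagrangianX T X Y) * u 0 0
        + (X * isoLagrangianX T X Y + 2 * Y * isoLagrangianY T X Y) / n
          * (∑ i : Fin n, u i.succ i.succ)
        - (isoLagrangianX T X Y / n) * (∑ i : Fin n, ρ 0 i.succ 0 i.succ)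
        + isoLagrangianY T X Y / (n * (n - 1)) *
          ∑ i : Fin n, ∑ j : Fin n, ρ i.succ j.succ i.succ j.succ := by
  obtain ⟨m₁, m₂, hm⟩ := exists_fderiv_inverseMetric hn hw
  have hn0 : (n : ℝ) ≠ 0 := by positivity
  have hn1 : (n : ℝ) - 1 ≠ 0 := by
    have : (2 : ℝ) ≤ n := by exact_mod_cast hn
    linarith
  have hsplit : ∀ (u : Tensor2 n) (ρ : Tensor4 n), ((u, ρ) : Tensor2 n × Tensor4 n)
      = (u, 0) + (0, ρ) := fun u ρ => by simp
  have hS : ∀ β : Fin (n + 1) → ℝ,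
      m₁ * ((β 0 + β 0) * -1) + m₂ * ∑ i : Fin n, (β i.succ + β i.succ)
      + (- (isoLagrangianX T X Y / n) * (∑ i : Fin n,
          - (β 0 + β i.succ + β 0 + β i.succ) * (- X))
        + isoLagrangianY T X Y / (n * (n - 1)) *
          ∑ i : Fin n, ∑ j : Fin n, - (β i.succ + β j.succ + β i.succ + β j.succ) *
            isoCurvature X Y stdTemporal stdSpatial i.succ j.succ i.succ j.succ) = 0 := by
    intro β
    have h := fderiv_scaling hw β
    rw [hsplit, map_add, hm, fderiv_stdPair_curvature hn hw] at h
    · simp only [stdPair, std_isoCurvature_temporal] at h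
      simpa [stdSpatial, stdTemporal] using h
    · intro a b c e
      simp only [stdPair]
      rw [isoCurvature_antisymm_left]; ring
    · intro a b c e
      simp only [stdPair]
      rw [isoCurvature_antisymm_right]; ring
  -- Rescaling the time axis alone determines `m₁`, and rescaling all spatial axes together
  -- determines `m₂`.
  have h0 := hS (Fin.cons 1 fun _ => 0)
  have h1 := hS (Fin.cons 0 fun _ => 1)
  simp only [Fin.cons_zero, Fin.cons_succ, ← Finset.mul_sum, sum_std_isoCurvature_spatial,
    Finset.sum_const, Finset.card_univ, Fintype.card_fin, nsmul_eq_mul] at h0 h1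
  have e0 : m₁ = - (X * isoLagrangianX T X Y) := by
    field_simp at h0
    linarith
  have e1 : m₂ = (X * isoLagrangianX T X Y + 2 * Y * isoLagrangianY T X Y) / n := by
    field_simp at h1 ⊢
    linarith
  rw [hsplit, map_add, hm, fderiv_stdPair_curvature hn hw hρ₁ hρ₂, e0, e1]
  ring

/-- Affine dependence on `(X, Y)` makes the derivatives of `ℓ` directional derivatives of the
Lagrangian along two fixed curvatures. -/
theorem stdPair_eq (X Y : ℝ) : (stdPair X Y : Tensor2 n × Tensor4 n)
    = stdPair 0 0 + X • (0, isoCurvature 1 0 stdTemporal stdSpatial)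
      + Y • (0, isoCurvature 0 1 stdTemporal stdSpatial) := by
  refine Prod.ext ?_ ?_
  · simp [stdPair]
  · funext a b c e
    simp [stdPair, isoCurvature]
    ring

theorem hasDerivAt_isoLagrangian {x y : ℝ → ℝ} {x' y' t : ℝ} (hx : HasDerivAt x x' t)
    (hy : HasDerivAt y y' t) (hw : stdPair (x t) (y t) ∈ T.domain) :
    HasDerivAt (fun s => isoLagrangian T (x s) (y s))
      (isoLagrangianX T (x t) (y t) * x' + isoLagrangianY T (x t) (y t) * y') t := by
  have h1 : HasDerivAt (fun s => (stdPair (x s) (y s) : Tensor2 n × Tensor4 n))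
      (x' • (0, isoCurvature 1 0 stdTemporal stdSpatial)
        + y' • (0, isoCurvature 0 1 stdTemporal stdSpatial)) t := by
    have h2 := ((hx.smul_const ((0, isoCurvature 1 0 stdTemporal stdSpatial) :
      Tensor2 n × Tensor4 n)).const_add (stdPair 0 0)).add (hy.smul_const
        ((0, isoCurvature 0 1 stdTemporal stdSpatial) : Tensor2 n × Tensor4 n))
    refine h2.congr_of_eventuallyEq (Filter.Eventually.of_forall fun s => ?_)
    simp only [Pi.add_apply]
    rw [stdPair_eq (x s) (y s)]
  refine ((T.differentiableAt hw).hasFDerivAt.comp_hasDerivAt t h1).congr_deriv ?_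
  rw [map_add, map_smul, map_smul, smul_eq_mul, smul_eq_mul, mul_comm x', mul_comm y']
  rfl

theorem contDiff_stdPair :
    ContDiff ℝ ∞ (fun z : ℝ × ℝ => (stdPair z.1 z.2 : Tensor2 n × Tensor4 n)) := by
  have : (fun z : ℝ × ℝ => (stdPair z.1 z.2 : Tensor2 n × Tensor4 n)) = fun z =>
      stdPair 0 0 + z.1 • (0, isoCurvature 1 0 stdTemporal stdSpatial)
        + z.2 • (0, isoCurvature 0 1 stdTemporal stdSpatial) := funext fun z => stdPair_eq z.1 z.2
  rw [this]
  fun_prop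

theorem contDiffAt_isoLagrangian {x y : ℝ → ℝ} {t : ℝ} (hx : ContDiffAt ℝ ∞ x t)
    (hy : ContDiffAt ℝ ∞ y t) (hw : stdPair (x t) (y t) ∈ T.domain) :
    ContDiffAt ℝ ∞ (fun s => isoLagrangian T (x s) (y s)) t ∧
    ContDiffAt ℝ ∞ (fun s => isoLagrangianX T (x s) (y s)) t ∧
    ContDiffAt ℝ ∞ (fun s => isoLagrangianY T (x s) (y s)) t := by
  have h1 : ContDiffAt ℝ ∞ (fun s => (stdPair (x s) (y s) : Tensor2 n × Tensor4 n)) t :=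
    contDiff_stdPair.contDiffAt.comp t (hx.prodMk hy)
  have h2 : ContDiffAt ℝ ∞ T.lagrangian (stdPair (x t) (y t)) :=
    (T.smooth _ hw).contDiffAt (T.isOpen_domain.mem_nhds hw)
  have h3 : ContDiffAt ℝ ∞ (fderiv ℝ T.lagrangian) (stdPair (x t) (y t)) :=
    h2.fderiv_right (by simp)
  have h4 := ContDiffAt.comp t h3 h1
  exact ⟨h2.comp t h1, h4.clm_apply contDiffAt_const, h4.clm_apply contDiffAt_const⟩

theorem isOpen_stdPair_domain : IsOpen {z : ℝ × ℝ | stdPair z.1 z.2 ∈ T.domain} :=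
  T.isOpen_domain.preimage contDiff_stdPair.continuous

end Isotropic

end Frames

/-! ### An orthonormal frame of the FLRW metric -/

section FlrwFrame

variable {n : ℕ} {k : ℝ} {x : Fin n → ℝ}

/-- A rank one perturbation of the identity. -/
def rankOne (α : ℝ) (x : Fin n → ℝ) (i j : Fin n) : ℝ := (if i = j then 1 else 0) + α * x i * x j

/-- Perturbations of the identity along a fixed `x` are closed under products, so inverses and
square roots reduce to scalar equations for the coefficient. -/
theorem sum_rankOne_mul (α β : ℝ) (x : Fin n → ℝ) (i j : Fin n) :
    ∑ l, rankOne α x i l * rankOne β x l j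
      = rankOne (α + β + α * β * radiusSq x) x i j := by
  have h : ∀ l, rankOne α x i l * rankOne β x l j
      = (if i = l then (if l = j then 1 else 0) + β * x l * x j else 0)
        + (if l = j then α * x i * x l else 0) + α * β * x i * x j * (x l * x l) := by
    intro l
    simp only [rankOne]
    split_ifs <;> ring
  simp_rw [h, Finset.sum_add_distrib, ← Finset.mul_sum, sum_sq_eq]
  simp only [rankOne, Finset.sum_ite_eq, Finset.sum_ite_eq', Finset.mem_univ, if_true]
  ring

theorem rankOne_symm (α : ℝ) (x : Fin n → ℝ) (i j : Fin n) :
    rankOne α x i j = rankOne α x j i := by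
  simp only [rankOne, eq_comm (a := i)]; ring

theorem rankOne_zero (x : Fin n → ℝ) (i j : Fin n) :
    rankOne 0 x i j = if i = j then 1 else 0 := by
  simp [rankOne]

theorem spatialMetric_eq_rankOne (i j : Fin n) :
    spatialMetric k x i j = rankOne (k / (1 - k * radiusSq x)) x i j := by
  simp only [spatialMetric, rankOne]; ring

theorem spatialInverse_eq_rankOne (i j : Fin n) :
    spatialInverse k x i j = rankOne (- k) x i j := by
  simp only [spatialInverse, rankOne]; ring

/-- The coefficient of the square root of the inverse spatial metric. -/
noncomputable def rootCoeff (k : ℝ) (x : Fin n → ℝ) : ℝ :=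
  - k / (1 + Real.sqrt (1 - k * radiusSq x))

/-- The coefficient of the square root of the spatial metric. -/
noncomputable def rootInvCoeff (k : ℝ) (x : Fin n → ℝ) : ℝ :=
  k / (Real.sqrt (1 - k * radiusSq x) * (1 + Real.sqrt (1 - k * radiusSq x)))

/-- With `s = √(1 - k r²)` the first coefficient is `(s - 1)/r²`, rationalized to `-k/(1 + s)` so
that nothing degenerates at `r = 0` or `k = 0`. All three identities follow from `k r² = 1 - s²`. -/
theorem rootCoeff_identities (hx : 0 < 1 - k * radiusSq x) :
    rootCoeff k x + rootCoeff k x + rootCoeff k x * rootCoeff k x * radiusSq x = - k ∧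
    rootInvCoeff k x + rootInvCoeff k x + rootInvCoeff k x * rootInvCoeff k x * radiusSq x
      = k / (1 - k * radiusSq x) ∧
    rootCoeff k x + rootInvCoeff k x + rootCoeff k x * rootInvCoeff k x * radiusSq x = 0 := by
  have hs := Real.sqrt_pos.2 hx
  have hs2 := Real.sq_sqrt hx.le
  set s := Real.sqrt (1 - k * radiusSq x) with hsdef
  have h1 : 1 + s ≠ 0 := by positivity
  have h2 : s ≠ 0 := hs.ne'
  have h3 : k * radiusSq x = 1 - s ^ 2 := by linarith
  have h4 : rootCoeff k x = - k / (1 + s) := rfl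
  have h5 : rootInvCoeff k x = k / (s * (1 + s)) := rfl
  rw [h4, h5, ← hs2]
  refine ⟨?_, ?_, ?_⟩
  · field_simp
    linear_combination k * h3
  · field_simp
    linear_combination k * h3
  · field_simp
    linear_combination (-k) * h3

theorem sum_root_mul_root (hx : 0 < 1 - k * radiusSq x) (i j : Fin n) :
    ∑ l, rankOne (rootCoeff k x) x i l * rankOne (rootCoeff k x) x l j = spatialInverse k x i j := by
  rw [sum_rankOne_mul, (rootCoeff_identities hx).1, spatialInverse_eq_rankOne]

theorem sum_rootInv_mul_rootInv (hx : 0 < 1 - k * radiusSq x) (i j : Fin n) :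
    ∑ l, rankOne (rootInvCoeff k x) x i l * rankOne (rootInvCoeff k x) x l j
      = spatialMetric k x i j := by
  rw [sum_rankOne_mul, (rootCoeff_identities hx).2.1, spatialMetric_eq_rankOne]

theorem sum_root_mul_rootInv (hx : 0 < 1 - k * radiusSq x) (i j : Fin n) :
    ∑ l, rankOne (rootCoeff k x) x i l * rankOne (rootInvCoeff k x) x l j
      = if i = j then 1 else 0 := by
  rw [sum_rankOne_mul, (rootCoeff_identities hx).2.2, rankOne_zero]

theorem sum_rootInv_mul_root (hx : 0 < 1 - k * radiusSq x) (i j : Fin n) :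
    ∑ l, rankOne (rootInvCoeff k x) x i l * rankOne (rootCoeff k x) x l j
      = if i = j then 1 else 0 := by
  rw [sum_rankOne_mul, add_comm (rootInvCoeff k x), mul_comm (rootInvCoeff k x),
    (rootCoeff_identities hx).2.2, rankOne_zero]

/-- The matrix `diag (u, v B)` with a scalar `u` and a spatial block `v B`. -/
def blockMatrix (u v : ℝ) (B : Fin n → Fin n → ℝ) : Matrix (Fin (n + 1)) (Fin (n + 1)) ℝ :=
  Matrix.of (Fin.cons (Fin.cons u fun _ => 0) fun i => Fin.cons 0 fun j => v * B i j)

@[simp] theorem blockMatrix_zero_zero (u v : ℝ) (B : Fin n → Fin n → ℝ) :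
    blockMatrix u v B 0 0 = u := rfl

@[simp] theorem blockMatrix_zero_succ (u v : ℝ) (B : Fin n → Fin n → ℝ) (j : Fin n) :
    blockMatrix u v B 0 j.succ = 0 := rfl

@[simp] theorem blockMatrix_succ_zero (u v : ℝ) (B : Fin n → Fin n → ℝ) (i : Fin n) :
    blockMatrix u v B i.succ 0 = 0 := rfl

@[simp] theorem blockMatrix_succ_succ (u v : ℝ) (B : Fin n → Fin n → ℝ) (i j : Fin n) :
    blockMatrix u v B i.succ j.succ = v * B i j := rfl

theorem blockMatrix_mul_eq_one {u v u' v' : ℝ} {B B' : Fin n → Fin n → ℝ} (hu : u * u' = 1)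
    (hv : v * v' = 1) (hB : ∀ i j, ∑ l, B i l * B' l j = if i = j then 1 else 0) :
    blockMatrix u v B * blockMatrix u' v' B' = 1 := by
  ext μ ν
  rw [Matrix.mul_apply, Fin.sum_univ_succ, Matrix.one_apply]
  refine Fin.cases ?_ (fun i => ?_) μ <;> refine Fin.cases ?_ (fun j => ?_) ν
  · simp [hu]
  · simp [eq_comm (a := (0 : Fin (n + 1)))]
  · simp
  · have : ∀ l, v * B i l * (v' * B' l j) = v * v' * (B i l * B' l j) := fun l => by ring
    simp only [blockMatrix_succ_zero, blockMatrix_succ_succ, zero_mul, zero_add, this,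
      Fin.succ_inj, hB, hv, one_mul]

/-- The orthonormal frame, with lapse `N` and scale factor `b`. -/
noncomputable def flrwFrame {N b : ℝ} (hN : N ≠ 0) (hb : b ≠ 0) (hx : 0 < 1 - k * radiusSq x) :
    Matrix.GeneralLinearGroup (Fin (n + 1)) ℝ where
  val := blockMatrix N⁻¹ b⁻¹ (rankOne (rootCoeff k x) x)
  inv := blockMatrix N b (rankOne (rootInvCoeff k x) x)
  val_inv := blockMatrix_mul_eq_one (inv_mul_cancel₀ hN) (inv_mul_cancel₀ hb)
    (sum_root_mul_rootInv hx)
  inv_val := blockMatrix_mul_eq_one (mul_inv_cancel₀ hN) (mul_inv_cancel₀ hb)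
    (sum_rootInv_mul_root hx)

theorem sum_std_eq (M M' : Fin (n + 1) → ℝ) (t s : ℝ) :
    ∑ c, ∑ d, M c * M' d * (s * stdSpatial c d + t * stdTemporal c d)
      = t * (M 0 * M' 0) + s * ∑ i : Fin n, M i.succ * M' i.succ := by
  have h : ∀ c, ∑ d, M c * M' d * (s * stdSpatial c d + t * stdTemporal c d)
      = M c * M' c * (if c = 0 then t else s) := by
    intro c
    rw [Finset.sum_eq_single c (fun d _ hd => by simp [stdSpatial, stdTemporal, hd.symm]) (by simp)]
    by_cases hc : c = 0 <;> simp [stdSpatial, stdTemporal, hc]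
  simp_rw [h]
  rw [Fin.sum_univ_succ, Finset.mul_sum]
  simp [mul_comm]

/-- The inverse metric and the Riemann tensor of an FLRW metric, given the values of the lapse,
of the scale factor and of the two curvature scalars. -/
noncomputable def flrwPair (k : ℝ) (x : Fin n → ℝ) (b F X Y : ℝ) : Tensor2 n × Tensor4 n :=
  (blockMatrix (- 1 / F) (1 / b ^ 2) (spatialInverse k x),
    isoCurvature X Y (blockMatrix F 0 fun _ _ => 0)
      (blockMatrix 0 (b ^ 2) (spatialMetric k x)))

/-- The spatial block of the frame is a symmetric square root of `γ⁻¹`, scaled by `1/b`; its inverse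
is a symmetric square root of `γ`, scaled by `b`. Contracting two copies therefore gives the inverse
metric and the metric. -/
theorem changeFrame_flrwFrame {N b : ℝ} (hN : N ≠ 0) (hb : b ≠ 0)
    (hx : 0 < 1 - k * radiusSq x) (X Y : ℝ) :
    changeFrame (flrwFrame hN hb hx) (stdPair X Y) = flrwPair k x b (N ^ 2) X Y := by
  have h1 : (flrwFrame hN hb hx).1 = blockMatrix N⁻¹ b⁻¹ (rankOne (rootCoeff k x) x) := rfl
  have h2 : ((flrwFrame hN hb hx)⁻¹).1 = blockMatrix N b (rankOne (rootInvCoeff k x) x) := rfl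
  refine Prod.ext ?_ ?_
  · funext a c
    have h := sum_std_eq (fun e => blockMatrix N⁻¹ b⁻¹ (rankOne (rootCoeff k x) x) a e)
      (fun e => blockMatrix N⁻¹ b⁻¹ (rankOne (rootCoeff k x) x) c e) (-1) 1
    simp only [changeFrame, stdPair, h1]
    refine Eq.trans (Finset.sum_congr rfl fun _ _ => Finset.sum_congr rfl fun _ _ => ?_)
      (h.trans ?_)
    · ring
    refine Fin.cases ?_ (fun i => ?_) a <;> refine Fin.cases ?_ (fun j => ?_) c
    · simp [flrwPair]; field_simp
    · simp [flrwPair]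
    · simp [flrwPair]
    · simp only [flrwPair, blockMatrix_succ_zero, blockMatrix_succ_succ,
        ← sum_root_mul_root hx i j, Finset.mul_sum]
      rw [mul_zero, mul_zero, zero_add]
      refine Finset.sum_congr rfl fun l _ => ?_
      rw [rankOne_symm _ _ j l]; field_simp
  · rw [stdPair, changeFrame_isoCurvature]
    have hp : ∀ (t s : ℝ) (a c : Fin (n + 1)), pullTensor (flrwFrame hN hb hx)
        (fun c d => s * stdSpatial c d + t * stdTemporal c d) a c
        = t * (blockMatrix N b (rankOne (rootInvCoeff k x) x) 0 a
            * blockMatrix N b (rankOne (rootInvCoeff k x) x) 0 c)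
          + s * ∑ i : Fin n, blockMatrix N b (rankOne (rootInvCoeff k x) x) i.succ a
            * blockMatrix N b (rankOne (rootInvCoeff k x) x) i.succ c := by
      intro t s a c
      simp only [pullTensor, h2]
      exact sum_std_eq _ _ t s
    have hT : pullTensor (flrwFrame hN hb hx) stdTemporal
        = blockMatrix (N ^ 2) 0 fun _ _ => 0 := by
      funext a c
      have := hp 1 0 a c
      simp only [zero_mul, one_mul, zero_add, add_zero] at this
      refine this.trans ?_
      refine Fin.cases ?_ (fun i => ?_) a <;> refine Fin.cases ?_ (fun j => ?_) c <;> simp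
      ring
    have hS : pullTensor (flrwFrame hN hb hx) stdSpatial
        = blockMatrix 0 (b ^ 2) (spatialMetric k x) := by
      funext a c
      have := hp 0 1 a c
      simp only [zero_mul, one_mul, zero_add, add_zero] at this
      refine this.trans ?_
      refine Fin.cases ?_ (fun i => ?_) a <;> refine Fin.cases ?_ (fun j => ?_) c
      · simp
      · simp
      · simp
      · simp only [blockMatrix_succ_succ, ← sum_rootInv_mul_rootInv hx i j, Finset.mul_sum]
        refine Finset.sum_congr rfl fun l _ => ?_
        rw [rankOne_symm _ _ l i]; ring
    rw [hT, hS]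
    rfl

/-- Only standard pairs are needed. Their curvature is built from two-index tensors, so no
four-index inversion has to be carried out. -/
theorem changeFrame_inv_changeFrame (A : Matrix.GeneralLinearGroup (Fin (n + 1)) ℝ)
    (X Y : ℝ) : changeFrame A⁻¹ (changeFrame A (stdPair X Y)) = stdPair X Y := by
  have h1 : ∀ a b, ∑ e, (A⁻¹).1 a e * A.1 e b = if a = b then 1 else 0 := fun a b => by
    have : (A⁻¹).1 * A.1 = 1 := A.inv_val
    rw [← Matrix.one_apply, ← this, Matrix.mul_apply]
  have h2 : ∀ (M M' : Fin (n + 1) → Fin (n + 1) → ℝ) (S : Tensor2 n),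
      (∀ a b, ∑ e, M e a * M' b e = if a = b then 1 else 0) →
      (fun a b => ∑ c, ∑ d, M c a * M d b * ∑ e, ∑ f, M' e c * M' f d * S e f) = S := by
    intro M M' S hM
    funext a b
    have : ∀ c d, M c a * M d b * ∑ e, ∑ f, M' e c * M' f d * S e f
        = ∑ e, ∑ f, (M c a * M' e c) * (M d b * M' f d) * S e f := by
      intro c d
      simp only [Finset.mul_sum]
      exact Finset.sum_congr rfl fun _ _ => Finset.sum_congr rfl fun _ _ => by ring
    simp_rw [this]
    calc _ = ∑ c, ∑ e, ∑ d, ∑ f, (M c a * M' e c) * (M d b * M' f d) * S e f :=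
          Finset.sum_congr rfl fun _ _ => Finset.sum_comm
      _ = ∑ e, ∑ c, ∑ f, ∑ d, (M c a * M' e c) * (M d b * M' f d) * S e f := by
          rw [Finset.sum_comm]
          exact Finset.sum_congr rfl fun _ _ => Finset.sum_congr rfl fun _ _ => Finset.sum_comm
      _ = ∑ e, ∑ f, ∑ c, ∑ d, (M c a * M' e c) * (M d b * M' f d) * S e f :=
          Finset.sum_congr rfl fun _ _ => Finset.sum_comm
      _ = ∑ e, ∑ f, (∑ c, M c a * M' e c) * (∑ d, M d b * M' f d) * S e f := by
          refine Finset.sum_congr rfl fun _ _ => Finset.sum_congr rfl fun _ _ => ?_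
          rw [Finset.sum_mul_sum, Finset.sum_mul]
          exact Finset.sum_congr rfl fun _ _ => by rw [Finset.sum_mul]
      _ = S a b := by simp [hM]
  have hinv : ((A⁻¹)⁻¹).1 = A.1 := by rw [inv_inv]
  have h3 : ∀ S, pullTensor A⁻¹ (pullTensor A S) = S := fun S =>
    h2 (fun e a => ((A⁻¹)⁻¹).1 e a) (fun e a => (A⁻¹).1 e a) S fun a b => by
      rw [hinv]
      have := h1 b a
      simp only [eq_comm (a := b)] at this
      rw [← this]
      exact Finset.sum_congr rfl fun _ _ => mul_comm _ _
  have h4 : changeFrame A (stdPair X Y) = ((changeFrame A (stdPair X Y)).1,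
      isoCurvature X Y (pullTensor A stdTemporal) (pullTensor A stdSpatial)) :=
    Prod.ext rfl (changeFrame_isoCurvature A _ X Y _ _)
  refine Prod.ext ?_ ?_
  · exact h2 (fun e a => (A⁻¹).1 a e) (fun e a => A.1 a e) (stdPair X Y).1 fun a b => h1 a b
  · rw [h4, changeFrame_isoCurvature, h3, h3]
    rfl

end FlrwFrame

/-! ### The reduced Lagrangian and its Euler-Lagrange expressions -/

section Reduced

variable {n : ℕ} {k : ℝ} {a F : ℝ → ℝ} {p : Coord n} {I : Set ℝ} {T : GravityTheory n}

/-- The first curvature scalar along the curve `(a, F)`. -/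
noncomputable def scalarX (a F : ℝ → ℝ) (t : ℝ) : ℝ :=
  accel (a t) (deriv a t) (deriv (deriv a) t) (F t) (deriv F t)

/-- The second curvature scalar along the curve `(a, F)`. -/
noncomputable def scalarY (k : ℝ) (a F : ℝ → ℝ) (t : ℝ) : ℝ := hubbleSq k (a t) (deriv a t) (F t)

theorem ScaleLapse.curvatureData_flrw (h : ScaleLapse I a F) (hp : p ∈ flrwDomain n k I) :
    curvatureData (flrw k a F) p = flrwPair k (Fin.tail p) (a (p 0)) (F (p 0))
      (scalarX a F (p 0)) (scalarY k a F (p 0)) := by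
  rw [curvatureData, h.inverseMetric_flrw hp, h.riemann_flrw hp]
  refine Prod.ext ?_ ?_
  · funext μ ν
    refine Fin.cases ?_ (fun i => ?_) μ <;> refine Fin.cases ?_ (fun j => ?_) ν <;>
      simp [flrwPair, flrwInverse]
    ring
  · have h1 : temporalPart F p = blockMatrix (F (p 0)) 0 fun _ _ => 0 := by
      funext μ ν
      refine Fin.cases ?_ (fun i => ?_) μ <;> refine Fin.cases ?_ (fun j => ?_) ν <;>
        simp [temporalPart]
    have h2 : spatialPart k a p = blockMatrix 0 (a (p 0) ^ 2) (spatialMetric k (Fin.tail p)) := by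
      funext μ ν
      refine Fin.cases ?_ (fun i => ?_) μ <;> refine Fin.cases ?_ (fun j => ?_) ν <;>
        simp [spatialPart]
    rw [h1, h2]
    rfl

variable {x : Fin n → ℝ} {b N X Y : ℝ}

theorem flrwPair_mem_domain (hb : 0 < b) (hN : 0 < N) (hx : 0 < 1 - k * radiusSq x)
    (h : stdPair X Y ∈ T.domain) : flrwPair k x b N X Y ∈ T.domain := by
  have := T.domain_invariant (flrwFrame (Real.sqrt_pos.2 hN).ne' hb.ne' hx) _ h
  rwa [changeFrame_flrwFrame, Real.sq_sqrt hN.le] at this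

/-- The inverse of the orthonormal frame carries the FLRW data back to the standard pair, and the
domain is invariant under it. -/
theorem stdPair_mem_domain (hb : 0 < b) (hN : 0 < N) (hx : 0 < 1 - k * radiusSq x)
    (h : flrwPair k x b N X Y ∈ T.domain) : stdPair X Y ∈ T.domain := by
  have e := changeFrame_flrwFrame (Real.sqrt_pos.2 hN).ne' hb.ne' hx X Y
  rw [Real.sq_sqrt hN.le] at e
  have := T.domain_invariant (flrwFrame (Real.sqrt_pos.2 hN).ne' hb.ne' hx)⁻¹ _ h
  rwa [← e, changeFrame_inv_changeFrame] at this

theorem lagrangian_flrwPair (hb : 0 < b) (hN : 0 < N) (hx : 0 < 1 - k * radiusSq x)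
    (h : stdPair X Y ∈ T.domain) : T.lagrangian (flrwPair k x b N X Y) = isoLagrangian T X Y := by
  have := T.scalar (flrwFrame (Real.sqrt_pos.2 hN).ne' hb.ne' hx) _ h
  rwa [changeFrame_flrwFrame, Real.sq_sqrt hN.le] at this

theorem ScaleLapse.density_flrw (h : ScaleLapse I a F) (hp : p ∈ flrwDomain n k I)
    (hw : stdPair (scalarX a F (p 0)) (scalarY k a F (p 0)) ∈ T.domain) :
    density T (flrw k a F) p = Real.sqrt (F (p 0)) * a (p 0) ^ n *
      isoLagrangian T (scalarX a F (p 0)) (scalarY k a F (p 0))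
        / Real.sqrt (1 - k * radiusSq (Fin.tail p)) := by
  rw [density, h.volumeFactor_flrw hp, h.curvatureData_flrw hp,
    lagrangian_flrwPair (h.scale_pos _ hp.1) (h.lapse_pos _ hp.1) hp.2 hw]
  ring

/-- The reduced Lagrangian without its dependence on the spatial point. -/
noncomputable def radialLagrangian (T : GravityTheory n) (k a₀ a₁ a₂ F₀ F₁ : ℝ) : ℝ :=
  Real.sqrt F₀ * a₀ ^ n * isoLagrangian T (accel a₀ a₁ a₂ F₀ F₁) (hubbleSq k a₀ a₁ F₀)

/-- The polynomial curves in the definition of the reduced Lagrangian are positive on an open set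
containing time zero, where their derivatives are the prescribed values. The formula for the density
at this instant needs no interval around it on which the curvature stays in the domain. -/
theorem reducedLagrangian_eq {a₀ a₁ a₂ F₀ F₁ : ℝ} (ha₀ : 0 < a₀) (hF₀ : 0 < F₀)
    (hx : 0 < 1 - k * radiusSq x)
    (hw : stdPair (accel a₀ a₁ a₂ F₀ F₁) (hubbleSq k a₀ a₁ F₀) ∈ T.domain) :
    reducedLagrangian T k x a₀ a₁ a₂ F₀ F₁
      = radialLagrangian T k a₀ a₁ a₂ F₀ F₁ / Real.sqrt (1 - k * radiusSq x) := by
  set a : ℝ → ℝ := fun s => a₀ + a₁ * s + a₂ * s ^ 2 / 2 with ha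
  set F : ℝ → ℝ := fun s => F₀ + F₁ * s with hF
  have hac : ContDiff ℝ ∞ a := by simp only [ha]; fun_prop
  have hFc : ContDiff ℝ ∞ F := by simp only [hF]; fun_prop
  have h : ScaleLapse {s | 0 < a s ∧ 0 < F s} a F :=
    { isOpen := (isOpen_lt continuous_const hac.continuous).inter
        (isOpen_lt continuous_const hFc.continuous)
      smooth_scale := hac.contDiffOn
      smooth_lapse := hFc.contDiffOn
      scale_pos := fun t ht => ht.1
      lapse_pos := fun t ht => ht.2 }
  have hda : ∀ s, HasDerivAt a (a₁ + a₂ * s) s := by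
    intro s
    have := (((hasDerivAt_id s).const_mul a₁).const_add a₀).add
      ((((hasDerivAt_id s).fun_pow 2).const_mul a₂).div_const 2)
    refine this.congr_deriv ?_
    simp; ring
  have hda' : deriv a = fun s => a₁ + a₂ * s := funext fun s => (hda s).deriv
  have hdda : deriv (deriv a) 0 = a₂ := by
    rw [hda']
    have := ((hasDerivAt_id (0 : ℝ)).const_mul a₂).const_add a₁
    exact this.deriv.trans (mul_one a₂)
  have hdF : deriv F 0 = F₁ := by
    have := ((hasDerivAt_id (0 : ℝ)).const_mul F₁).const_add F₀
    exact this.deriv.trans (mul_one F₁)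
  have hp : (Fin.cons 0 x : Coord n) ∈ flrwDomain n k {s | 0 < a s ∧ 0 < F s} := by
    refine ⟨?_, ?_⟩
    · simp [ha, hF, ha₀, hF₀]
    · simpa using hx
  have e0 : a 0 = a₀ := by simp [ha]
  have e1 : F 0 = F₀ := by simp [hF]
  have e2 : deriv a 0 = a₁ := by rw [hda']; simp
  have eX : scalarX a F 0 = accel a₀ a₁ a₂ F₀ F₁ := by rw [scalarX, e0, e1, e2, hdda, hdF]
  have eY : scalarY k a F 0 = hubbleSq k a₀ a₁ F₀ := by rw [scalarY, e0, e1, e2]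
  have := h.density_flrw (T := T) hp (by simpa only [Fin.cons_zero, eX, eY] using hw)
  simp only [Fin.cons_zero, Fin.tail_cons, eX, eY, e0, e1] at this
  exact this

/-- A curve `(a, F)` whose curvature lies in the domain of the Lagrangian. -/
structure AdmissibleCurve (T : GravityTheory n) (k : ℝ) (I : Set ℝ) (a F : ℝ → ℝ) : Prop
    extends ScaleLapse I a F where
  mem_domain : ∀ t ∈ I, stdPair (scalarX a F t) (scalarY k a F t) ∈ T.domain

theorem AdmissibleCurve.reducedLagrangian_eq (h : AdmissibleCurve T k I a F) {t : ℝ} (ht : t ∈ I)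
    (hx : 0 < 1 - k * radiusSq x) :
    reducedLagrangian T k x (a t) (deriv a t) (deriv (deriv a) t) (F t) (deriv F t)
      = Real.sqrt (F t) * a t ^ n * isoLagrangian T (scalarX a F t) (scalarY k a F t)
        / Real.sqrt (1 - k * radiusSq x) :=
  Gravity.reducedLagrangian_eq (h.scale_pos t ht) (h.lapse_pos t ht) hx (h.mem_domain t ht)

/-! #### Partial derivatives of the reduced Lagrangian along the curve -/

/-- `∂Λ/∂F`. -/
noncomputable def partialF (T : GravityTheory n) (k : ℝ) (a F : ℝ → ℝ) (t : ℝ) : ℝ :=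
  Real.sqrt (F t) * a t ^ n * (isoLagrangian T (scalarX a F t) (scalarY k a F t) / (2 * F t)
    + isoLagrangianX T (scalarX a F t) (scalarY k a F t) *
      (- deriv (deriv a) t / (a t * F t ^ 2) + deriv a t * deriv F t / (a t * F t ^ 3))
    + isoLagrangianY T (scalarX a F t) (scalarY k a F t) *
      (- deriv a t ^ 2 / (a t ^ 2 * F t ^ 2)))

/-- `∂Λ/∂Ḟ`. -/
noncomputable def partialFdot (T : GravityTheory n) (k : ℝ) (a F : ℝ → ℝ) (t : ℝ) : ℝ :=
  Real.sqrt (F t) * a t ^ n * (isoLagrangianX T (scalarX a F t) (scalarY k a F t) *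
    (- deriv a t / (2 * a t * F t ^ 2)))

/-- `∂Λ/∂a`. -/
noncomputable def partialA (T : GravityTheory n) (k : ℝ) (a F : ℝ → ℝ) (t : ℝ) : ℝ :=
  Real.sqrt (F t) * a t ^ n * (n * isoLagrangian T (scalarX a F t) (scalarY k a F t) / a t
    - isoLagrangianX T (scalarX a F t) (scalarY k a F t) * scalarX a F t / a t
    - isoLagrangianY T (scalarX a F t) (scalarY k a F t) * (2 * scalarY k a F t / a t))

/-- `∂Λ/∂ȧ`. -/
noncomputable def partialAdot (T : GravityTheory n) (k : ℝ) (a F : ℝ → ℝ) (t : ℝ) : ℝ :=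
  Real.sqrt (F t) * a t ^ n * (isoLagrangianX T (scalarX a F t) (scalarY k a F t) *
      (- deriv F t / (2 * a t * F t ^ 2))
    + isoLagrangianY T (scalarX a F t) (scalarY k a F t) * (2 * deriv a t / (a t ^ 2 * F t)))

/-- `∂Λ/∂ä`. -/
noncomputable def partialAddot (T : GravityTheory n) (k : ℝ) (a F : ℝ → ℝ) (t : ℝ) : ℝ :=
  Real.sqrt (F t) * a t ^ n * (isoLagrangianX T (scalarX a F t) (scalarY k a F t) /
    (a t * F t))

/-- The form `u ^ m / u` avoids the truncated exponent `m - 1` and keeps `u ^ m` as a common factor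
in later identities. -/
theorem hasDerivAt_pow_div {u : ℝ → ℝ} {u' t : ℝ} (hu : HasDerivAt u u' t) (h0 : u t ≠ 0) (m : ℕ) :
    HasDerivAt (fun s => u s ^ m) (m * u t ^ m / u t * u') t := by
  refine (hu.fun_pow m).congr_deriv ?_
  rcases m with _ | m
  · simp
  · field_simp; simp; ring

/-- A partial derivative of the reduced Lagrangian. -/
theorem deriv_reducedLagrangian {u₀ u₁ u₂ v₀ v₁ : ℝ → ℝ} {u₀' u₁' u₂' v₀' v₁' y : ℝ}
    (h0 : HasDerivAt u₀ u₀' y) (h1 : HasDerivAt u₁ u₁' y) (h2 : HasDerivAt u₂ u₂' y)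
    (g0 : HasDerivAt v₀ v₀' y) (g1 : HasDerivAt v₁ v₁' y) (hu : 0 < u₀ y) (hv : 0 < v₀ y)
    (hx : 0 < 1 - k * radiusSq x)
    (hw : stdPair (accel (u₀ y) (u₁ y) (u₂ y) (v₀ y) (v₁ y)) (hubbleSq k (u₀ y) (u₁ y) (v₀ y))
      ∈ T.domain) :
    deriv (fun s => reducedLagrangian T k x (u₀ s) (u₁ s) (u₂ s) (v₀ s) (v₁ s)) y
      = Real.sqrt (v₀ y) * u₀ y ^ n *
      ((v₀' / (2 * v₀ y) + n * u₀' / u₀ y) *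
        isoLagrangian T (accel (u₀ y) (u₁ y) (u₂ y) (v₀ y) (v₁ y)) (hubbleSq k (u₀ y) (u₁ y) (v₀ y))
      + isoLagrangianX T (accel (u₀ y) (u₁ y) (u₂ y) (v₀ y) (v₁ y))
        (hubbleSq k (u₀ y) (u₁ y) (v₀ y)) *
        (u₂' / (u₀ y * v₀ y) - u₂ y * u₀' / (u₀ y ^ 2 * v₀ y) - u₂ y * v₀' / (u₀ y * v₀ y ^ 2)
          - u₁' * v₁ y / (2 * u₀ y * v₀ y ^ 2) - u₁ y * v₁' / (2 * u₀ y * v₀ y ^ 2)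
          + u₁ y * v₁ y * u₀' / (2 * u₀ y ^ 2 * v₀ y ^ 2) + u₁ y * v₁ y * v₀' / (u₀ y * v₀ y ^ 3))
      + isoLagrangianY T (accel (u₀ y) (u₁ y) (u₂ y) (v₀ y) (v₁ y))
        (hubbleSq k (u₀ y) (u₁ y) (v₀ y)) *
        (2 * u₁ y * u₁' / (u₀ y ^ 2 * v₀ y) - u₁ y ^ 2 * v₀' / (u₀ y ^ 2 * v₀ y ^ 2)
          - 2 * (k + u₁ y ^ 2 / v₀ y) * u₀' / u₀ y ^ 3))
        / Real.sqrt (1 - k * radiusSq x) := by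
  have hu' := hu.ne'
  have hv' := hv.ne'
  have dX : HasDerivAt (fun s => accel (u₀ s) (u₁ s) (u₂ s) (v₀ s) (v₁ s)) _ y :=
    (h2.div (h0.mul g0) (mul_ne_zero hu' hv')).sub ((h1.mul g1).div
      ((h0.const_mul 2).mul (g0.fun_pow 2)) (by simp [hu', hv']))
  have dY : HasDerivAt (fun s => hubbleSq k (u₀ s) (u₁ s) (v₀ s)) _ y :=
    (((h1.fun_pow 2).div g0 hv').const_add k).div (h0.fun_pow 2) (by simp [hu'])
  -- The closed formula is available only for positive arguments and admissible curvature scalars;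
  -- both conditions are open, which suffices for a derivative.
  have hev : ∀ᶠ s in nhds y, reducedLagrangian T k x (u₀ s) (u₁ s) (u₂ s) (v₀ s) (v₁ s)
      = Real.sqrt (v₀ s) * u₀ s ^ n * isoLagrangian T (accel (u₀ s) (u₁ s) (u₂ s) (v₀ s) (v₁ s))
        (hubbleSq k (u₀ s) (u₁ s) (v₀ s)) / Real.sqrt (1 - k * radiusSq x) := by
    filter_upwards [h0.continuousAt.eventually (lt_mem_nhds hu),
      g0.continuousAt.eventually (lt_mem_nhds hv),
      (dX.continuousAt.prodMk dY.continuousAt).eventually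
        (isOpen_stdPair_domain.mem_nhds hw)] with s hs1 hs2 hs3
    exact reducedLagrangian_eq hs1 hs2 hx hs3
  have dL := ((((g0.sqrt hv').mul (hasDerivAt_pow_div h0 hu' n)).mul
    (hasDerivAt_isoLagrangian dX dY hw)).div_const (Real.sqrt (1 - k * radiusSq x)))
  rw [(dL.congr_of_eventuallyEq hev).deriv]
  have hs : Real.sqrt (v₀ y) ^ 2 = v₀ y := Real.sq_sqrt hv.le
  have hs0 : Real.sqrt (v₀ y) ≠ 0 := (Real.sqrt_pos.2 hv).ne'
  have hv1 : v₀' / (2 * Real.sqrt (v₀ y)) = Real.sqrt (v₀ y) * (v₀' / (2 * v₀ y)) := by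
    field_simp
    rw [hs]
  simp only [Pi.mul_apply, Pi.div_apply, hv1, Nat.cast_ofNat]
  congr 1
  field_simp
  ring

theorem AdmissibleCurve.deriv_F (h : AdmissibleCurve T k I a F) {t : ℝ} (ht : t ∈ I)
    (hx : 0 < 1 - k * radiusSq x) :
    deriv (fun y => reducedLagrangian T k x (a t) (deriv a t)
    (deriv (deriv a) t) y (deriv F t)) (F t)
      = partialF T k a F t / Real.sqrt (1 - k * radiusSq x) := by
  have ha := (h.scale_pos t ht).ne'
  have hF := (h.lapse_pos t ht).ne'
  rw [deriv_reducedLagrangian (hasDerivAt_const _ _) (hasDerivAt_const _ _) (hasDerivAt_const _ _)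
    (hasDerivAt_id' _) (hasDerivAt_const _ _) (h.scale_pos t ht) (h.lapse_pos t ht) hx
    (h.mem_domain t ht), partialF, scalarX, scalarY]
  congr 1
  field_simp
  ring

theorem AdmissibleCurve.deriv_Fdot (h : AdmissibleCurve T k I a F) {t : ℝ} (ht : t ∈ I)
    (hx : 0 < 1 - k * radiusSq x) :
    deriv (fun y => reducedLagrangian T k x (a t) (deriv a t)
    (deriv (deriv a) t) (F t) y) (deriv F t)
      = partialFdot T k a F t / Real.sqrt (1 - k * radiusSq x) := by
  have ha := (h.scale_pos t ht).ne'
  have hF := (h.lapse_pos t ht).ne'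
  rw [deriv_reducedLagrangian (hasDerivAt_const _ _) (hasDerivAt_const _ _) (hasDerivAt_const _ _)
    (hasDerivAt_const _ _) (hasDerivAt_id' _) (h.scale_pos t ht) (h.lapse_pos t ht) hx
    (h.mem_domain t ht), partialFdot, scalarX, scalarY]
  congr 1
  field_simp
  ring

theorem AdmissibleCurve.deriv_A (h : AdmissibleCurve T k I a F) {t : ℝ} (ht : t ∈ I)
    (hx : 0 < 1 - k * radiusSq x) :
    deriv (fun y => reducedLagrangian T k x y (deriv a t)
    (deriv (deriv a) t) (F t) (deriv F t)) (a t)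
      = partialA T k a F t / Real.sqrt (1 - k * radiusSq x) := by
  have ha := (h.scale_pos t ht).ne'
  have hF := (h.lapse_pos t ht).ne'
  rw [deriv_reducedLagrangian (hasDerivAt_id' _) (hasDerivAt_const _ _) (hasDerivAt_const _ _)
    (hasDerivAt_const _ _) (hasDerivAt_const _ _) (h.scale_pos t ht) (h.lapse_pos t ht) hx
    (h.mem_domain t ht), partialA]
  congr 2
  have eX : scalarX a F t = deriv (deriv a) t / (a t * F t)
    - deriv a t * deriv F t / (2 * a t * F t ^ 2) := rfl
  have eY : scalarY k a F t = (k + deriv a t ^ 2 / F t) / a t ^ 2 := rfl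
  have e1 : accel (a t) (deriv a t) (deriv (deriv a) t) (F t) (deriv F t) = scalarX a F t := rfl
  have e2 : hubbleSq k (a t) (deriv a t) (F t) = scalarY k a F t := rfl
  rw [e1, e2]
  generalize isoLagrangian T (scalarX a F t) (scalarY k a F t) = l
  generalize isoLagrangianX T (scalarX a F t) (scalarY k a F t) = lX
  generalize isoLagrangianY T (scalarX a F t) (scalarY k a F t) = lY
  rw [eX, eY]
  field_simp
  ring

theorem AdmissibleCurve.deriv_Adot (h : AdmissibleCurve T k I a F) {t : ℝ} (ht : t ∈ I)
    (hx : 0 < 1 - k * radiusSq x) :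
    deriv (fun y => reducedLagrangian T k x (a t) y
    (deriv (deriv a) t) (F t) (deriv F t)) (deriv a t)
      = partialAdot T k a F t / Real.sqrt (1 - k * radiusSq x) := by
  have ha := (h.scale_pos t ht).ne'
  have hF := (h.lapse_pos t ht).ne'
  rw [deriv_reducedLagrangian (hasDerivAt_const _ _) (hasDerivAt_id' _) (hasDerivAt_const _ _)
    (hasDerivAt_const _ _) (hasDerivAt_const _ _) (h.scale_pos t ht) (h.lapse_pos t ht) hx
    (h.mem_domain t ht), partialAdot, scalarX, scalarY]
  congr 1
  field_simp
  ring

theorem AdmissibleCurve.deriv_Addot (h : AdmissibleCurve T k I a F) {t : ℝ} (ht : t ∈ I)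
    (hx : 0 < 1 - k * radiusSq x) :
    deriv (fun y => reducedLagrangian T k x (a t) (deriv a t)
    y (F t) (deriv F t)) (deriv (deriv a) t)
      = partialAddot T k a F t / Real.sqrt (1 - k * radiusSq x) := by
  have ha := (h.scale_pos t ht).ne'
  have hF := (h.lapse_pos t ht).ne'
  rw [deriv_reducedLagrangian (hasDerivAt_const _ _) (hasDerivAt_const _ _) (hasDerivAt_id' _)
    (hasDerivAt_const _ _) (hasDerivAt_const _ _) (h.scale_pos t ht) (h.lapse_pos t ht) hx
    (h.mem_domain t ht), partialAddot, scalarX, scalarY]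
  congr 1
  field_simp
  ring

/-- The Euler-Lagrange expression of the lapse. -/
theorem AdmissibleCurve.eulerLagrangeF_eq (h : AdmissibleCurve T k I a F) {t : ℝ} (ht : t ∈ I)
    (hx : 0 < 1 - k * radiusSq x) :
    eulerLagrangeF (reducedLagrangian T k x) a F t
    = (partialF T k a F t - deriv (partialFdot T k a F) t) / Real.sqrt (1 - k * radiusSq x) := by
  have h1 : (fun s => deriv (fun y => reducedLagrangian T k x (a s) (deriv a s)
      (deriv (deriv a) s) (F s) y) (deriv F s))
      =ᶠ[nhds t] fun s => partialFdot T k a F s / Real.sqrt (1 - k * radiusSq x) := by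
    filter_upwards [h.isOpen.mem_nhds ht] with s hs
    exact h.deriv_Fdot hs hx
  rw [eulerLagrangeF, h.deriv_F ht hx, h1.deriv_eq, deriv_div_const, sub_div]

/-- The Euler-Lagrange expression of the scale factor. -/
theorem AdmissibleCurve.eulerLagrangeA_eq (h : AdmissibleCurve T k I a F) {t : ℝ} (ht : t ∈ I)
    (hx : 0 < 1 - k * radiusSq x) :
    eulerLagrangeA (reducedLagrangian T k x) a F t
    = (partialA T k a F t - deriv (partialAdot T k a F) t
      + deriv (deriv (partialAddot T k a F)) t) / Real.sqrt (1 - k * radiusSq x) := by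
  have h1 : (fun s => deriv (fun y => reducedLagrangian T k x (a s) y
      (deriv (deriv a) s) (F s) (deriv F s)) (deriv a s))
      =ᶠ[nhds t] fun s => partialAdot T k a F s / Real.sqrt (1 - k * radiusSq x) := by
    filter_upwards [h.isOpen.mem_nhds ht] with s hs
    exact h.deriv_Adot hs hx
  have h2 : (fun s => deriv (fun y => reducedLagrangian T k x (a s) (deriv a s)
      y (F s) (deriv F s)) (deriv (deriv a) s))
      =ᶠ[nhds t] fun s => partialAddot T k a F s / Real.sqrt (1 - k * radiusSq x) := by
    filter_upwards [h.isOpen.mem_nhds ht] with s hs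
    exact h.deriv_Addot hs hx
  have h3 : deriv (fun s => partialAddot T k a F s / Real.sqrt (1 - k * radiusSq x))
      = fun s => deriv (partialAddot T k a F) s / Real.sqrt (1 - k * radiusSq x) :=
    funext fun s => deriv_div_const _
  rw [eulerLagrangeA, h.deriv_A ht hx, h1.deriv_eq, h2.deriv.deriv_eq, deriv_div_const, h3,
    deriv_div_const, add_div, sub_div]

/-- Smoothness of the functions of time that occur. -/
theorem ScaleLapse.contDiffAt (h : ScaleLapse I a F) {t : ℝ} (ht : t ∈ I) :
    ContDiffAt ℝ ∞ a t ∧ ContDiffAt ℝ ∞ (deriv a) t ∧ ContDiffAt ℝ ∞ (deriv (deriv a)) t ∧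
    ContDiffAt ℝ ∞ F t ∧ ContDiffAt ℝ ∞ (deriv F) t ∧
    ContDiffAt ℝ ∞ (fun t => Real.sqrt (F t)) t ∧ ContDiffAt ℝ ∞ (scalarX a F) t ∧
    ContDiffAt ℝ ∞ (scalarY k a F) t := by
  have hn := h.isOpen.mem_nhds ht
  have ha := h.smooth_scale.contDiffAt hn
  have ha' := (ContDiffOn.deriv_infty h.isOpen h.smooth_scale).contDiffAt hn
  have ha'' := (ContDiffOn.deriv_infty h.isOpen
    (ContDiffOn.deriv_infty h.isOpen h.smooth_scale)).contDiffAt hn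
  have hF := h.smooth_lapse.contDiffAt hn
  have hF' := (ContDiffOn.deriv_infty h.isOpen h.smooth_lapse).contDiffAt hn
  have ha0 := (h.scale_pos t ht).ne'
  have hF0 := (h.lapse_pos t ht).ne'
  refine ⟨ha, ha', ha'', hF, hF', hF.sqrt hF0, ?_, ?_⟩
  · exact (ha''.div (ha.mul hF) (mul_ne_zero ha0 hF0)).sub ((ha'.mul hF').div
      ((contDiffAt_const.mul ha).mul (hF.pow 2)) (by simp [ha0, hF0]))
  · exact (contDiffAt_const.add ((ha'.pow 2).div hF hF0)).div (ha.pow 2) (by simp [ha0])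

theorem AdmissibleCurve.contDiffAt_iso (h : AdmissibleCurve T k I a F) {t : ℝ} (ht : t ∈ I) :
    ContDiffAt ℝ ∞ (fun s => isoLagrangian T (scalarX a F s) (scalarY k a F s)) t ∧
    ContDiffAt ℝ ∞ (fun s => isoLagrangianX T (scalarX a F s) (scalarY k a F s)) t ∧
    ContDiffAt ℝ ∞ (fun s => isoLagrangianY T (scalarX a F s) (scalarY k a F s)) t :=
  have hs := h.contDiffAt (k := k) ht
  contDiffAt_isoLagrangian hs.2.2.2.2.2.2.1 hs.2.2.2.2.2.2.2 (h.mem_domain t ht)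

theorem AdmissibleCurve.contDiffAt_partial (h : AdmissibleCurve T k I a F) {t : ℝ} (ht : t ∈ I) :
    ContDiffAt ℝ ∞ (partialF T k a F) t ∧ ContDiffAt ℝ ∞ (partialFdot T k a F) t ∧
    ContDiffAt ℝ ∞ (partialA T k a F) t ∧ ContDiffAt ℝ ∞ (partialAdot T k a F) t ∧
    ContDiffAt ℝ ∞ (partialAddot T k a F) t := by
  obtain ⟨ha, ha', ha'', hF, hF', hs, hX, hY⟩ := h.contDiffAt (k := k) ht
  obtain ⟨l, lX, lY⟩ := h.contDiffAt_iso ht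
  have ha0 := (h.scale_pos t ht).ne'
  have hF0 := (h.lapse_pos t ht).ne'
  have c : ∀ r : ℝ, ContDiffAt ℝ ∞ (fun _ : ℝ => r) t := fun r => contDiffAt_const
  have hv := hs.mul (ha.pow n)
  refine ⟨?_, ?_, ?_, ?_, ?_⟩
  · exact hv.mul (((l.div ((c 2).mul hF) (by simp [hF0])).add (lX.mul
      ((ha''.neg.div (ha.mul (hF.pow 2)) (by simp [ha0, hF0])).add
        ((ha'.mul hF').div (ha.mul (hF.pow 3)) (by simp [ha0, hF0]))))).add
      (lY.mul ((ha'.pow 2).neg.div ((ha.pow 2).mul (hF.pow 2)) (by simp [ha0, hF0]))))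
  · exact hv.mul (lX.mul (ha'.neg.div (((c 2).mul ha).mul (hF.pow 2)) (by simp [ha0, hF0])))
  · exact hv.mul (((((c n).mul l).div ha ha0).sub ((lX.mul hX).div ha ha0)).sub
      (lY.mul (((c 2).mul hY).div ha ha0)))
  · exact hv.mul ((lX.mul (hF'.neg.div (((c 2).mul ha).mul (hF.pow 2)) (by simp [ha0, hF0]))).add
      (lY.mul (((c 2).mul ha').div ((ha.pow 2).mul hF) (by simp [ha0, hF0]))))
  · exact hv.mul (lX.div (ha.mul hF) (by simp [ha0, hF0]))

end Reduced

/-! ### Reparametrization of time -/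

section Reparametrization

variable {n : ℕ} {k : ℝ} {a F : ℝ → ℝ} {I : Set ℝ} {T : GravityTheory n} {x : Fin n → ℝ}

/-- `a^{n-1} ȧ ∂_X ℓ / √F`. -/
noncomputable def momentumF (T : GravityTheory n) (k : ℝ) (a F : ℝ → ℝ) (t : ℝ) : ℝ :=
  a t ^ n / a t * (deriv a t / Real.sqrt (F t)) *
    isoLagrangianX T (scalarX a F t) (scalarY k a F t)

/-- `a^{n-1} ∂_X ℓ`. -/
noncomputable def momentumX (T : GravityTheory n) (k : ℝ) (a F : ℝ → ℝ) (t : ℝ) : ℝ :=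
  a t ^ n / a t * isoLagrangianX T (scalarX a F t) (scalarY k a F t)

/-- `2 a^{n-2} ȧ ∂_Y ℓ / √F`. -/
noncomputable def momentumY (T : GravityTheory n) (k : ℝ) (a F : ℝ → ℝ) (t : ℝ) : ℝ :=
  2 * a t ^ n / a t ^ 2 * (deriv a t / Real.sqrt (F t)) *
    isoLagrangianY T (scalarX a F t) (scalarY k a F t)

theorem AdmissibleCurve.contDiffAt_momentum (h : AdmissibleCurve T k I a F) {t : ℝ} (ht : t ∈ I) :
    ContDiffAt ℝ ∞ (momentumF T k a F) t ∧ ContDiffAt ℝ ∞ (momentumX T k a F) t ∧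
    ContDiffAt ℝ ∞ (momentumY T k a F) t := by
  obtain ⟨ha, ha', ha'', hF, hF', hs, hX, hY⟩ := h.contDiffAt (k := k) ht
  obtain ⟨l, lX, lY⟩ := h.contDiffAt_iso ht
  have ha0 := (h.scale_pos t ht).ne'
  have hs0 := (Real.sqrt_pos.2 (h.lapse_pos t ht)).ne'
  exact ⟨(((ha.pow n).div ha ha0).mul (ha'.div hs hs0)).mul lX,
    ((ha.pow n).div ha ha0).mul lX,
    (((contDiffAt_const.mul (ha.pow n)).div (ha.pow 2) (by simp [ha0])).mul
      (ha'.div hs hs0)).mul lY⟩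

/-- `dℓ/ds` in the proper time `ds = √F dt`. -/
noncomputable def properDeriv (F f : ℝ → ℝ) (t : ℝ) : ℝ := deriv f t / Real.sqrt (F t)

/-- Up to the factor `1/√F`, only `a`, `da/ds`, `X`, `Y` and a derivative in the proper time `ds =
√F dt` occur; this is the form in which independence of the time coordinate is visible. -/
theorem AdmissibleCurve.eulerLagrangeF_eq_proper (h : AdmissibleCurve T k I a F) {t : ℝ}
    (ht : t ∈ I) (hx : 0 < 1 - k * radiusSq x) :
    eulerLagrangeF (reducedLagrangian T k x) a F t
      = (1 / Real.sqrt (F t)) * (a t ^ n * isoLagrangian T (scalarX a F t) (scalarY k a F t) / 2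
        - a t ^ n * scalarX a F t * isoLagrangianX T (scalarX a F t) (scalarY k a F t)
        - a t ^ n * (deriv a t / Real.sqrt (F t) / a t) ^ 2
          * isoLagrangianY T (scalarX a F t) (scalarY k a F t)
        + properDeriv F (momentumF T k a F) t / 2) / Real.sqrt (1 - k * radiusSq x) := by
  -- Splitting off `1/(2F)` produces, on differentiation, a term in `Ḟ` that cancels the part of
  -- `∂X/∂F` not equal to `-X/F`.
  have h1 : partialFdot T k a F =ᶠ[nhds t] fun s => - (momentumF T k a F s / (2 * F s)) := by
    filter_upwards [h.isOpen.mem_nhds ht] with s hs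
    have ha0 := (h.scale_pos s hs).ne'
    have hF0 := (h.lapse_pos s hs).ne'
    have hs0 := (Real.sqrt_pos.2 (h.lapse_pos s hs)).ne'
    have hs2 := Real.sq_sqrt (h.lapse_pos s hs).le
    simp only [partialFdot, momentumF]
    field_simp
    rw [hs2]
    ring
  have d1 := ((h.contDiffAt_momentum ht).1.differentiableAt (by simp)).hasDerivAt
  have hF0 := (h.lapse_pos t ht).ne'
  have d2 := (d1.div ((h.hasDerivAt_lapse ht).const_mul 2) (by simpa using hF0)).neg
  have h2 : deriv (partialFdot T k a F) t = _ := h1.deriv_eq.trans d2.deriv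
  have ha0 := (h.scale_pos t ht).ne'
  have hs0 := (Real.sqrt_pos.2 (h.lapse_pos t ht)).ne'
  have hs2 := Real.sq_sqrt (h.lapse_pos t ht).le
  rw [h.eulerLagrangeF_eq ht hx, h2]
  congr 1
  have eX : scalarX a F t = deriv (deriv a) t / (a t * F t)
    - deriv a t * deriv F t / (2 * a t * F t ^ 2) := rfl
  simp only [partialF, properDeriv]
  have e1 : momentumF T k a F t = a t ^ n / a t * (deriv a t / Real.sqrt (F t)) *
    isoLagrangianX T (scalarX a F t) (scalarY k a F t) := rfl
  rw [e1]
  generalize isoLagrangian T (scalarX a F t) (scalarY k a F t) = l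
  generalize isoLagrangianX T (scalarX a F t) (scalarY k a F t) = lX
  generalize isoLagrangianY T (scalarX a F t) (scalarY k a F t) = lY
  rw [eX]
  generalize deriv (momentumF T k a F) t = m
  generalize Real.sqrt (F t) = s at *
  rw [← hs2]
  field_simp
  ring

/-- The last two terms of the Euler-Lagrange expression form one total derivative, of `d/dt (∂Λ/∂ä)
- ∂Λ/∂ȧ`. In this combination the derivatives of `F` cancel and a proper-time expression remains. -/
theorem AdmissibleCurve.eulerLagrangeA_eq_proper (h : AdmissibleCurve T k I a F) {t : ℝ}
    (ht : t ∈ I) (hx : 0 < 1 - k * radiusSq x) :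
    eulerLagrangeA (reducedLagrangian T k x) a F t
      = Real.sqrt (F t) * (a t ^ n / a t *
          (n * isoLagrangian T (scalarX a F t) (scalarY k a F t)
          - scalarX a F t * isoLagrangianX T (scalarX a F t) (scalarY k a F t)
          - 2 * scalarY k a F t * isoLagrangianY T (scalarX a F t) (scalarY k a F t))
        + properDeriv F (fun s => properDeriv F (momentumX T k a F) s - momentumY T k a F s) t)
        / Real.sqrt (1 - k * radiusSq x) := by
  have h1 : ∀ s ∈ I, partialAddot T k a F s = momentumX T k a F s / Real.sqrt (F s) := by
    intro s hs
    have ha0 := (h.scale_pos s hs).ne'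
    have hF0 := (h.lapse_pos s hs).ne'
    have hs0 := (Real.sqrt_pos.2 (h.lapse_pos s hs)).ne'
    have hs2 := Real.sq_sqrt (h.lapse_pos s hs).le
    simp only [partialAddot, momentumX]
    field_simp
    rw [hs2]
    ring
  have h2 : ∀ s ∈ I, deriv (partialAddot T k a F) s - partialAdot T k a F s
      = properDeriv F (momentumX T k a F) s - momentumY T k a F s := by
    intro s hs
    have ha0 := (h.scale_pos s hs).ne'
    have hF0 := (h.lapse_pos s hs).ne'
    have hs0 := (Real.sqrt_pos.2 (h.lapse_pos s hs)).ne'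
    have hs2 := Real.sq_sqrt (h.lapse_pos s hs).le
    have hev : partialAddot T k a F =ᶠ[nhds s] fun r => momentumX T k a F r / Real.sqrt (F r) := by
      filter_upwards [h.isOpen.mem_nhds hs] with r hr using h1 r hr
    have d1 := ((h.contDiffAt_momentum hs).2.1.differentiableAt (by simp)).hasDerivAt
    have d2 := d1.div ((h.hasDerivAt_lapse hs).sqrt hF0) hs0
    have h3 : deriv (partialAddot T k a F) s = _ := hev.deriv_eq.trans d2.deriv
    rw [h3]
    have e1 : momentumX T k a F s = a s ^ n / a s *
      isoLagrangianX T (scalarX a F s) (scalarY k a F s) := rfl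
    simp only [partialAdot, properDeriv, momentumY]
    rw [e1]
    generalize deriv (momentumX T k a F) s = m
    generalize isoLagrangianX T (scalarX a F s) (scalarY k a F s) = lX
    generalize isoLagrangianY T (scalarX a F s) (scalarY k a F s) = lY
    generalize Real.sqrt (F s) = r at *
    rw [← hs2]
    field_simp
    ring
  have hsm := h.contDiffAt_partial ht
  -- Differentiability of both terms is needed to merge the two derivatives into the derivative of
  -- the difference, which is known on all of `I`.
  have d3 : DifferentiableAt ℝ (deriv (partialAddot T k a F)) t := by
    have : ContDiffOn ℝ ∞ (partialAddot T k a F) I := fun s hs =>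
      (h.contDiffAt_partial hs).2.2.2.2.contDiffWithinAt
    exact (ContDiffOn.hasDerivAt_infty h.isOpen
      (ContDiffOn.deriv_infty h.isOpen this) ht).differentiableAt
  have d4 : DifferentiableAt ℝ (partialAdot T k a F) t := hsm.2.2.2.1.differentiableAt (by simp)
  have h5 : deriv (deriv (partialAddot T k a F)) t - deriv (partialAdot T k a F) t
      = deriv (fun s => properDeriv F (momentumX T k a F) s - momentumY T k a F s) t := by
    rw [← deriv_fun_sub d3 d4]
    refine Filter.EventuallyEq.deriv_eq ?_
    filter_upwards [h.isOpen.mem_nhds ht] with s hs using h2 s hs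
  have hs0 := (Real.sqrt_pos.2 (h.lapse_pos t ht)).ne'
  have ha0 := (h.scale_pos t ht).ne'
  rw [h.eulerLagrangeA_eq ht hx, sub_add_eq_add_sub, add_sub_assoc, h5]
  congr 1
  simp only [partialA]
  rw [show properDeriv F (fun s => properDeriv F (momentumX T k a F) s - momentumY T k a F s) t
    = deriv (fun s => properDeriv F (momentumX T k a F) s - momentumY T k a F s) t
      / Real.sqrt (F t) from rfl]
  field_simp

/-- `τ` is a proper time along the curve `(a, F)`, and `b` is the scale factor as a function of the
proper time. -/
structure ProperTime (I : Set ℝ) (a F τ b : ℝ → ℝ) : Prop where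
  isOpen_image : IsOpen (τ '' I)
  hasDerivAt : ∀ t ∈ I, HasDerivAt τ (Real.sqrt (F t)) t
  smooth : ContDiffOn ℝ ∞ b (τ '' I)
  eq : ∀ t ∈ I, b (τ t) = a t

section ProperTime

variable {τ b : ℝ → ℝ}

/-- By the chain rule, as `τ` has the non-zero derivative `√F`. Every later transfer between the two
time coordinates goes through this lemma. -/
theorem ProperTime.deriv_comp (hτ : ProperTime I a F τ b) (h : ScaleLapse I a F) {f f' : ℝ → ℝ}
    {t : ℝ} (ht : t ∈ I) (hf : DifferentiableAt ℝ f' (τ t)) (he : ∀ s ∈ I, f' (τ s) = f s) :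
    deriv f' (τ t) = properDeriv F f t := by
  have h1 := hf.hasDerivAt.comp t (hτ.hasDerivAt t ht)
  have h2 : f =ᶠ[nhds t] f' ∘ τ := by
    filter_upwards [h.isOpen.mem_nhds ht] with s hs using (he s hs).symm
  have hs0 := (Real.sqrt_pos.2 (h.lapse_pos t ht)).ne'
  rw [properDeriv, h2.deriv_eq, h1.deriv]
  field_simp

theorem ProperTime.scaleLapse (hτ : ProperTime I a F τ b) (h : ScaleLapse I a F) :
    ScaleLapse (τ '' I) b fun _ => 1 where
  isOpen := hτ.isOpen_image
  smooth_scale := hτ.smooth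
  smooth_lapse := contDiffOn_const
  scale_pos := by rintro _ ⟨t, ht, rfl⟩; rw [hτ.eq t ht]; exact h.scale_pos t ht
  lapse_pos := fun _ _ => one_pos

theorem ProperTime.deriv_scale (hτ : ProperTime I a F τ b) (h : ScaleLapse I a F) {t : ℝ}
    (ht : t ∈ I) : deriv b (τ t) = deriv a t / Real.sqrt (F t) :=
  hτ.deriv_comp h ht ((hτ.scaleLapse h).hasDerivAt_scale ⟨t, ht, rfl⟩).differentiableAt hτ.eq

theorem ProperTime.deriv_deriv_scale (hτ : ProperTime I a F τ b) (h : ScaleLapse I a F) {t : ℝ}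
    (ht : t ∈ I) : deriv (deriv b) (τ t)
      = deriv (deriv a) t / F t - deriv a t * deriv F t / (2 * F t ^ 2) := by
  have hF0 := (h.lapse_pos t ht).ne'
  have hs0 := (Real.sqrt_pos.2 (h.lapse_pos t ht)).ne'
  have hs2 := Real.sq_sqrt (h.lapse_pos t ht).le
  rw [hτ.deriv_comp h (f := fun t => deriv a t / Real.sqrt (F t)) ht
    ((hτ.scaleLapse h).hasDerivAt_deriv_scale ⟨t, ht, rfl⟩).differentiableAt
    (fun s hs => hτ.deriv_scale h hs)]
  have d := (h.hasDerivAt_deriv_scale ht).div ((h.hasDerivAt_lapse ht).sqrt hF0) hs0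
  have d' : deriv (fun t => deriv a t / Real.sqrt (F t)) t = _ := d.deriv
  rw [properDeriv, d']
  generalize Real.sqrt (F t) = s at *
  rw [← hs2]
  field_simp

/-- In both time coordinates this is `(d²a/ds²)/a`: the term with `Ḟ` in the first scalar is the one
produced by the second derivative in proper time. -/
theorem ProperTime.scalarX_eq (hτ : ProperTime I a F τ b) (h : ScaleLapse I a F) {t : ℝ}
    (ht : t ∈ I) : scalarX b (fun _ => 1) (τ t) = scalarX a F t := by
  have ha0 := (h.scale_pos t ht).ne'
  have hF0 := (h.lapse_pos t ht).ne'
  simp only [scalarX, accel, hτ.eq t ht, hτ.deriv_deriv_scale h ht, deriv_const]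
  field_simp
  ring

theorem ProperTime.scalarY_eq (hτ : ProperTime I a F τ b) (h : ScaleLapse I a F) {t : ℝ}
    (ht : t ∈ I) : scalarY k b (fun _ => 1) (τ t) = scalarY k a F t := by
  have hs2 := Real.sq_sqrt (h.lapse_pos t ht).le
  simp only [scalarY, hubbleSq, hτ.eq t ht, hτ.deriv_scale h ht, div_pow, hs2, div_one]

theorem ProperTime.admissibleCurve (hτ : ProperTime I a F τ b) (h : AdmissibleCurve T k I a F) :
    AdmissibleCurve T k (τ '' I) b fun _ => 1 where
  toScaleLapse := hτ.scaleLapse h.toScaleLapse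
  mem_domain := by
    rintro _ ⟨t, ht, rfl⟩
    rw [hτ.scalarX_eq h.toScaleLapse ht, hτ.scalarY_eq h.toScaleLapse ht]
    exact h.mem_domain t ht

theorem ProperTime.eulerLagrangeF_iff (hτ : ProperTime I a F τ b) (h : AdmissibleCurve T k I a F)
    {t : ℝ} (ht : t ∈ I) (hx : 0 < 1 - k * radiusSq x) :
    eulerLagrangeF (reducedLagrangian T k x) a F t = 0 ↔
      eulerLagrangeF (reducedLagrangian T k x) b (fun _ => 1) (τ t) = 0 := by
  have h' := hτ.admissibleCurve h
  have hm : τ t ∈ τ '' I := ⟨t, ht, rfl⟩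
  have e1 : properDeriv (fun _ => 1) (momentumF T k b fun _ => 1) (τ t)
      = properDeriv F (momentumF T k a F) t := by
    rw [← hτ.deriv_comp h.toScaleLapse ht
      ((h'.contDiffAt_momentum hm).1.differentiableAt (by simp)) fun s hs => ?_]
    · simp [properDeriv]
    · simp only [momentumF, hτ.eq s hs, hτ.scalarX_eq h.toScaleLapse hs,
        hτ.scalarY_eq h.toScaleLapse hs, hτ.deriv_scale h.toScaleLapse hs, Real.sqrt_one, div_one]
  rw [h.eulerLagrangeF_eq_proper ht hx, h'.eulerLagrangeF_eq_proper hm hx, e1,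
    hτ.scalarX_eq h.toScaleLapse ht, hτ.scalarY_eq h.toScaleLapse ht,
    hτ.deriv_scale h.toScaleLapse ht, hτ.eq t ht]
  have hs0 := (Real.sqrt_pos.2 (h.lapse_pos t ht)).ne'
  simp [hs0]

theorem ProperTime.eulerLagrangeA_iff (hτ : ProperTime I a F τ b) (h : AdmissibleCurve T k I a F)
    {t : ℝ} (ht : t ∈ I) (hx : 0 < 1 - k * radiusSq x) :
    eulerLagrangeA (reducedLagrangian T k x) a F t = 0 ↔
      eulerLagrangeA (reducedLagrangian T k x) b (fun _ => 1) (τ t) = 0 := by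
  have h' := hτ.admissibleCurve h
  have hm : τ t ∈ τ '' I := ⟨t, ht, rfl⟩
  have hX : ∀ s ∈ I, properDeriv (fun _ => 1) (momentumX T k b fun _ => 1) (τ s)
      = properDeriv F (momentumX T k a F) s := by
    intro s hs
    rw [← hτ.deriv_comp h.toScaleLapse hs
      ((h'.contDiffAt_momentum ⟨s, hs, rfl⟩).2.1.differentiableAt (by simp)) fun r hr => ?_]
    · simp [properDeriv]
    · simp only [momentumX, hτ.eq r hr, hτ.scalarX_eq h.toScaleLapse hr,
        hτ.scalarY_eq h.toScaleLapse hr]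
  have hY : ∀ s ∈ I, momentumY T k b (fun _ => 1) (τ s) = momentumY T k a F s := by
    intro s hs
    simp only [momentumY, hτ.eq s hs, hτ.scalarX_eq h.toScaleLapse hs,
      hτ.scalarY_eq h.toScaleLapse hs, hτ.deriv_scale h.toScaleLapse hs, Real.sqrt_one, div_one]
  have hd : DifferentiableAt ℝ (fun s => properDeriv (fun _ => 1) (momentumX T k b fun _ => 1) s
      - momentumY T k b (fun _ => 1) s) (τ t) := by
    have hc : ContDiffOn ℝ ∞ (momentumX T k b fun _ => 1) (τ '' I) := fun s hs =>
      (h'.contDiffAt_momentum hs).2.1.contDiffWithinAt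
    have hc' := (ContDiffOn.hasDerivAt_infty h'.isOpen
      (ContDiffOn.deriv_infty h'.isOpen hc) hm).differentiableAt
    simp only [properDeriv, Real.sqrt_one, div_one]
    exact hc'.sub ((h'.contDiffAt_momentum hm).2.2.differentiableAt (by simp))
  have e1 : properDeriv (fun _ => 1) (fun s => properDeriv (fun _ => 1)
      (momentumX T k b fun _ => 1) s - momentumY T k b (fun _ => 1) s) (τ t)
      = properDeriv F (fun s => properDeriv F (momentumX T k a F) s - momentumY T k a F s) t := by
    rw [← hτ.deriv_comp h.toScaleLapse ht hd fun s hs => ?_]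
    · simp [properDeriv]
    · simp only [hX s hs, hY s hs]
  rw [h.eulerLagrangeA_eq_proper ht hx, h'.eulerLagrangeA_eq_proper hm hx, e1,
    hτ.scalarX_eq h.toScaleLapse ht, hτ.scalarY_eq h.toScaleLapse ht, hτ.eq t ht]
  have hs0 := (Real.sqrt_pos.2 (h.lapse_pos t ht)).ne'
  simp [hs0]

end ProperTime

/-- Existence of the proper time. -/
theorem ScaleLapse.exists_properTime (h : ScaleLapse I a F) (hI : I.OrdConnected) :
    ∃ τ b : ℝ → ℝ, ContDiffOn ℝ ∞ τ I ∧ StrictMonoOn τ I ∧ ProperTime I a F τ b := by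
  -- The integral that defines proper time needs a base point in `I`; for empty `I` any functions
  -- will do.
  rcases I.eq_empty_or_nonempty with rfl | ⟨t₀, ht₀⟩
  · exact ⟨id, a, contDiff_id.contDiffOn, strictMono_id.strictMonoOn _, by simp, by simp, by simp,
      by simp⟩
  -- The value `k := 0` is a dummy: smoothness of `√F` is one part of a conjunction whose last part
  -- mentions `k`.
  have hsm : ContDiffOn ℝ ∞ (fun t => Real.sqrt (F t)) I := fun t ht =>
    (h.contDiffAt (k := 0) ht).2.2.2.2.2.1.contDiffWithinAt
  have hcont := hsm.continuousOn
  set τ : ℝ → ℝ := fun t => ∫ s in t₀..t, Real.sqrt (F s) with hτ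
  have hderiv : ∀ t ∈ I, HasDerivAt τ (Real.sqrt (F t)) t := by
    intro t ht
    refine intervalIntegral.integral_hasDerivAt_right ?_ ?_ ?_
    · exact (hcont.mono (hI.uIcc_subset ht₀ ht)).intervalIntegrable
    · exact hcont.stronglyMeasurableAtFilter h.isOpen t ht
    · exact hcont.continuousAt (h.isOpen.mem_nhds ht)
  have hpos : ∀ t ∈ I, 0 < Real.sqrt (F t) := fun t ht => Real.sqrt_pos.2 (h.lapse_pos t ht)
  have hτsm : ContDiffOn ℝ ∞ τ I := by
    rw [contDiffOn_infty_iff_deriv_of_isOpen h.isOpen]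
    exact ⟨fun t ht => (hderiv t ht).differentiableAt.differentiableWithinAt,
      hsm.congr fun t ht => (hderiv t ht).deriv⟩
  have hmono : StrictMonoOn τ I := by
    refine strictMonoOn_of_deriv_pos hI.convex hτsm.continuousOn fun t ht => ?_
    have ht' := interior_subset ht
    rw [(hderiv t ht').deriv]
    exact hpos t ht'
  -- A strict derivative that does not vanish makes `τ` locally open. This gives the openness of the
  -- image and the continuity of the inverse.
  have hstrict : ∀ t ∈ I, HasStrictDerivAt τ (Real.sqrt (F t)) t := fun t ht =>
    (hτsm.contDiffAt (h.isOpen.mem_nhds ht)).hasStrictDerivAt' (hderiv t ht) (by simp)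
  have hmap : ∀ t ∈ I, ∀ U ∈ nhds t, τ '' U ∈ nhds (τ t) := by
    intro t ht U hU
    rw [← (hstrict t ht).map_nhds_eq (hpos t ht).ne']
    exact Filter.image_mem_map hU
  have hopen : IsOpen (τ '' I) := by
    rw [isOpen_iff_mem_nhds]
    rintro _ ⟨t, ht, rfl⟩
    exact hmap t ht I (h.isOpen.mem_nhds ht)
  set σ := Function.invFunOn τ I with hσ
  have hσl : ∀ t ∈ I, σ (τ t) = t := fun t ht => hmono.injOn.leftInvOn_invFunOn ht
  have hσm : ∀ y ∈ τ '' I, σ y ∈ I := by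
    rintro _ ⟨t, ht, rfl⟩; rw [hσl t ht]; exact ht
  have hσr : ∀ y ∈ τ '' I, τ (σ y) = y := by
    rintro _ ⟨t, ht, rfl⟩; rw [hσl t ht]
  have hσc : ContinuousOn σ (τ '' I) := by
    rintro _ ⟨t, ht, rfl⟩
    refine ContinuousAt.continuousWithinAt ?_
    rw [ContinuousAt, hσl t ht]
    intro U hU
    rw [Filter.mem_map]
    refine Filter.mem_of_superset (hmap t ht (U ∩ I)
      (Filter.inter_mem hU (h.isOpen.mem_nhds ht))) ?_
    rintro _ ⟨s, hs, rfl⟩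
    rw [Set.mem_preimage, hσl s hs.2]
    exact hs.1
  -- Packaging `τ` and its inverse as a partial homeomorphism gives access to the smoothness of the
  -- inverse at points of non-zero derivative.
  let e : OpenPartialHomeomorph ℝ ℝ :=
    { toFun := τ
      invFun := σ
      source := I
      target := τ '' I
      map_source' := fun t ht => ⟨t, ht, rfl⟩
      map_target' := hσm
      left_inv' := hσl
      right_inv' := hσr
      open_source := h.isOpen
      open_target := hopen
      continuousOn_toFun := hτsm.continuousOn
      continuousOn_invFun := hσc }
  have hσsm : ContDiffOn ℝ ∞ σ (τ '' I) := by
    intro y hy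
    exact (e.contDiffAt_symm_deriv (hpos _ (hσm y hy)).ne' hy (hderiv _ (hσm y hy))
      (hτsm.contDiffAt (h.isOpen.mem_nhds (hσm y hy)))).contDiffWithinAt
  exact ⟨τ, a ∘ σ, hτsm, hmono, hopen, hderiv, h.smooth_scale.comp hσsm hσm, fun t ht => by
    simp [hσl t ht]⟩

end Reparametrization

/-! ### Linearization of the Lagrangian density -/

section Linearization

variable {n : ℕ}

/-- The first variation of the inverse metric under a variation of the 2-jet of the metric. -/
noncomputable def linInverse (j η : Jet n) : Tensor2 n := fun a b =>
  - ∑ c, ∑ d, (Matrix.of j.1)⁻¹ a c * (Matrix.of j.1)⁻¹ d b * η.1 c d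

/-- The first variation of the Riemann tensor under a variation of the 2-jet of the metric. -/
noncomputable def linRiemann (j η : Jet n) : Tensor4 n := fun a b c d =>
  (1 / 2) * (η.2.2 b c a d - η.2.2 b d a c - η.2.2 a c b d + η.2.2 a d b c)
    + (1 / 4) * ∑ e, ∑ f, (linInverse j η e f *
      (lowerChristoffel j a d e * lowerChristoffel j b c f
        - lowerChristoffel j b d e * lowerChristoffel j a c f)
      + (Matrix.of j.1)⁻¹ e f *
      (lowerChristoffel η a d e * lowerChristoffel j b c f
        + lowerChristoffel j a d e * lowerChristoffel η b c f
        - lowerChristoffel η b d e * lowerChristoffel j a c f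
        - lowerChristoffel j b d e * lowerChristoffel η a c f))

variable {j η : Jet n}

theorem hasDerivAt_inverseJet (hdet : (Matrix.of j.1).det ≠ 0) (a b : Fin (n + 1)) :
    HasDerivAt (fun ε : ℝ => (Matrix.of (j + ε • η).1)⁻¹ a b) (linInverse j η a b) 0 := by
  have h0 : Matrix.of (j + (0 : ℝ) • η).1 = Matrix.of j.1 := by simp
  have hd : ∀ c d, HasDerivAt (fun ε : ℝ => Matrix.of (j + ε • η).1 c d) (η.1 c d) 0 := by
    intro c d
    simpa using ((hasDerivAt_id (0 : ℝ)).mul_const (η.1 c d)).const_add (j.1 c d)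
  have hc : ∀ c d, ContDiffAt ℝ 1 (fun ε : ℝ => Matrix.of (j + ε • η).1 c d) 0 := by
    intro c d
    have : (fun ε : ℝ => Matrix.of (j + ε • η).1 c d) = fun ε => j.1 c d + ε * η.1 c d := rfl
    rw [this]; fun_prop
  have h := (hasFDerivAt_inv_apply_of_contDiffAt (M := fun ε : ℝ => Matrix.of (j + ε • η).1) hc
    (fun c d => (hd c d).hasFDerivAt) (by rw [h0]; exact hdet) a b).hasDerivAt
  refine h.congr_deriv ?_
  simp [linInverse]

theorem hasDerivAt_riemannJet (hdet : (Matrix.of j.1).det ≠ 0) (a b c d : Fin (n + 1)) :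
    HasDerivAt (fun ε : ℝ => riemannJet (j + ε • η) a b c d) (linRiemann j η a b c d) 0 := by
  have hS : ∀ a b d, HasDerivAt (fun ε : ℝ => lowerChristoffel (j + ε • η) a b d)
      (lowerChristoffel η a b d) 0 := by
    intro a b d
    have : (fun ε : ℝ => lowerChristoffel (j + ε • η) a b d)
        = fun ε => lowerChristoffel j a b d + ε * lowerChristoffel η a b d := by
      funext ε; simp [lowerChristoffel]; ring
    rw [this]
    simpa using ((hasDerivAt_id (0 : ℝ)).mul_const (lowerChristoffel η a b d)).const_add
      (lowerChristoffel j a b d)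
  have h2 : ∀ a b c d, HasDerivAt (fun ε : ℝ => (j + ε • η).2.2 a b c d) (η.2.2 a b c d) 0 := by
    intro a b c d
    simpa using ((hasDerivAt_id (0 : ℝ)).mul_const (η.2.2 a b c d)).const_add (j.2.2 a b c d)
  refine HasDerivAt.congr_deriv (((((h2 b c a d).sub (h2 b d a c)).sub (h2 a c b d)).add
    (h2 a d b c)).const_mul (1 / 2) |>.add ((HasDerivAt.fun_sum fun e _ =>
      HasDerivAt.fun_sum fun f _ => (hasDerivAt_inverseJet hdet e f).mul
        (((hS a d e).mul (hS b c f)).sub ((hS b d e).mul (hS a c f)))).const_mul (1 / 4))) ?_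
  simp only [linRiemann, Pi.mul_apply, Pi.sub_apply, zero_smul, add_zero]
  congr 2
  refine Finset.sum_congr rfl fun e _ => Finset.sum_congr rfl fun f _ => ?_
  ring

/-- The determinant of `1 + ε M` is a polynomial in `ε` whose linear coefficient is the trace. -/
theorem hasDerivAt_det_add_smul {ι : Type*} [Fintype ι] [DecidableEq ι] (M : Matrix ι ι ℝ) :
    HasDerivAt (fun ε : ℝ => (1 + ε • M).det) M.trace 0 := by
  have h : (fun ε : ℝ => (1 + ε • M).det) = fun ε => 1 + M.trace * ε
      + (Matrix.det (1 + (Polynomial.X : Polynomial ℝ) • M.map Polynomial.C)).divX.divX.eval ε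
        * ε ^ 2 := funext fun ε => Matrix.det_one_add_smul ε M
  rw [h]
  have := (((hasDerivAt_id (0 : ℝ)).const_mul M.trace).const_add 1).add
    (((Polynomial.hasDerivAt (Matrix.det (1 + (Polynomial.X : Polynomial ℝ) •
      M.map Polynomial.C)).divX.divX 0)).mul ((hasDerivAt_id (0 : ℝ)).fun_pow 2))
  refine this.congr_deriv ?_
  simp

/-- Jacobi's formula. Factoring out the determinant of the background leaves `det (1 + ε M)`,
positive for small `ε`, so the absolute value is harmless whatever the sign of the background
determinant. -/
theorem hasDerivAt_volumeJet (hdet : (Matrix.of j.1).det ≠ 0) :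
    HasDerivAt (fun ε : ℝ => Real.sqrt |(Matrix.of (j + ε • η).1).det|)
      (Real.sqrt |(Matrix.of j.1).det| * ((1 / 2) * ∑ a, ∑ b, (Matrix.of j.1)⁻¹ a b * η.1 b a))
      0 := by
  set G := Matrix.of j.1 with hG
  set M := G⁻¹ * Matrix.of η.1 with hM
  have h1 : ∀ ε : ℝ, (Matrix.of (j + ε • η).1).det = G.det * (1 + ε • M).det := by
    intro ε
    rw [← Matrix.det_mul, mul_add, mul_one, Matrix.mul_smul, hM, ← mul_assoc,
      Matrix.mul_nonsing_inv _ (isUnit_iff_ne_zero.2 hdet), one_mul]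
    rfl
  have h2 := hasDerivAt_det_add_smul M
  have h3 : ∀ᶠ ε : ℝ in nhds 0, Real.sqrt |(Matrix.of (j + ε • η).1).det|
      = Real.sqrt |G.det| * Real.sqrt ((1 + ε • M).det) := by
    have : ∀ᶠ ε : ℝ in nhds 0, 0 < (1 + ε • M).det :=
      h2.continuousAt.eventually (lt_mem_nhds (by simp))
    filter_upwards [this] with ε hε
    rw [h1, abs_mul, Real.sqrt_mul (abs_nonneg _), abs_of_pos hε]
  refine HasDerivAt.congr_of_eventuallyEq ?_ h3
  refine ((h2.sqrt (by simp)).const_mul (Real.sqrt |G.det|)).congr_deriv ?_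
  have h4 : M.trace = ∑ a, ∑ b, G⁻¹ a b * η.1 b a := by
    simp [hM, Matrix.trace, Matrix.mul_apply]
  rw [h4]
  simp only [zero_smul, add_zero, Matrix.det_one, Real.sqrt_one]
  ring

/-- The first variation of the Lagrangian density. -/
theorem hasDerivAt_densityJet {T : GravityTheory n} (hj : j ∈ jetDomain T) :
    HasDerivAt (fun ε : ℝ => densityJet T (j + ε • η))
      (Real.sqrt |(Matrix.of j.1).det| *
        ((1 / 2) * (∑ a, ∑ b, (Matrix.of j.1)⁻¹ a b * η.1 b a) * T.lagrangian (curvatureJet j)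
        + fderiv ℝ T.lagrangian (curvatureJet j) (linInverse j η, linRiemann j η))) 0 := by
  have h1 : HasDerivAt (fun ε : ℝ => curvatureJet (j + ε • η)) (linInverse j η, linRiemann j η) 0 :=
    HasDerivAt.prodMk
      (hasDerivAt_pi.2 fun a => hasDerivAt_pi.2 fun b => hasDerivAt_inverseJet hj.1 a b)
      (hasDerivAt_pi.2 fun a => hasDerivAt_pi.2 fun b => hasDerivAt_pi.2 fun c =>
        hasDerivAt_pi.2 fun d => hasDerivAt_riemannJet hj.1 a b c d)
  have h0 : j + (0 : ℝ) • η = j := by simp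
  have hL : HasFDerivAt T.lagrangian (fderiv ℝ T.lagrangian (curvatureJet j))
      (curvatureJet (j + (0 : ℝ) • η)) := by
    rw [h0]; exact (T.differentiableAt hj.2).hasFDerivAt
  refine ((hasDerivAt_volumeJet hj.1).mul (hL.comp_hasDerivAt 0 h1)).congr_deriv ?_
  simp only [h0, Function.comp_apply]
  ring

theorem linRiemann_antisymm_left (a b c d : Fin (n + 1)) :
    linRiemann j η a b c d = - linRiemann j η b a c d := by
  simp only [linRiemann]
  rw [neg_add, ← mul_neg, ← mul_neg, ← Finset.sum_neg_distrib]
  congr 1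
  · ring
  · congr 1
    refine Finset.sum_congr rfl fun e _ => ?_
    rw [← Finset.sum_neg_distrib]
    refine Finset.sum_congr rfl fun f _ => ?_
    ring

/-- The Christoffel symbols as a function of the 1-jet of the metric. -/
noncomputable def christoffelJet (j : Jet n) (a b c : Fin (n + 1)) : ℝ :=
  (1 / 2) * ∑ d, (Matrix.of j.1)⁻¹ c d * lowerChristoffel j a b d

theorem sum_comm_four {ι : Type*} [Fintype ι] (X : ι → ι → ι → ι → ℝ) :
    ∑ a, ∑ b, ∑ c, ∑ d, X c d a b = ∑ a, ∑ b, ∑ c, ∑ d, X a b c d := by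
  calc _ = ∑ a, ∑ c, ∑ b, ∑ d, X c d a b := Finset.sum_congr rfl fun _ _ => Finset.sum_comm
    _ = ∑ c, ∑ a, ∑ b, ∑ d, X c d a b := Finset.sum_comm
    _ = ∑ c, ∑ a, ∑ d, ∑ b, X c d a b :=
      Finset.sum_congr rfl fun _ _ => Finset.sum_congr rfl fun _ _ => Finset.sum_comm
    _ = _ := Finset.sum_congr rfl fun _ _ => Finset.sum_comm

/-- The linearized Riemann tensor in terms of the Christoffel symbols. -/
theorem linRiemann_eq (hs : ∀ e f, (Matrix.of j.1)⁻¹ e f = (Matrix.of j.1)⁻¹ f e)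
    (a b c d : Fin (n + 1)) : linRiemann j η a b c d =
      (1 / 2) * (η.2.2 b c a d - η.2.2 b d a c - η.2.2 a c b d + η.2.2 a d b c)
      - ((∑ e, ∑ f, η.1 e f * (christoffelJet j a d e * christoffelJet j b c f))
        - ∑ e, ∑ f, η.1 e f * (christoffelJet j b d e * christoffelJet j a c f))
      + (1 / 2) * ((∑ e, lowerChristoffel η a d e * christoffelJet j b c e)
        + (∑ e, lowerChristoffel η b c e * christoffelJet j a d e)
        - (∑ e, lowerChristoffel η b d e * christoffelJet j a c e)
        - ∑ e, lowerChristoffel η a c e * christoffelJet j b d e) := by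
  -- The factor `-4` combines the sign of the variation of the inverse metric with the two factors
  -- `½` in the Christoffel symbols.
  have h1 : ∀ a b c d, ∑ e, ∑ f, linInverse j η e f *
      (lowerChristoffel j a d e * lowerChristoffel j b c f)
      = - 4 * ∑ e, ∑ f, η.1 e f * (christoffelJet j a d e * christoffelJet j b c f) := by
    intro a b c d
    have h : ∀ e f, η.1 e f * (christoffelJet j a d e * christoffelJet j b c f)
        = ∑ c', ∑ d', (1 / 4) * ((Matrix.of j.1)⁻¹ c' e * (Matrix.of j.1)⁻¹ f d' * η.1 e f *
          (lowerChristoffel j a d c' * lowerChristoffel j b c d')) := by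
      intro e f
      simp only [christoffelJet]
      rw [mul_mul_mul_comm, Finset.sum_mul_sum, Finset.mul_sum, Finset.mul_sum]
      refine Finset.sum_congr rfl fun c' _ => ?_
      rw [Finset.mul_sum, Finset.mul_sum]
      refine Finset.sum_congr rfl fun d' _ => ?_
      rw [hs e c']; ring
    simp_rw [h, ← Finset.mul_sum]
    rw [sum_comm_four]
    simp only [linInverse, neg_mul, Finset.sum_neg_distrib, Finset.sum_mul]
    ring
  have h2 : ∀ (u : Fin (n + 1) → ℝ) (b c : Fin (n + 1)), ∑ e, ∑ f, (Matrix.of j.1)⁻¹ e f *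
      (u e * lowerChristoffel j b c f) = 2 * ∑ e, u e * christoffelJet j b c e := by
    intro u b c
    simp only [christoffelJet, Finset.mul_sum]
    refine Finset.sum_congr rfl fun e _ => Finset.sum_congr rfl fun f _ => ?_
    ring
  have h3 : ∀ (u : Fin (n + 1) → ℝ) (b c : Fin (n + 1)), ∑ e, ∑ f, (Matrix.of j.1)⁻¹ e f *
      (lowerChristoffel j b c e * u f) = 2 * ∑ e, u e * christoffelJet j b c e := by
    intro u b c
    rw [← h2, Finset.sum_comm]
    refine Finset.sum_congr rfl fun e _ => Finset.sum_congr rfl fun f _ => ?_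
    rw [hs]; ring
  simp only [linRiemann, mul_add, mul_sub, Finset.sum_add_distrib, Finset.sum_sub_distrib, h1, h2,
    h3]
  ring

/-- Exchanging the last two indices also exchanges the two factors of the quadratic terms; this is
why symmetry of the inverse metric and of the variation is required here, but not for the first
pair. -/
theorem linRiemann_antisymm_right (hs : ∀ e f, (Matrix.of j.1)⁻¹ e f = (Matrix.of j.1)⁻¹ f e)
    (hη : ∀ e f, η.1 e f = η.1 f e) (a b c d : Fin (n + 1)) :
    linRiemann j η a b c d = - linRiemann j η a b d c := by
  have h : ∀ u v : Fin (n + 1) → ℝ, ∑ e, ∑ f, η.1 e f * (u e * v f)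
      = ∑ e, ∑ f, η.1 e f * (v e * u f) := by
    intro u v
    rw [Finset.sum_comm]
    refine Finset.sum_congr rfl fun c _ => Finset.sum_congr rfl fun d _ => ?_
    rw [hη]; ring
  rw [linRiemann_eq hs, linRiemann_eq hs, h (christoffelJet j a d), h (christoffelJet j b d)]
  ring

end Linearization

/-! ### The derivative of the Lagrangian at the FLRW data -/

section SpatialTrace

variable {n : ℕ} {k : ℝ} {x : Fin n → ℝ}

/-- The trace of a spatial tensor with respect to the spatial metric. -/
noncomputable def spatialTrace (k : ℝ) (x : Fin n → ℝ) (M : Fin n → Fin n → ℝ) : ℝ :=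
  ∑ i, ∑ j, spatialInverse k x i j * M i j

theorem spatialTrace_add (M M' : Fin n → Fin n → ℝ) :
    spatialTrace k x (fun i j => M i j + M' i j) = spatialTrace k x M + spatialTrace k x M' := by
  simp [spatialTrace, mul_add, Finset.sum_add_distrib]

theorem spatialTrace_sub (M M' : Fin n → Fin n → ℝ) :
    spatialTrace k x (fun i j => M i j - M' i j) = spatialTrace k x M - spatialTrace k x M' := by
  simp [spatialTrace, mul_sub, Finset.sum_sub_distrib]

theorem spatialTrace_const_mul (c : ℝ) (M : Fin n → Fin n → ℝ) :
    spatialTrace k x (fun i j => c * M i j) = c * spatialTrace k x M := by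
  simp only [spatialTrace, Finset.mul_sum]
  exact Finset.sum_congr rfl fun _ _ => Finset.sum_congr rfl fun _ _ => by ring

theorem spatialTrace_swap (M : Fin n → Fin n → ℝ) :
    spatialTrace k x (fun i j => M j i) = spatialTrace k x M := by
  simp only [spatialTrace]
  rw [Finset.sum_comm]
  exact Finset.sum_congr rfl fun i _ => Finset.sum_congr rfl fun j _ => by
    rw [spatialInverse_symm]

theorem spatialTrace_sum {ι : Type*} (s : Finset ι) (M : ι → Fin n → Fin n → ℝ) :
    spatialTrace k x (fun i j => ∑ l ∈ s, M l i j) = ∑ l ∈ s, spatialTrace k x (M l) := by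
  simp only [spatialTrace, Finset.mul_sum]
  symm
  rw [Finset.sum_comm]
  exact Finset.sum_congr rfl fun _ _ => Finset.sum_comm

theorem spatialTrace_comm (M : Fin n → Fin n → Fin n → Fin n → ℝ) :
    spatialTrace k x (fun i j => spatialTrace k x fun l m => M i j l m)
      = spatialTrace k x (fun l m => spatialTrace k x fun i j => M i j l m) := by
  simp only [spatialTrace, Finset.mul_sum]
  rw [sum_comm_four]
  exact Finset.sum_congr rfl fun _ _ => Finset.sum_congr rfl fun _ _ =>
    Finset.sum_congr rfl fun _ _ => Finset.sum_congr rfl fun _ _ => by ring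

/-- Turns a trace over orthonormal frame components into a contraction with the metric or its
inverse. -/
theorem sum_sum_frame {B Γ : Fin n → Fin n → ℝ} (hB : ∀ c d, ∑ i, B i c * B i d = Γ c d)
    (M : Fin n → Fin n → ℝ) :
    ∑ i, ∑ c, ∑ d, B i c * B i d * M c d = ∑ c, ∑ d, Γ c d * M c d := by
  rw [Finset.sum_comm]
  refine Finset.sum_congr rfl fun c _ => ?_
  rw [Finset.sum_comm]
  refine Finset.sum_congr rfl fun d _ => ?_
  rw [← hB, Finset.sum_mul]

variable {T : GravityTheory n}

theorem changeFrame_antisymm {A : Matrix.GeneralLinearGroup (Fin (n + 1)) ℝ}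
    {v : Tensor2 n × Tensor4 n} (h₁ : ∀ a b c e, v.2 a b c e = - v.2 b a c e)
    (h₂ : ∀ a b c e, v.2 a b c e = - v.2 a b e c) :
    (∀ a b c e, (changeFrame A v).2 a b c e = - (changeFrame A v).2 b a c e) ∧
    ∀ a b c e, (changeFrame A v).2 a b c e = - (changeFrame A v).2 a b e c := by
  constructor <;> intro a b c e <;> simp only [changeFrame, ← Finset.sum_neg_distrib]
  · rw [Finset.sum_comm]
    refine Finset.sum_congr rfl fun _ _ => Finset.sum_congr rfl fun _ _ =>
      Finset.sum_congr rfl fun _ _ => Finset.sum_congr rfl fun _ _ => ?_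
    rw [h₁]; ring
  · refine Finset.sum_congr rfl fun _ _ => Finset.sum_congr rfl fun _ _ => ?_
    rw [Finset.sum_comm]
    refine Finset.sum_congr rfl fun _ _ => Finset.sum_congr rfl fun _ _ => ?_
    rw [h₂]; ring

/-- The derivative of the Lagrangian at the FLRW data. -/
theorem fderiv_flrwPair (hn : 2 ≤ n) {b F X Y : ℝ} (hb : 0 < b) (hF : 0 < F)
    (hx : 0 < 1 - k * radiusSq x) (hw : stdPair X Y ∈ T.domain) {u : Tensor2 n} {ρ : Tensor4 n}
    (hρ₁ : ∀ a b c e, ρ a b c e = - ρ b a c e) (hρ₂ : ∀ a b c e, ρ a b c e = - ρ a b e c) :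
    fderiv ℝ T.lagrangian (flrwPair k x b F X Y) (u, ρ)
      = - (X * isoLagrangianX T X Y) * (F * u 0 0)
        + (X * isoLagrangianX T X Y + 2 * Y * isoLagrangianY T X Y) / n
          * (b ^ 2 * ∑ i, ∑ j, spatialMetric k x i j * u i.succ j.succ)
        - (isoLagrangianX T X Y / n) * (1 / (F * b ^ 2) *
            spatialTrace k x fun i j => ρ 0 i.succ 0 j.succ)
        + isoLagrangianY T X Y / (n * (n - 1)) * (1 / b ^ 4 *
            spatialTrace k x fun i l => spatialTrace k x fun j m =>
              ρ i.succ j.succ l.succ m.succ) := by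
  set N := Real.sqrt F with hN
  have hN0 : N ≠ 0 := (Real.sqrt_pos.2 hF).ne'
  have hN2 : N ^ 2 = F := Real.sq_sqrt hF.le
  set A := flrwFrame hN0 hb.ne' hx with hA
  have hAw : changeFrame A (stdPair X Y) = flrwPair k x b F X Y := by
    rw [hA, changeFrame_flrwFrame, hN2]
  have hinv : changeFrame A⁻¹ (flrwPair k x b F X Y) = stdPair X Y := by
    rw [← hAw, changeFrame_inv_changeFrame]
  have hw' : flrwPair k x b F X Y ∈ T.domain := hAw ▸ T.domain_invariant A _ hw
  have hm1 : (A⁻¹).1 = blockMatrix N b (rankOne (rootInvCoeff k x) x) := rfl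
  have hm2 : ((A⁻¹)⁻¹).1 = blockMatrix N⁻¹ b⁻¹ (rankOne (rootCoeff k x) x) := rfl
  set v : Tensor2 n × Tensor4 n := (u, ρ)
  obtain ⟨h₁, h₂⟩ := changeFrame_antisymm (A := A⁻¹) (v := v) hρ₁ hρ₂
  -- Moving both the base point and the direction by the inverse frame reduces the claim to the
  -- standard pair; the four identities below express frame traces of the direction in coordinates.
  rw [← T.fderiv_changeFrame hw' A⁻¹ v, hinv]
  have hR1 : ∀ c d, ∑ i, rankOne (rootCoeff k x) x c i * rankOne (rootCoeff k x) x d i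
      = spatialInverse k x c d := by
    intro c d
    rw [← sum_root_mul_root hx c d]
    exact Finset.sum_congr rfl fun i _ => by rw [rankOne_symm _ _ d i]
  have hR2 : ∀ c d, ∑ i, rankOne (rootInvCoeff k x) x i c * rankOne (rootInvCoeff k x) x i d
      = spatialMetric k x c d := by
    intro c d
    rw [← sum_rootInv_mul_rootInv hx c d]
    exact Finset.sum_congr rfl fun i _ => by rw [rankOne_symm _ _ i c]
  have e1 : (changeFrame A⁻¹ v).1 0 0 = F * u 0 0 := by
    simp only [changeFrame, hm1, Fin.sum_univ_succ, blockMatrix_zero_zero, blockMatrix_zero_succ]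
    simp only [zero_mul, mul_zero, add_zero, Finset.sum_const_zero, v, ← hN2]
    ring
  have e2 : ∑ i : Fin n, (changeFrame A⁻¹ v).1 i.succ i.succ
      = b ^ 2 * ∑ i, ∑ j, spatialMetric k x i j * u i.succ j.succ := by
    rw [← sum_sum_frame hR2 fun i j => u i.succ j.succ, Finset.mul_sum]
    refine Finset.sum_congr rfl fun i _ => ?_
    simp only [changeFrame, hm1, Fin.sum_univ_succ, blockMatrix_succ_zero, blockMatrix_succ_succ,
      Finset.mul_sum]
    simp only [zero_mul, mul_zero, zero_add, Finset.sum_const_zero]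
    refine Finset.sum_congr rfl fun j _ => Finset.sum_congr rfl fun l _ => ?_
    simp only [v]; ring
  have e3 : ∑ i : Fin n, (changeFrame A⁻¹ v).2 0 i.succ 0 i.succ
      = 1 / (F * b ^ 2) * spatialTrace k x fun i j => ρ 0 i.succ 0 j.succ := by
    rw [spatialTrace, ← sum_sum_frame (B := fun i c => rankOne (rootCoeff k x) x c i) hR1
      fun i j => ρ 0 i.succ 0 j.succ, Finset.mul_sum]
    refine Finset.sum_congr rfl fun i _ => ?_
    simp only [changeFrame, hm2, Fin.sum_univ_succ, blockMatrix_succ_zero, blockMatrix_succ_succ,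
      blockMatrix_zero_zero, blockMatrix_zero_succ, Finset.mul_sum]
    simp only [zero_mul, mul_zero, zero_add, add_zero, Finset.sum_const_zero]
    refine Finset.sum_congr rfl fun j _ => Finset.sum_congr rfl fun l _ => ?_
    simp only [v, ← hN2]; field_simp
  have e4 : ∑ i : Fin n, ∑ j : Fin n, (changeFrame A⁻¹ v).2 i.succ j.succ i.succ j.succ
      = 1 / b ^ 4 * spatialTrace k x fun i l => spatialTrace k x fun j m =>
              ρ i.succ j.succ l.succ m.succ := by
    have h : ∀ i l : Fin n, spatialTrace k x (fun j m => ρ i.succ j.succ l.succ m.succ)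
        = ∑ j', ∑ j, ∑ m, rankOne (rootCoeff k x) x j j' * rankOne (rootCoeff k x) x m j' *
          ρ i.succ j.succ l.succ m.succ := fun i l => by
      rw [spatialTrace, ← sum_sum_frame (B := fun i c => rankOne (rootCoeff k x) x c i) hR1
        fun j m => ρ i.succ j.succ l.succ m.succ]
    simp_rw [h]
    rw [spatialTrace_sum, Finset.sum_comm, Finset.mul_sum]
    refine Finset.sum_congr rfl fun j' _ => ?_
    rw [spatialTrace, ← sum_sum_frame (B := fun i c => rankOne (rootCoeff k x) x c i) hR1,
      Finset.mul_sum]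
    refine Finset.sum_congr rfl fun i' _ => ?_
    simp only [changeFrame, hm2, Fin.sum_univ_succ, blockMatrix_zero_succ, blockMatrix_succ_succ,
      Finset.mul_sum]
    simp only [zero_mul, mul_zero, zero_add, add_zero, Finset.sum_const_zero]
    refine Finset.sum_congr rfl fun i _ => ?_
    rw [Finset.sum_comm]
    refine Finset.sum_congr rfl fun l _ => Finset.sum_congr rfl fun j _ =>
      Finset.sum_congr rfl fun m _ => ?_
    simp only [v]; field_simp
  rw [← e1, ← e2, ← e3, ← e4]
  exact fderiv_stdPair hn hw h₁ h₂

end SpatialTrace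

/-! ### Contractions of the linearized Riemann tensor at the FLRW metric -/

section Contractions

variable {n : ℕ} {k : ℝ} {x : Fin n → ℝ}

/-- The covariant divergence, with respect to the spatial metric, of a spatial covector with
components `v` and partial derivatives `V i j = ∂_i v_j`. -/
noncomputable def spatialDiv (k : ℝ) (x : Fin n → ℝ) (v : Fin n → ℝ) (V : Fin n → Fin n → ℝ) : ℝ :=
  spatialTrace k x V - n * k * ∑ j, x j * v j

theorem spatialTrace_metric (hx : 1 - k * radiusSq x ≠ 0) :
    spatialTrace k x (spatialMetric k x) = n := by
  have : ∀ i, ∑ j, spatialInverse k x i j * spatialMetric k x i j = 1 := fun i => by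
    simp_rw [spatialMetric_symm k x i]
    rw [sum_spatialInverse_mul_metric hx, if_pos rfl]
  simp [spatialTrace, this]

theorem spatialTrace_mul_metric (hx : 1 - k * radiusSq x ≠ 0) (v : Fin n → ℝ) (l : Fin n) :
    spatialTrace k x (fun j m => v m * spatialMetric k x j l) = v l := by
  have : ∀ m, ∑ j, spatialInverse k x j m * (v m * spatialMetric k x j l)
      = v m * if m = l then 1 else 0 := fun m => by
    rw [← sum_spatialInverse_mul_metric hx, Finset.mul_sum]
    exact Finset.sum_congr rfl fun j _ => by rw [spatialInverse_symm k x j]; ring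
  rw [spatialTrace, Finset.sum_comm]
  simp [this]

theorem spatialTrace_metric_mul (hx : 1 - k * radiusSq x ≠ 0) (v : Fin n → ℝ) (i : Fin n) :
    spatialTrace k x (fun j m => spatialMetric k x i m * v j) = v i := by
  rw [← spatialTrace_swap]
  simp_rw [mul_comm _ (v _), spatialMetric_symm k x i]
  exact spatialTrace_mul_metric hx v i

/-- The symmetries of the 2-jet of a field of symmetric 2-tensors. -/
structure Jet.IsSymm (η : Jet n) : Prop where
  value : ∀ a b, η.1 a b = η.1 b a
  first : ∀ c a b, η.2.1 c a b = η.2.1 c b a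
  second : ∀ c d a b, η.2.2 c d a b = η.2.2 c d b a
  comm : ∀ c d a b, η.2.2 c d a b = η.2.2 d c a b

theorem isSymm_jet {h : Coord n → Tensor2 n} {p : Coord n}
    (hh : ∀ a b, ContDiffAt ℝ 2 (fun q => h q a b) p) (hs : ∀ q a b, h q a b = h q b a) :
    (jet h p).IsSymm where
  value := hs p
  first c a b := by simp only [jet]; simp_rw [hs _ a b]
  second c d a b := by simp only [jet]; simp_rw [hs _ a b]
  comm c d a b := pd_comm (hh a b) c d

variable {a F : ℝ → ℝ} {I : Set ℝ} {p : Coord n} {η : Jet n}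

theorem ScaleLapse.christoffelJet_flrw (h : ScaleLapse I a F) (hp : p ∈ flrwDomain n k I) :
    christoffelJet (jet (flrw k a F) p) 0 0 0 = deriv F (p 0) / (2 * F (p 0)) ∧
    (∀ l : Fin n, christoffelJet (jet (flrw k a F) p) 0 0 l.succ = 0) ∧
    (∀ j : Fin n, christoffelJet (jet (flrw k a F) p) 0 (Fin.succ j) 0 = 0) ∧
    (∀ j : Fin n, christoffelJet (jet (flrw k a F) p) (Fin.succ j) 0 0 = 0) ∧
    (∀ j l : Fin n, christoffelJet (jet (flrw k a F) p) 0 (Fin.succ j) l.succ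
      = deriv a (p 0) / a (p 0) * if j = l then 1 else 0) ∧
    (∀ j l : Fin n, christoffelJet (jet (flrw k a F) p) (Fin.succ j) 0 l.succ
      = deriv a (p 0) / a (p 0) * if j = l then 1 else 0) ∧
    (∀ i j : Fin n, christoffelJet (jet (flrw k a F) p) (Fin.succ i) (Fin.succ j) 0
      = a (p 0) * deriv a (p 0) / F (p 0) * spatialMetric k (Fin.tail p) i j) ∧
    (∀ i j l : Fin n, christoffelJet (jet (flrw k a F) p) (Fin.succ i) (Fin.succ j) l.succ
      = k * p l.succ * spatialMetric k (Fin.tail p) i j) :=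
  h.christoffel_flrw hp

theorem ScaleLapse.jet_flrw_inverse_symm (e f : Fin (n + 1)) :
    (Matrix.of (jet (flrw k a F) p).1)⁻¹ e f = (Matrix.of (jet (flrw k a F) p).1)⁻¹ f e :=
  inverseMetric_symm (flrw_symm p) e f

/-- The trace leaves only scalars: the components `h_{0j}` and the spatial derivatives of `h_{00}`
can enter only through divergences. The position vectors in the Christoffel symbols are exactly what
completes the partial derivatives to covariant divergences. -/
theorem ScaleLapse.spatialTrace_linRiemann_temporal (h : ScaleLapse I a F)
    (hp : p ∈ flrwDomain n k I) (hη : η.IsSymm) {φ ℋ c : ℝ}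
    (hφ : φ = deriv F (p 0) / (2 * F (p 0))) (hℋ : ℋ = deriv a (p 0) / a (p 0))
    (hc : c = a (p 0) * deriv a (p 0) / F (p 0)) :
    spatialTrace k (Fin.tail p) (fun i j =>
        linRiemann (jet (flrw k a F) p) η 0 i.succ 0 j.succ)
      = spatialDiv k (Fin.tail p) (fun j => η.2.1 0 0 j.succ) (fun i j => η.2.2 0 i.succ 0 j.succ)
        - φ * spatialDiv k (Fin.tail p) (fun j => η.1 0 j.succ) (fun i j => η.2.1 i.succ 0 j.succ)
        - (1 / 2) * spatialDiv k (Fin.tail p) (fun j => η.2.1 j.succ 0 0)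
            (fun i j => η.2.2 i.succ j.succ 0 0)
        - (1 / 2) * spatialTrace k (Fin.tail p) (fun i j => η.2.2 0 0 i.succ j.succ)
        + (ℋ + φ / 2) * spatialTrace k (Fin.tail p) (fun i j => η.2.1 0 i.succ j.succ)
        - ℋ ^ 2 * spatialTrace k (Fin.tail p) (fun i j => η.1 i.succ j.succ)
        + n * φ * c * η.1 0 0 - (1 / 2) * n * c * η.2.1 0 0 0 := by
  obtain ⟨c1, c2, c3, c4, c5, c6, c7, c8⟩ := h.christoffelJet_flrw hp
  rw [← hφ] at c1
  rw [← hℋ] at c5 c6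
  rw [← hc] at c7
  have key : ∀ i j : Fin n, linRiemann (jet (flrw k a F) p) η 0 i.succ 0 j.succ
      = (1 / 2) * (η.2.2 0 i.succ 0 j.succ + η.2.2 0 j.succ 0 i.succ - η.2.2 i.succ j.succ 0 0
          - η.2.2 0 0 i.succ j.succ) - ℋ ^ 2 * η.1 i.succ j.succ + ℋ * η.2.1 0 i.succ j.succ
        - (φ / 2) * (η.2.1 i.succ 0 j.succ + η.2.1 j.succ 0 i.succ - η.2.1 0 i.succ j.succ)
        + (φ * c * η.1 0 0 + φ * k * (∑ l, Fin.tail p l * η.1 0 l.succ)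
          - (1 / 2) * c * η.2.1 0 0 0 - k * (∑ l, Fin.tail p l * η.2.1 0 0 l.succ)
          + (1 / 2) * k * (∑ l, Fin.tail p l * η.2.1 l.succ 0 0))
          * spatialMetric k (Fin.tail p) i j := by
    intro i j
    rw [linRiemann_eq ScaleLapse.jet_flrw_inverse_symm]
    have e1 : ∑ l : Fin n, η.1 l.succ 0 * (k * p l.succ * spatialMetric k (Fin.tail p) i j * φ)
        = φ * k * (∑ l, Fin.tail p l * η.1 0 l.succ) * spatialMetric k (Fin.tail p) i j := by
      rw [Finset.mul_sum, Finset.sum_mul]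
      exact Finset.sum_congr rfl fun l _ => by rw [hη.value, tail_apply]; ring
    have e2 : ∑ l : Fin n, lowerChristoffel η 0 0 l.succ *
        (k * p l.succ * spatialMetric k (Fin.tail p) i j)
        = (2 * k * (∑ l, Fin.tail p l * η.2.1 0 0 l.succ)
          - k * (∑ l, Fin.tail p l * η.2.1 l.succ 0 0)) * spatialMetric k (Fin.tail p) i j := by
      rw [Finset.mul_sum, Finset.mul_sum, ← Finset.sum_sub_distrib, Finset.sum_mul]
      exact Finset.sum_congr rfl fun l _ => by simp only [lowerChristoffel, tail_apply]; ring
    simp only [Fin.sum_univ_succ, c1, c2, c3, c4, c5, c6, c7, c8, zero_mul, mul_zero, zero_add,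
      add_zero, Finset.sum_const_zero, mul_ite, ite_mul, mul_one, Finset.sum_ite_eq,
      Finset.mem_univ, if_true, e1, e2]
    simp only [lowerChristoffel]
    rw [hη.comm i.succ 0 0 j.succ, hη.second 0 j.succ i.succ 0, hη.value j.succ i.succ,
      hη.first 0 j.succ i.succ, hη.first i.succ j.succ 0, hη.first j.succ i.succ 0]
    ring
  simp_rw [key]
  simp only [spatialTrace_add, spatialTrace_sub, spatialTrace_const_mul, spatialTrace_metric hp.2.ne']
  rw [spatialTrace_swap fun i j => η.2.2 0 i.succ 0 j.succ,
    spatialTrace_swap fun i j => η.2.1 i.succ 0 j.succ]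
  simp only [spatialDiv]
  ring

/-- The part of the linearized scalar curvature of the spatial metric that is a divergence. -/
noncomputable def spatialCurvatureVariation (k : ℝ) (x : Fin n → ℝ) (η : Jet n) : ℝ :=
  spatialTrace k x (fun i l => spatialTrace k x fun j m => η.2.2 j.succ l.succ i.succ m.succ)
    - spatialTrace k x (fun i l => spatialTrace k x fun j m => η.2.2 j.succ m.succ i.succ l.succ)
    - (n - 1) * k * spatialTrace k x (fun i j => η.1 i.succ j.succ)
    - 2 * (n - 1) * k * ∑ l, x l * spatialTrace k x (fun i j => η.2.1 i.succ l.succ j.succ)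
    + (n - 1) * k * ∑ l, x l * spatialTrace k x (fun i j => η.2.1 l.succ i.succ j.succ)
    + n * (n - 1) * k ^ 2 * ∑ l, ∑ m, x l * x m * η.1 l.succ m.succ

/-- A linearized Gauss equation. The terms with `c` come from the extrinsic curvature of the slices.
The others are the trace of the linearized intrinsic curvature: a divergence plus the contraction of
`h` with the Ricci tensor `(n - 1) k γ`. -/
theorem ScaleLapse.spatialTrace_linRiemann_spatial (h : ScaleLapse I a F)
    (hp : p ∈ flrwDomain n k I) (hη : η.IsSymm) {c : ℝ}
    (hc : c = a (p 0) * deriv a (p 0) / F (p 0)) :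
    spatialTrace k (Fin.tail p) (fun i l => spatialTrace k (Fin.tail p) fun j m =>
        linRiemann (jet (flrw k a F) p) η i.succ j.succ l.succ m.succ)
      = n * (n - 1) * c ^ 2 * η.1 0 0
        + (n - 1) * c * spatialTrace k (Fin.tail p) (fun i j => η.2.1 0 i.succ j.succ)
        + (n - 1) * k * spatialTrace k (Fin.tail p) (fun i j => η.1 i.succ j.succ)
        - 2 * (n - 1) * c * spatialDiv k (Fin.tail p) (fun j => η.1 0 j.succ)
            (fun i j => η.2.1 i.succ 0 j.succ)
        + spatialCurvatureVariation k (Fin.tail p) η := by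
  obtain ⟨-, -, -, -, -, -, c7, c8⟩ := h.christoffelJet_flrw hp
  rw [← hc] at c7
  set x := Fin.tail p with hxd
  -- All Christoffel symbols with two spatial lower indices are multiples of `γ_{ij}`, by `c` for
  -- the upper time index and by `k x^l` for a spatial one. The contractions therefore split into
  -- `γ` times `σ`, or two copies of `γ` times the scalar `τ`.
  set σ : Fin n → Fin n → ℝ := fun i j => c * lowerChristoffel η i.succ j.succ 0
    + ∑ l, (k * x l) * lowerChristoffel η i.succ j.succ l.succ with hσ
  set τ : ℝ := c ^ 2 * η.1 0 0 + 2 * c * k * (∑ l, x l * η.1 0 l.succ)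
    + k ^ 2 * ∑ l, ∑ m, x l * x m * η.1 l.succ m.succ with hτ
  have e1 : ∀ i j i' j' : Fin n, ∑ e, ∑ f, η.1 e f *
      (christoffelJet (jet (flrw k a F) p) i.succ j.succ e *
        christoffelJet (jet (flrw k a F) p) i'.succ j'.succ f)
      = τ * (spatialMetric k x i j * spatialMetric k x i' j') := by
    intro i j i' j'
    have f1 : ∑ m : Fin n, η.1 0 m.succ * (c * spatialMetric k x i j *
        (k * p m.succ * spatialMetric k x i' j')) = c * k * (∑ l, x l * η.1 0 l.succ)
          * (spatialMetric k x i j * spatialMetric k x i' j') := by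
      rw [Finset.mul_sum, Finset.sum_mul]
      exact Finset.sum_congr rfl fun l _ => by rw [hxd, tail_apply]; ring
    have f2 : ∑ l : Fin n, (η.1 l.succ 0 * (k * p l.succ * spatialMetric k x i j *
        (c * spatialMetric k x i' j'))) = c * k * (∑ l, x l * η.1 0 l.succ)
          * (spatialMetric k x i j * spatialMetric k x i' j') := by
      rw [Finset.mul_sum, Finset.sum_mul]
      exact Finset.sum_congr rfl fun l _ => by rw [hxd, tail_apply, hη.value]; ring
    have f3 : ∑ l : Fin n, ∑ m : Fin n, η.1 l.succ m.succ * (k * p l.succ * spatialMetric k x i j *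
        (k * p m.succ * spatialMetric k x i' j'))
          = k ^ 2 * (∑ l, ∑ m, x l * x m * η.1 l.succ m.succ)
          * (spatialMetric k x i j * spatialMetric k x i' j') := by
      rw [Finset.mul_sum, Finset.sum_mul]
      refine Finset.sum_congr rfl fun l _ => ?_
      rw [Finset.mul_sum, Finset.sum_mul]
      exact Finset.sum_congr rfl fun m _ => by rw [hxd, tail_apply, tail_apply]; ring
    simp only [Fin.sum_univ_succ, c7, c8, Finset.sum_add_distrib, f1, f2, f3]
    rw [hτ]; ring
  have e2 : ∀ i j i' j' : Fin n, ∑ e, lowerChristoffel η i.succ j.succ e *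
        christoffelJet (jet (flrw k a F) p) i'.succ j'.succ e
      = σ i j * spatialMetric k x i' j' := by
    intro i j i' j'
    simp only [Fin.sum_univ_succ, c7, c8, hσ, add_mul, Finset.sum_mul]
    congr 1
    · ring
    · exact Finset.sum_congr rfl fun l _ => by rw [hxd, tail_apply]; ring
  have key : ∀ i j l m : Fin n,
      linRiemann (jet (flrw k a F) p) η i.succ j.succ l.succ m.succ
      = (1 / 2) * (η.2.2 j.succ l.succ i.succ m.succ - η.2.2 j.succ m.succ i.succ l.succ
          - η.2.2 i.succ l.succ j.succ m.succ + η.2.2 i.succ m.succ j.succ l.succ)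
        - τ * (spatialMetric k x i m * spatialMetric k x j l
          - spatialMetric k x i l * spatialMetric k x j m)
        + (1 / 2) * (σ i m * spatialMetric k x j l + spatialMetric k x i m * σ j l
          - spatialMetric k x i l * σ j m - σ i l * spatialMetric k x j m) := by
    intro i j l m
    rw [linRiemann_eq ScaleLapse.jet_flrw_inverse_symm]
    simp only [e1, e2]
    ring
  have hx := hp.2.ne'
  have hγ : spatialTrace k x (fun i j => spatialMetric k x i j) = n := spatialTrace_metric hx
  have inner : ∀ i l : Fin n, spatialTrace k x (fun j m =>
        linRiemann (jet (flrw k a F) p) η i.succ j.succ l.succ m.succ)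
      = (1 / 2) * (spatialTrace k x (fun j m => η.2.2 j.succ l.succ i.succ m.succ)
          - spatialTrace k x (fun j m => η.2.2 j.succ m.succ i.succ l.succ)
          - spatialTrace k x (fun j m => η.2.2 i.succ l.succ j.succ m.succ)
          + spatialTrace k x (fun j m => η.2.2 i.succ m.succ j.succ l.succ))
        + (τ * (n - 1) - (1 / 2) * spatialTrace k x (fun i j => σ i j)) * spatialMetric k x i l
        + (1 - n / 2) * σ i l := by
    intro i l
    simp_rw [key]
    simp only [spatialTrace_add, spatialTrace_sub, spatialTrace_const_mul, hγ]
    rw [spatialTrace_mul_metric hx (fun m => spatialMetric k x i m) l,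
      spatialTrace_mul_metric hx (fun m => σ i m) l,
      spatialTrace_metric_mul hx (fun j => σ j l) i]
    ring
  have hσt : spatialTrace k x (fun i j => σ i j)
      = 2 * c * spatialTrace k x (fun i j => η.2.1 i.succ 0 j.succ)
        - c * spatialTrace k x (fun i j => η.2.1 0 i.succ j.succ)
        + 2 * k * (∑ l, x l * spatialTrace k x (fun i j => η.2.1 i.succ l.succ j.succ))
        - k * ∑ l, x l * spatialTrace k x (fun i j => η.2.1 l.succ i.succ j.succ) := by
    have g1 : ∀ l, spatialTrace k x (fun i j => lowerChristoffel η i.succ j.succ l)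
        = 2 * spatialTrace k x (fun i j => η.2.1 i.succ l j.succ)
          - spatialTrace k x (fun i j => η.2.1 l i.succ j.succ) := by
      intro l
      simp only [lowerChristoffel, spatialTrace_add, spatialTrace_sub]
      rw [spatialTrace_swap fun i j => η.2.1 i.succ j.succ l]
      simp_rw [hη.first _ _ l]
      ring
    simp only [hσ, spatialTrace_add, spatialTrace_const_mul, spatialTrace_sum, g1]
    rw [Finset.mul_sum, Finset.mul_sum, mul_sub, add_sub_assoc, ← Finset.sum_sub_distrib]
    congr 1
    · ring
    · exact Finset.sum_congr rfl fun l _ => by ring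
  simp_rw [inner]
  simp only [spatialTrace_add, spatialTrace_sub, spatialTrace_const_mul, hγ]
  rw [spatialTrace_comm fun i l j m => η.2.2 i.succ l.succ j.succ m.succ,
    spatialTrace_comm fun i l j m => η.2.2 i.succ m.succ j.succ l.succ, hσt, hτ]
  simp only [spatialDiv, spatialCurvatureVariation]
  ring

end Contractions

/-! ### The first variation of the Lagrangian density at the FLRW metric -/

section FirstVariation

variable {n : ℕ} {k : ℝ} {T : GravityTheory n} {a F : ℝ → ℝ} {I : Set ℝ} {p : Coord n} {η : Jet n}

/-- The first variation of the Lagrangian density at the metric with 2-jet `j`. -/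
noncomputable def densityVariation (T : GravityTheory n) (j η : Jet n) : ℝ :=
  Real.sqrt |(Matrix.of j.1).det| *
    ((1 / 2) * (∑ a, ∑ b, (Matrix.of j.1)⁻¹ a b * η.1 b a) * T.lagrangian (curvatureJet j)
    + fderiv ℝ T.lagrangian (curvatureJet j) (linInverse j η, linRiemann j η))

theorem sum_spatialMetric_mul_inverse {x : Fin n → ℝ} (hx : 1 - k * radiusSq x ≠ 0)
    (M : Fin n → Fin n → ℝ) :
    ∑ i, ∑ j, spatialMetric k x i j *
      (∑ c, ∑ d, spatialInverse k x i c * spatialInverse k x d j * M c d) = spatialTrace k x M := by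
  have h1 : ∀ i, ∑ j, spatialMetric k x i j *
      (∑ c, ∑ d, spatialInverse k x i c * spatialInverse k x d j * M c d)
      = ∑ c, spatialInverse k x i c * M c i := by
    intro i
    simp only [Finset.mul_sum]
    rw [Finset.sum_comm]
    refine Finset.sum_congr rfl fun c _ => ?_
    rw [Finset.sum_comm]
    have h2 : ∀ d, ∑ j, spatialMetric k x i j *
        (spatialInverse k x i c * spatialInverse k x d j * M c d)
        = spatialInverse k x i c * M c d * if d = i then 1 else 0 := by
      intro d
      rw [← sum_spatialInverse_mul_metric hx d i, Finset.mul_sum]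
      exact Finset.sum_congr rfl fun j _ => by rw [spatialMetric_symm k x i j]; ring
    simp [h2]
  simp_rw [h1]
  rw [← spatialTrace_swap]
  rfl

/-- The part of the first variation of the Lagrangian density that is a spatial divergence. -/
noncomputable def divergencePart (T : GravityTheory n) (k : ℝ) (a F : ℝ → ℝ) (p : Coord n)
    (η : Jet n) : ℝ :=
  Real.sqrt (F (p 0)) * a (p 0) ^ n / Real.sqrt (1 - k * radiusSq (Fin.tail p)) *
    (- (isoLagrangianX T (scalarX a F (p 0)) (scalarY k a F (p 0)) / (n * F (p 0) * a (p 0) ^ 2)) *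
      (spatialDiv k (Fin.tail p) (fun j => η.2.1 0 0 j.succ) (fun i j => η.2.2 0 i.succ 0 j.succ)
        - deriv F (p 0) / (2 * F (p 0)) * spatialDiv k (Fin.tail p) (fun j => η.1 0 j.succ)
            (fun i j => η.2.1 i.succ 0 j.succ)
        - (1 / 2) * spatialDiv k (Fin.tail p) (fun j => η.2.1 j.succ 0 0)
            (fun i j => η.2.2 i.succ j.succ 0 0))
    + isoLagrangianY T (scalarX a F (p 0)) (scalarY k a F (p 0)) / (n * (n - 1) * a (p 0) ^ 4) *
      (- (2 * (n - 1) * (a (p 0) * deriv a (p 0) / F (p 0))) *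
        spatialDiv k (Fin.tail p) (fun j => η.1 0 j.succ) (fun i j => η.2.1 i.succ 0 j.succ)
        + spatialCurvatureVariation k (Fin.tail p) η))

/-- The part of the first variation of the Lagrangian density that comes from the reduced
Lagrangian. -/
noncomputable def reducedPart (T : GravityTheory n) (k : ℝ) (a F : ℝ → ℝ) (t : ℝ)
    (h₀ h₁ H₀ H₁ H₂ : ℝ) : ℝ :=
  - partialF T k a F t * h₀ - partialFdot T k a F t * h₁
    + partialA T k a F t * (1 / (2 * n * a t) * H₀)
    + partialAdot T k a F t *
      (- deriv a t / (2 * n * a t ^ 2) * H₀ + 1 / (2 * n * a t) * H₁)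
    + partialAddot T k a F t *
      ((- deriv (deriv a) t / (2 * n * a t ^ 2) + deriv a t ^ 2 / (n * a t ^ 3)) * H₀
        + 2 * (- deriv a t / (2 * n * a t ^ 2)) * H₁ + 1 / (2 * n * a t) * H₂)

/-- The pointwise core of the theorem. Once `d𝓛` is expressed through traces and these are computed,
everything outside the spatial divergences is the variation of the reduced Lagrangian with `δF =
-h_{00}` and `δa = H/(2na)`. As `γ⁻¹` does not depend on `t`, traces of time derivatives of `h` are
time derivatives of `H`. -/
theorem AdmissibleCurve.densityVariation_eq (hn : 2 ≤ n) (h : AdmissibleCurve T k I a F)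
    (hp : p ∈ flrwDomain n k I) (hη : η.IsSymm) :
    densityVariation T (jet (flrw k a F) p) η
      = 1 / Real.sqrt (1 - k * radiusSq (Fin.tail p)) *
        reducedPart T k a F (p 0) (η.1 0 0) (η.2.1 0 0 0)
          (spatialTrace k (Fin.tail p) fun i j => η.1 i.succ j.succ)
          (spatialTrace k (Fin.tail p) fun i j => η.2.1 0 i.succ j.succ)
          (spatialTrace k (Fin.tail p) fun i j => η.2.2 0 0 i.succ j.succ)
        + divergencePart T k a F p η := by
  have ha := h.scale_pos _ hp.1
  have hF := h.lapse_pos _ hp.1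
  have hx := hp.2
  have hg : ∀ μ ν, ContDiffAt ℝ 2 (fun q => flrw k a F q μ ν) p := fun μ ν =>
    (h.contDiffAt_flrw hp μ ν).of_le (by norm_cast)
  have hdet := h.det_flrw_ne_zero hp
  have hcurv : curvatureJet (jet (flrw k a F) p) = flrwPair k (Fin.tail p) (a (p 0)) (F (p 0))
      (scalarX a F (p 0)) (scalarY k a F (p 0)) := by
    rw [← curvatureData_eq_curvatureJet hg hdet flrw_symm, h.curvatureData_flrw hp]
  have hvol : Real.sqrt |(Matrix.of (jet (flrw k a F) p).1).det|
      = Real.sqrt (F (p 0)) * a (p 0) ^ n / Real.sqrt (1 - k * radiusSq (Fin.tail p)) :=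
    h.volumeFactor_flrw hp
  have hinv : ∀ μ ν, (Matrix.of (jet (flrw k a F) p).1)⁻¹ μ ν = flrwInverse k a F p μ ν :=
    fun μ ν => congrFun (congrFun (h.inverseMetric_flrw hp) μ) ν
  have htr : ∑ μ, ∑ ν, (Matrix.of (jet (flrw k a F) p).1)⁻¹ μ ν * η.1 ν μ
      = - η.1 0 0 / F (p 0)
        + (spatialTrace k (Fin.tail p) fun i j => η.1 i.succ j.succ) / a (p 0) ^ 2 := by
    simp only [hinv, Fin.sum_univ_succ, flrwInverse, Fin.cons_zero, Fin.cons_succ, zero_mul,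
      Finset.sum_const_zero, add_zero, zero_add, spatialTrace, Finset.sum_div]
    congr 1
    · ring
    · exact Finset.sum_congr rfl fun i _ => Finset.sum_congr rfl fun j _ => by
        rw [hη.value j.succ i.succ]; ring
  have hu0 : linInverse (jet (flrw k a F) p) η 0 0 = - η.1 0 0 / F (p 0) ^ 2 := by
    simp only [linInverse, hinv, Fin.sum_univ_succ, flrwInverse, Fin.cons_zero, Fin.cons_succ,
      zero_mul, mul_zero, Finset.sum_const_zero, add_zero]
    field_simp
  have hu1 : ∑ i, ∑ j, spatialMetric k (Fin.tail p) i j *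
      linInverse (jet (flrw k a F) p) η i.succ j.succ
      = - (spatialTrace k (Fin.tail p) fun i j => η.1 i.succ j.succ) / a (p 0) ^ 4 := by
    rw [← sum_spatialMetric_mul_inverse hx.ne', neg_div, Finset.sum_div, ← Finset.sum_neg_distrib]
    refine Finset.sum_congr rfl fun i _ => ?_
    rw [Finset.sum_div, ← Finset.sum_neg_distrib]
    refine Finset.sum_congr rfl fun j _ => ?_
    simp only [linInverse, hinv, Fin.sum_univ_succ, flrwInverse, Fin.cons_zero, Fin.cons_succ,
      zero_mul, mul_zero, Finset.sum_const_zero, zero_add]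
    rw [mul_div_assoc, Finset.sum_div, ← mul_neg]
    congr 2
    refine Finset.sum_congr rfl fun c _ => ?_
    rw [Finset.sum_div]
    refine Finset.sum_congr rfl fun d _ => ?_
    field_simp
  rw [densityVariation, hvol, hcurv, htr, lagrangian_flrwPair ha hF hx (h.mem_domain _ hp.1),
    fderiv_flrwPair hn ha hF hx (h.mem_domain _ hp.1) linRiemann_antisymm_left
      (linRiemann_antisymm_right ScaleLapse.jet_flrw_inverse_symm hη.value), hu0, hu1,
    h.spatialTrace_linRiemann_temporal hp hη rfl rfl rfl,
    h.spatialTrace_linRiemann_spatial hp hη rfl]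
  generalize spatialTrace k (Fin.tail p) (fun i j => η.1 i.succ j.succ) = H₀
  generalize spatialTrace k (Fin.tail p) (fun i j => η.2.1 0 i.succ j.succ) = H₁
  generalize spatialTrace k (Fin.tail p) (fun i j => η.2.2 0 0 i.succ j.succ) = H₂
  simp only [reducedPart, divergencePart, partialF, partialFdot, partialA, partialAdot,
    partialAddot]
  generalize isoLagrangian T (scalarX a F (p 0)) (scalarY k a F (p 0)) = l
  generalize isoLagrangianX T (scalarX a F (p 0)) (scalarY k a F (p 0)) = lX
  generalize isoLagrangianY T (scalarX a F (p 0)) (scalarY k a F (p 0)) = lY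
  generalize spatialDiv k (Fin.tail p) (fun j => η.2.1 0 0 j.succ)
    (fun i j => η.2.2 0 i.succ 0 j.succ) = d₀
  generalize spatialDiv k (Fin.tail p) (fun j => η.1 0 j.succ)
    (fun i j => η.2.1 i.succ 0 j.succ) = d₁
  generalize spatialDiv k (Fin.tail p) (fun j => η.2.1 j.succ 0 0)
    (fun i j => η.2.2 i.succ j.succ 0 0) = d₂
  generalize spatialCurvatureVariation k (Fin.tail p) η = z
  have hn0 : (n : ℝ) ≠ 0 := by positivity
  have hn1 : (n : ℝ) - 1 ≠ 0 := by
    have : (2 : ℝ) ≤ n := by exact_mod_cast hn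
    intro h; linarith
  have hs := (Real.sqrt_pos.2 hx).ne'
  simp only [scalarX, scalarY, accel, hubbleSq]
  generalize η.1 0 0 = h₀
  generalize η.2.1 0 0 0 = h₁
  generalize Real.sqrt (1 - k * radiusSq (Fin.tail p)) = s at *
  generalize deriv (deriv a) (p 0) = a₂ at *
  generalize deriv a (p 0) = a₁ at *
  generalize deriv F (p 0) = F₁ at *
  -- With the volume factor `√F a ^ n` replaced by a variable, an identity of rational functions
  -- remains.
  generalize hV : Real.sqrt (F (p 0)) * a (p 0) ^ n = V
  generalize a (p 0) = a₀ at *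
  generalize F (p 0) = F₀ at *
  generalize (n : ℝ) = m at *
  have ha0 := ha.ne'
  have hF0 := hF.ne'
  clear * - ha0 hF0 hs hn0 hn1
  field_simp
  ring

end FirstVariation

/-! ### Functions whose integral vanishes because they are divergences -/

section ZeroIntegral

variable {n : ℕ} {K Ω : Set (Coord n)}

/-- `f` is integrable on `K`, and its integral is zero. -/
structure HasZeroIntegral (K : Set (Coord n)) (f : Coord n → ℝ) : Prop where
  integrableOn : MeasureTheory.IntegrableOn f K
  integral_eq : ∫ p in K, f p = 0

theorem HasZeroIntegral.zero : HasZeroIntegral K fun _ => 0 :=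
  ⟨MeasureTheory.integrableOn_zero, by simp⟩

theorem HasZeroIntegral.add {f g : Coord n → ℝ} (hf : HasZeroIntegral K f)
    (hg : HasZeroIntegral K g) : HasZeroIntegral K fun p => f p + g p :=
  ⟨hf.1.add hg.1, by rw [MeasureTheory.integral_add hf.1 hg.1, hf.2, hg.2, add_zero]⟩

theorem HasZeroIntegral.sum {ι : Type*} (s : Finset ι) {f : ι → Coord n → ℝ}
    (hf : ∀ i ∈ s, HasZeroIntegral K (f i)) : HasZeroIntegral K fun p => ∑ i ∈ s, f i p := by
  classical
  induction s using Finset.induction_on with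
  | empty => simpa using HasZeroIntegral.zero
  | insert i s hi ih =>
    simp only [Finset.sum_insert hi]
    exact (hf i (by simp)).add (ih fun l hl => hf l (by simp [hl]))

theorem HasZeroIntegral.congr {f g : Coord n → ℝ} (hK : MeasurableSet K)
    (hf : HasZeroIntegral K f) (hfg : ∀ p ∈ K, g p = f p) : HasZeroIntegral K g :=
  ⟨hf.1.congr_fun (fun p hp => (hfg p hp).symm) hK, by
    rw [MeasureTheory.setIntegral_congr_fun hK hfg, hf.2]⟩

/-- Integration by parts against the constant function `1`. -/
theorem integral_pd_eq_zero {Z : Coord n → ℝ} (hZ : ContDiff ℝ 1 Z) (hc : HasCompactSupport Z)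
    (μ : Fin (n + 1)) :
    MeasureTheory.Integrable (fun p => pd μ Z p) ∧ ∫ p, pd μ Z p = 0 := by
  have h1 : MeasureTheory.Integrable (fun p => pd μ Z p) := by
    refine Continuous.integrable_of_hasCompactSupport ?_ ?_
    · exact (hZ.continuous_fderiv one_ne_zero).clm_apply continuous_const
    · exact hc.fderiv_apply (𝕜 := ℝ) _
  refine ⟨h1, ?_⟩
  have h := integral_mul_fderiv_eq_neg_fderiv_mul_of_integrable (𝕜 := ℝ)
    (μ := MeasureTheory.volume) (f := fun _ : Coord n => (1 : ℝ)) (g := Z)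
    (v := Pi.single μ 1) (by simp) (by simpa [pd] using h1)
    (by simpa using hZ.continuous.integrable_of_hasCompactSupport hc)
    (fun _ _ => differentiableAt_const _) (fun x _ => hZ.differentiable one_ne_zero x)
  simpa [pd] using h

/-- `v` is a smooth function with support in the compact set `K`. -/
structure IsTest (K : Set (Coord n)) (v : Coord n → ℝ) : Prop where
  smooth : ContDiff ℝ ∞ v
  support : tsupport v ⊆ K

theorem IsTest.pd {v : Coord n → ℝ} (hv : IsTest K v) (μ : Fin (n + 1)) :
    IsTest K fun p => Gravity.pd μ v p where
  smooth := (hv.smooth.fderiv_right (by simp)).clm_apply contDiff_const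
  support := (tsupport_fderiv_apply_subset ℝ _).trans hv.support

theorem IsTest.mul_left {v g : Coord n → ℝ} (hv : IsTest K v) (hg : ContDiff ℝ ∞ g) :
    IsTest K fun p => g p * v p where
  smooth := hg.mul hv.smooth
  support := (tsupport_mul_subset_right).trans hv.support

theorem IsTest.sub {v w : Coord n → ℝ} (hv : IsTest K v) (hw : IsTest K w) :
    IsTest K fun p => v p - w p where
  smooth := hv.smooth.sub hw.smooth
  support := (tsupport_sub v w).trans (Set.union_subset hv.support hw.support)

theorem isTest_zero : IsTest K fun _ => 0 where
  smooth := contDiff_const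
  support := by simp [tsupport]

theorem IsTest.add {v w : Coord n → ℝ} (hv : IsTest K v) (hw : IsTest K w) :
    IsTest K fun p => v p + w p where
  smooth := hv.smooth.add hw.smooth
  support := (tsupport_add v w).trans (Set.union_subset hv.support hw.support)

theorem IsTest.sum {ι : Type*} (s : Finset ι) {v : ι → Coord n → ℝ}
    (hv : ∀ i ∈ s, IsTest K (v i)) : IsTest K fun p => ∑ i ∈ s, v i p := by
  classical
  induction s using Finset.induction_on with
  | empty => simpa using isTest_zero
  | insert i s hi ih =>
    simp only [Finset.sum_insert hi]
    exact (hv i (by simp)).add (ih fun l hl => hv l (by simp [hl]))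

theorem IsTest.differentiableAt {v : Coord n → ℝ} (hv : IsTest K v) (p : Coord n) :
    DifferentiableAt ℝ v p := hv.smooth.differentiable (by simp) p

/-- Integration by parts. -/
theorem IsTest.hasZeroIntegral_pd_mul {v G : Coord n → ℝ} (hv : IsTest K v) (hK : IsCompact K)
    (hG : ∀ p ∈ K, ContDiffAt ℝ 1 G p) (μ : Fin (n + 1)) :
    HasZeroIntegral K fun p => Gravity.pd μ G p * v p + G p * Gravity.pd μ v p := by
  have hsub : tsupport (fun p => G p * v p) ⊆ tsupport v := tsupport_mul_subset_right
  have hZ : ContDiff ℝ 1 fun p => G p * v p := by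
    rw [contDiff_iff_contDiffAt]
    intro p
    by_cases hp : p ∈ tsupport v
    · exact (hG p (hv.support hp)).mul (hv.smooth.contDiffAt.of_le (by norm_cast))
    -- `G` is only assumed regular on `K`; outside the support of `v` the product vanishes locally,
    -- so it is nevertheless regular everywhere.
    · have : (fun p => G p * v p) =ᶠ[nhds p] fun _ => 0 := by
        filter_upwards [notMem_tsupport_iff_eventuallyEq.1 hp] with q hq
        simp [hq]
      exact contDiffAt_const.congr_of_eventuallyEq this
  have hc : HasCompactSupport fun p => G p * v p :=
    hK.of_isClosed_subset (isClosed_tsupport _) (hsub.trans hv.support)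
  obtain ⟨h1, h2⟩ := integral_pd_eq_zero hZ hc μ
  have h3 : HasZeroIntegral K fun p => Gravity.pd μ (fun q => G q * v q) p := by
    refine ⟨h1.integrableOn, ?_⟩
    rw [MeasureTheory.setIntegral_eq_integral_of_forall_compl_eq_zero, h2]
    intro p hp
    have : p ∉ tsupport (fun p => G p * v p) := fun h => hp (hv.support (hsub h))
    rw [Gravity.pd, (notMem_tsupport_iff_eventuallyEq.1 this).fderiv_eq]
    simp
  exact h3.congr hK.measurableSet fun p hp =>
    (((hasGrad_pd ((hG p hp).differentiableAt one_ne_zero)).mul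
      (hasGrad_pd (hv.differentiableAt p))).pd μ).symm

variable {k : ℝ} {I : Set ℝ} {v : Coord n → ℝ}

theorem hasGrad_inv_sqrt {p : Coord n} (hx : 0 < 1 - k * radiusSq (Fin.tail p)) :
    HasGrad (fun q => 1 / Real.sqrt (1 - k * radiusSq (Fin.tail q)))
      (Fin.cons 0 fun i => k * p i.succ / ((1 - k * radiusSq (Fin.tail p)) *
        Real.sqrt (1 - k * radiusSq (Fin.tail p)))) p := by
  have hs := (Real.sqrt_pos.2 hx).ne'
  have h1 := ((hasGrad_const (p := p) 1).sub (hasGrad_radiusSq.const_mul k))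
  have h2 : HasDerivAt (fun y => 1 / Real.sqrt y) _ (1 - k * radiusSq (Fin.tail p)) :=
    ((hasDerivAt_const _ (1 : ℝ)).div (Real.hasDerivAt_sqrt hx.ne') hs)
  have h3 := HasGrad.comp h2 h1
  refine h3.congr_grad fun μ => ?_
  refine Fin.cases ?_ (fun l => ?_) μ
  · simp
  · simp only [Fin.cons_succ]
    rw [Real.sq_sqrt hx.le]
    field_simp
    ring

theorem contDiffAt_inv_sqrt {m : WithTop ℕ∞} {p : Coord n}
    (hx : 0 < 1 - k * radiusSq (Fin.tail p)) :
    ContDiffAt ℝ m (fun q : Coord n => 1 / Real.sqrt (1 - k * radiusSq (Fin.tail q))) p :=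
  contDiffAt_const.div ((contDiffAt_const.sub (contDiffAt_const.mul contDiffAt_radiusSq_tail)).sqrt
    hx.ne') (Real.sqrt_pos.2 hx).ne'

/-- Integration by parts in the time direction. -/
theorem IsTest.hasZeroIntegral_time (hv : IsTest K v) (hK : IsCompact K)
    (hKΩ : K ⊆ flrwDomain n k I) {f f' : ℝ → ℝ} (hf : ∀ t ∈ I, ContDiffAt ℝ 1 f t)
    (hf' : ∀ t ∈ I, HasDerivAt f (f' t) t) :
    HasZeroIntegral K fun p => 1 / Real.sqrt (1 - k * radiusSq (Fin.tail p)) *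
      (f' (p 0) * v p + f (p 0) * Gravity.pd 0 v p) := by
  refine (hv.hasZeroIntegral_pd_mul hK (G := fun q => f (q 0) *
    (1 / Real.sqrt (1 - k * radiusSq (Fin.tail q)))) (fun p hp => ?_) 0).congr hK.measurableSet
    fun p hp => ?_
  · exact (ContDiffAt.comp (g := f) p (hf _ (hKΩ hp).1) (by fun_prop)).mul
      (contDiffAt_inv_sqrt (hKΩ hp).2)
  · rw [((hasGrad_time (hf' _ (hKΩ hp).1)).mul (hasGrad_inv_sqrt (hKΩ hp).2)).pd 0]
    simp only [Fin.cons_zero]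
    ring

theorem hasGrad_spatialInverse {p : Coord n} (i j : Fin n) :
    HasGrad (fun q => spatialInverse k (Fin.tail q) i j)
      (Fin.cons 0 fun l => - k * ((if l = i then p j.succ else 0) +
        if l = j then p i.succ else 0)) p := by
  have h := (hasGrad_const (p := p) (if i = j then 1 else 0)).sub
    (((hasGrad_coord i.succ).const_mul k).mul (hasGrad_coord j.succ))
  have h' : HasGrad (fun q => spatialInverse k (Fin.tail q) i j) _ p := h
  refine h'.congr_grad fun μ => ?_
  refine Fin.cases ?_ (fun l => ?_) μ
  · simp [eq_comm (a := (0 : Fin (n + 1)))]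
  · simp only [Fin.cons_succ, Fin.succ_inj]
    split_ifs <;> ring

theorem contDiff_spatialInverse {m : WithTop ℕ∞} (i j : Fin n) :
    ContDiff ℝ m fun q : Coord n => spatialInverse k (Fin.tail q) i j := by
  simp only [spatialInverse, tail_apply]; fun_prop

/-- Integration by parts in the spatial directions. -/
theorem hasZeroIntegral_space {v : Fin n → Coord n → ℝ} (hv : ∀ j, IsTest K (v j))
    (hK : IsCompact K) (hKΩ : K ⊆ flrwDomain n k I) {f : ℝ → ℝ}
    (hf : ∀ t ∈ I, ContDiffAt ℝ 1 f t) :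
    HasZeroIntegral K fun p => f (p 0) / Real.sqrt (1 - k * radiusSq (Fin.tail p)) *
      spatialDiv k (Fin.tail p) (fun j => v j p) (fun i j => Gravity.pd i.succ (v j) p) := by
  have h : ∀ i j : Fin n, HasZeroIntegral K _ := fun i j =>
    (hv j).hasZeroIntegral_pd_mul hK (G := fun q => f (q 0) *
      (1 / Real.sqrt (1 - k * radiusSq (Fin.tail q)) * spatialInverse k (Fin.tail q) i j))
      (fun p hp => (ContDiffAt.comp (g := f) p (hf _ (hKΩ hp).1) (by fun_prop)).mul
        ((contDiffAt_inv_sqrt (hKΩ hp).2).mul (contDiff_spatialInverse i j).contDiffAt)) i.succ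
  refine (HasZeroIntegral.sum Finset.univ fun i _ => HasZeroIntegral.sum Finset.univ
    fun j _ => h i j).congr hK.measurableSet fun p hp => ?_
  have hx := (hKΩ hp).2
  have hd := ((hf _ (hKΩ hp).1).differentiableAt one_ne_zero).hasDerivAt
  have hg : ∀ i j : Fin n, Gravity.pd i.succ (fun q => f (q 0) *
      (1 / Real.sqrt (1 - k * radiusSq (Fin.tail q)) * spatialInverse k (Fin.tail q) i j)) p
      = f (p 0) / Real.sqrt (1 - k * radiusSq (Fin.tail p)) *
        (k * p i.succ / (1 - k * radiusSq (Fin.tail p)) * spatialInverse k (Fin.tail p) i j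
          - k * (p j.succ + if i = j then p i.succ else 0)) := by
    intro i j
    rw [((hasGrad_time hd).mul ((hasGrad_inv_sqrt hx).mul (hasGrad_spatialInverse i j))).pd]
    simp only [Fin.cons_succ, if_true]
    field_simp
    ring
  -- This is the divergence of `√γ γ^{ij}` relative to `√γ = (1 - k r²)^{-1/2}`. It equals `-γ^{il}
  -- Γ_{il}^j = -n k x^j`, the correction term in `spatialDiv`.
  have hj : ∀ j : Fin n, ∑ i : Fin n, (k * p i.succ / (1 - k * radiusSq (Fin.tail p)) *
      spatialInverse k (Fin.tail p) i j - k * (p j.succ + if i = j then p i.succ else 0))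
      = - (n * k * p j.succ) := by
    intro j
    have e := sum_spatialInverse_mul_coord (k := k) (x := Fin.tail p) j
    have e' : ∑ i : Fin n, k * p i.succ / (1 - k * radiusSq (Fin.tail p)) *
        spatialInverse k (Fin.tail p) i j = k * p j.succ := by
      calc _ = k / (1 - k * radiusSq (Fin.tail p)) *
            ∑ i, spatialInverse k (Fin.tail p) j i * Fin.tail p i := by
            rw [Finset.mul_sum]
            exact Finset.sum_congr rfl fun i _ => by
              rw [spatialInverse_symm k _ i j, tail_apply]; ring
        _ = _ := by rw [e, tail_apply]; field_simp
    rw [Finset.sum_sub_distrib, e', ← Finset.mul_sum, Finset.sum_add_distrib]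
    simp
    ring
  simp only [hg, Finset.sum_add_distrib]
  rw [Finset.sum_comm (f := fun i j => _ * v j p)]
  simp_rw [← Finset.sum_mul, ← Finset.mul_sum, hj]
  simp only [spatialDiv, spatialTrace, mul_sub, Finset.mul_sum]
  rw [sub_eq_neg_add, ← Finset.sum_neg_distrib]
  congr 1
  · exact Finset.sum_congr rfl fun j _ => by rw [tail_apply]; ring
  · exact Finset.sum_congr rfl fun i _ => Finset.sum_congr rfl fun j _ => by ring

end ZeroIntegral

/-! ### The first variation of the action at the FLRW metric -/

section ActionVariation

variable {n : ℕ} {k : ℝ} {K : Set (Coord n)} {p : Coord n} {h : Coord n → Tensor2 n}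

/-- The inverse metric is constant in time, so the time derivative passes through the trace; spatial
derivatives pick up a term from the quadratic dependence of `γ⁻¹` on `x`. -/
theorem hasGrad_spatialTrace {M : Coord n → Fin n → Fin n → ℝ}
    {M' : Fin (n + 1) → Fin n → Fin n → ℝ}
    (hM : ∀ i j, HasGrad (fun q => M q i j) (fun μ => M' μ i j) p) :
    HasGrad (fun q => spatialTrace k (Fin.tail q) (M q))
      (Fin.cons (spatialTrace k (Fin.tail p) (M' 0)) fun l =>
        spatialTrace k (Fin.tail p) (M' l.succ)
          - k * ∑ m : Fin n, Fin.tail p m * (M p l m + M p m l)) p := by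
  have h0 : HasGrad (fun q => spatialTrace k (Fin.tail q) (M q)) _ p :=
    HasGrad.sum fun i _ => HasGrad.sum fun j _ => (hasGrad_spatialInverse i j).mul (hM i j)
  refine h0.congr_grad fun μ => ?_
  refine Fin.cases ?_ (fun l => ?_) μ
  · simp [spatialTrace]
  · simp only [Fin.cons_succ, Finset.sum_add_distrib]
    rw [add_comm, sub_eq_add_neg]
    congr 1
    have e : ∀ i j : Fin n, - k * ((if l = i then p j.succ else 0) + if l = j then p i.succ else 0)
        * M p i j = (if l = i then - k * (p j.succ * M p i j) else 0)
          + if l = j then - k * (p i.succ * M p i j) else 0 := by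
      intro i j
      split_ifs <;> ring
    simp_rw [e, Finset.sum_add_distrib]
    rw [Finset.sum_comm]
    simp only [Finset.sum_ite_eq, Finset.mem_univ, if_true, ← Finset.mul_sum, mul_add,
      Finset.sum_add_distrib, tail_apply]
    ring

theorem IsTest.spatialTrace {M : Coord n → Fin n → Fin n → ℝ}
    (hM : ∀ i j, IsTest K fun q => M q i j) :
    IsTest K fun q => spatialTrace k (Fin.tail q) (M q) :=
  IsTest.sum _ fun i _ => IsTest.sum _ fun j _ => (hM i j).mul_left (contDiff_spatialInverse i j)

/-- `h` is a smooth field of symmetric tensors, with support in `K`. -/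
structure IsTestTensor (K : Set (Coord n)) (h : Coord n → Tensor2 n) : Prop where
  component : ∀ a b, IsTest K fun q => h q a b
  symm : ∀ q a b, h q a b = h q b a

theorem IsTestTensor.contDiffAt (hh : IsTestTensor K h) (p : Coord n) (a b : Fin (n + 1)) :
    ContDiffAt ℝ 2 (fun q => h q a b) p :=
  (hh.component a b).smooth.contDiffAt.of_le (by norm_cast)

theorem IsTestTensor.isSymm (hh : IsTestTensor K h) (p : Coord n) : (jet h p).IsSymm :=
  isSymm_jet (hh.contDiffAt p) hh.symm

theorem IsTestTensor.hasGrad (hh : IsTestTensor K h) (p : Coord n) (a b : Fin (n + 1)) :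
    HasGrad (fun q => h q a b) (fun μ => (jet h p).2.1 μ a b) p :=
  hasGrad_pd ((hh.component a b).differentiableAt p)

theorem IsTestTensor.hasGrad_pd (hh : IsTestTensor K h) (p : Coord n) (c a b : Fin (n + 1)) :
    HasGrad (fun q => (jet h q).2.1 c a b) (fun μ => (jet h p).2.2 μ c a b) p :=
  Gravity.hasGrad_pd (((hh.component a b).pd c).differentiableAt p)

/-- The trace of the spatial part of a tensor field. -/
noncomputable def traceField (k : ℝ) (h : Coord n → Tensor2 n) (q : Coord n) : ℝ :=
  spatialTrace k (Fin.tail q) fun i j => h q i.succ j.succ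

theorem IsTestTensor.traceField (hh : IsTestTensor K h) : IsTest K (traceField k h) :=
  IsTest.spatialTrace (M := fun q i j => h q i.succ j.succ) fun _ _ => hh.component _ _

theorem IsTestTensor.pd_traceField (hh : IsTestTensor K h) (p : Coord n) :
    pd 0 (Gravity.traceField k h) p
      = spatialTrace k (Fin.tail p) fun i j => (jet h p).2.1 0 i.succ j.succ :=
  (hasGrad_spatialTrace (M := fun q i j => h q i.succ j.succ)
    fun _ _ => hh.hasGrad p _ _).pd 0

theorem IsTestTensor.pd_pd_traceField (hh : IsTestTensor K h) (p : Coord n) :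
    pd 0 (fun q => pd 0 (Gravity.traceField k h) q) p
      = spatialTrace k (Fin.tail p) fun i j => (jet h p).2.2 0 0 i.succ j.succ := by
  have : (fun q => pd 0 (Gravity.traceField k h) q)
      = fun q => spatialTrace k (Fin.tail q) fun i j => (jet h q).2.1 0 i.succ j.succ :=
    funext hh.pd_traceField
  rw [this]
  exact (hasGrad_spatialTrace (M := fun q i j => (jet h q).2.1 0 i.succ j.succ)
    fun _ _ => hh.hasGrad_pd p _ _ _).pd 0

/-- The spatial covector whose divergence is the variation of the spatial curvature. -/
noncomputable def curvatureCovector (k : ℝ) (h : Coord n → Tensor2 n) (j : Fin n) (q : Coord n) :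
    ℝ :=
  spatialTrace k (Fin.tail q) (fun i l =>
      (jet h q).2.1 i.succ l.succ j.succ - (jet h q).2.1 j.succ i.succ l.succ)
    - ∑ m : Fin n, ((n - 1) * k * q m.succ) * h q m.succ j.succ

theorem IsTestTensor.curvatureCovector (hh : IsTestTensor K h) (j : Fin n) :
    IsTest K (curvatureCovector k h j) :=
  (IsTest.spatialTrace fun i l => ((hh.component l.succ j.succ).pd i.succ).sub
    ((hh.component i.succ l.succ).pd j.succ)).sub
    (IsTest.sum _ fun m _ => (hh.component _ _).mul_left (by fun_prop))

/-- Behind this is the formula `δR = ∇^i ∇^j h_{ij} - Δ H - Ric^{ij} h_{ij}` for the scalar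
curvature. The covector is `∇^i h_{ij} - ∂_j H`; rewriting it with partial derivatives leaves the
term `-(n - 1) k x^m h_{mj}`. -/
theorem IsTestTensor.spatialDiv_curvatureCovector (hh : IsTestTensor K h) (p : Coord n) :
    spatialDiv k (Fin.tail p) (fun j => Gravity.curvatureCovector k h j p)
        (fun i j => pd i.succ (Gravity.curvatureCovector k h j) p)
      = spatialCurvatureVariation k (Fin.tail p) (jet h p) := by
  have hη := hh.isSymm p
  set η := jet h p with hηd
  set x := Fin.tail p with hx
  have hv : ∀ j : Fin n, Gravity.curvatureCovector k h j p
      = spatialTrace k x (fun i l => η.2.1 i.succ j.succ l.succ)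
        - spatialTrace k x (fun i l => η.2.1 j.succ i.succ l.succ)
        - (n - 1) * k * ∑ m, x m * η.1 j.succ m.succ := by
    intro j
    simp only [Gravity.curvatureCovector, spatialTrace_sub, Finset.mul_sum]
    simp_rw [← hηd, ← hx]
    simp_rw [hη.first _ _ (Fin.succ j)]
    congr 1
    refine Finset.sum_congr rfl fun m _ => ?_
    rw [hx, tail_apply, hη.value]
    change _ * η.1 _ _ = _
    rw [hη.value]
    ring
  have hV : ∀ i j : Fin n, pd i.succ (Gravity.curvatureCovector k h j) p
      = spatialTrace k x (fun l m => η.2.2 i.succ l.succ m.succ j.succ)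
        - spatialTrace k x (fun l m => η.2.2 i.succ j.succ l.succ m.succ)
        - k * (∑ m, x m * (η.2.1 i.succ m.succ j.succ - η.2.1 j.succ i.succ m.succ
          + η.2.1 m.succ i.succ j.succ - η.2.1 j.succ m.succ i.succ))
        - (n - 1) * k * (η.1 i.succ j.succ + ∑ m, x m * η.2.1 i.succ m.succ j.succ) := by
    intro i j
    have g1 := hasGrad_spatialTrace (k := k) (p := p)
      (M := fun q i l => (jet h q).2.1 i.succ l.succ j.succ - (jet h q).2.1 j.succ i.succ l.succ)
      fun i l => (hh.hasGrad_pd p _ _ _).sub (hh.hasGrad_pd p _ _ _)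
    have g2 := HasGrad.sum (p := p) (s := Finset.univ) fun (m : Fin n) _ =>
      ((hasGrad_coord m.succ).const_mul ((n - 1) * k)).mul (hh.hasGrad p m.succ j.succ)
    have g3 : HasGrad (Gravity.curvatureCovector k h j) _ p := g1.sub g2
    rw [g3.pd]
    simp only [Fin.cons_succ, spatialTrace_sub, Finset.sum_add_distrib]
    have e : ∀ m : Fin n, (n - 1) * k * (if i.succ = m.succ then 1 else 0) * h p m.succ j.succ
        = if i = m then (n - 1) * k * h p m.succ j.succ else 0 := by
      intro m; simp only [Fin.succ_inj]; split_ifs <;> ring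
    simp_rw [e]
    simp only [Finset.sum_ite_eq, Finset.mem_univ, if_true]
    have e2 : ∑ m : Fin n, (n - 1) * k * p m.succ * (jet h p).2.1 i.succ m.succ j.succ
        = (n - 1) * k * ∑ m, x m * η.2.1 i.succ m.succ j.succ := by
      rw [Finset.mul_sum]
      exact Finset.sum_congr rfl fun m _ => by rw [hx, tail_apply]; ring
    rw [e2]
    have e3 : ∑ m : Fin n, Fin.tail p m * ((jet h p).2.1 i.succ m.succ j.succ
        - (jet h p).2.1 j.succ i.succ m.succ + ((jet h p).2.1 m.succ i.succ j.succ
        - (jet h p).2.1 j.succ m.succ i.succ))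
        = ∑ m, x m * (η.2.1 i.succ m.succ j.succ - η.2.1 j.succ i.succ m.succ
          + η.2.1 m.succ i.succ j.succ - η.2.1 j.succ m.succ i.succ) :=
      Finset.sum_congr rfl fun m _ => by ring
    rw [e3]
    change _ - (_ * η.1 i.succ j.succ + _) = _
    ring
  have d1 : spatialTrace k x (fun i j => spatialTrace k x fun l m =>
      η.2.2 i.succ l.succ m.succ j.succ)
      = spatialTrace k x (fun i l => spatialTrace k x fun j m =>
        η.2.2 j.succ l.succ i.succ m.succ) := by
    rw [spatialTrace_comm, ← spatialTrace_swap]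
  have d2 : spatialTrace k x (fun i j => spatialTrace k x fun l m =>
      η.2.2 i.succ j.succ l.succ m.succ)
      = spatialTrace k x (fun i l => spatialTrace k x fun j m =>
        η.2.2 j.succ m.succ i.succ l.succ) := by
    rw [spatialTrace_comm]
  have d3 : ∀ m : Fin n, spatialTrace k x (fun i j => η.2.1 j.succ i.succ m.succ)
      = spatialTrace k x (fun i j => η.2.1 i.succ m.succ j.succ) := by
    intro m
    rw [spatialTrace_swap fun i j => η.2.1 i.succ j.succ m.succ]
    simp_rw [hη.first _ _ (Fin.succ m)]
  have d4 : ∀ m : Fin n, spatialTrace k x (fun i j => η.2.1 j.succ m.succ i.succ)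
      = spatialTrace k x (fun i j => η.2.1 i.succ m.succ j.succ) := fun m =>
    spatialTrace_swap fun i j => η.2.1 i.succ m.succ j.succ
  simp only [spatialDiv, hv, hV, spatialTrace_sub, spatialTrace_add, spatialTrace_const_mul,
    spatialTrace_sum, d1, d2, d3, d4, spatialCurvatureVariation]
  simp only [mul_sub, mul_add, Finset.sum_sub_distrib, Finset.sum_add_distrib]
  have e5 : ∑ l : Fin n, x l * ((n - 1) * k * ∑ m, x m * η.1 l.succ m.succ)
      = (n - 1) * k * ∑ l, ∑ m, x l * x m * η.1 l.succ m.succ := by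
    simp only [Finset.mul_sum]
    exact Finset.sum_congr rfl fun _ _ => Finset.sum_congr rfl fun _ _ => by ring
  simp only [mul_sub, sub_mul, Finset.sum_sub_distrib] at e5 ⊢
  linear_combination (n * k) * e5

end ActionVariation

/-! ### From the varied density to the Euler-Lagrange expressions -/

section ReducedVariation

variable {n : ℕ} {k : ℝ} {T : GravityTheory n} {a F : ℝ → ℝ} {I : Set ℝ}
  {K : Set (Coord n)} {h : Coord n → Tensor2 n}

/-- The Euler-Lagrange expression of the lapse function, up to its dependence on the spatial
point. -/
noncomputable def lapseEquation (T : GravityTheory n) (k : ℝ) (a F : ℝ → ℝ) (t : ℝ) : ℝ :=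
  partialF T k a F t - deriv (partialFdot T k a F) t

/-- The Euler-Lagrange expression of the scale factor, up to its dependence on the spatial
point. -/
noncomputable def scaleEquation (T : GravityTheory n) (k : ℝ) (a F : ℝ → ℝ) (t : ℝ) : ℝ :=
  partialA T k a F t - deriv (partialAdot T k a F) t + deriv (deriv (partialAddot T k a F)) t

/-- By homogeneity every coefficient depends on `t` only, so it commutes with the spatial
divergence. The covectors involved are `∂_t h_{0j}`, `h_{0j}`, `∂_j h_{00}` and the curvature
covector, all supported in `K`. -/
theorem IsTestTensor.hasZeroIntegral_divergencePart (hh : IsTestTensor K h)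
    (hc : AdmissibleCurve T k I a F) (hK : IsCompact K) (hKΩ : K ⊆ flrwDomain n k I) :
    HasZeroIntegral K fun p => divergencePart T k a F p (jet h p) := by
  have hsm : ∀ t ∈ I, ContDiffAt ℝ ∞ (fun t => Real.sqrt (F t) * a t ^ n *
      (- (isoLagrangianX T (scalarX a F t) (scalarY k a F t) / (n * F t * a t ^ 2)))) t ∧
      ContDiffAt ℝ ∞ (fun t => Real.sqrt (F t) * a t ^ n *
      (isoLagrangianY T (scalarX a F t) (scalarY k a F t) / (n * (n - 1) * a t ^ 4))) t ∧
      ContDiffAt ℝ ∞ (fun t => deriv F t / (2 * F t)) t ∧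
      ContDiffAt ℝ ∞ (fun t => 2 * (n - 1) * (a t * deriv a t / F t)) t := by
    intro t ht
    obtain ⟨ha, ha', -, hF, hF', hs, -, -⟩ := hc.contDiffAt (k := k) ht
    obtain ⟨-, lX, lY⟩ := hc.contDiffAt_iso ht
    have ha0 := (hc.scale_pos t ht).ne'
    have hF0 := (hc.lapse_pos t ht).ne'
    have c : ∀ r : ℝ, ContDiffAt ℝ ∞ (fun _ : ℝ => r) t := fun r => contDiffAt_const
    -- No condition on `r` is needed: pulling out `r⁻¹` is valid for `r = 0` too, by the convention
    -- for division by zero.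
    have hdiv : ∀ {u : ℝ → ℝ} (r : ℝ) {v : ℝ → ℝ}, ContDiffAt ℝ ∞ u t → ContDiffAt ℝ ∞ v t →
        v t ≠ 0 → ContDiffAt ℝ ∞ (fun s => u s / (r * v s)) t := by
      intro u r v hu hv hv0
      have : (fun s => u s / (r * v s)) = fun s => r⁻¹ * (u s / v s) := by
        funext s; rw [div_mul_eq_div_div, div_right_comm, div_eq_inv_mul _ r]
      rw [this]
      exact (c _).mul (hu.div hv hv0)
    refine ⟨(hs.mul (ha.pow n)).mul ?_, (hs.mul (ha.pow n)).mul ?_, hdiv 2 hF' hF hF0,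
      (c _).mul ((ha.mul ha').div hF hF0)⟩
    · simp only [mul_assoc]
      exact (hdiv n lX (hF.mul (ha.pow 2)) (by positivity)).neg
    · exact hdiv (n * (n - 1)) lY (ha.pow 4) (by positivity)
  have of1 : ∀ {f : ℝ → ℝ} {t : ℝ}, ContDiffAt ℝ ∞ f t → ContDiffAt ℝ 1 f t := fun hf =>
    hf.of_le (by norm_cast)
  have z0 := hasZeroIntegral_space (v := fun j p => pd 0 (fun q => h q 0 j.succ) p)
    (fun j => (hh.component 0 j.succ).pd 0) hK hKΩ fun t ht => of1 (hsm t ht).1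
  have z1 := hasZeroIntegral_space (v := fun j p => h p 0 j.succ)
    (fun j => hh.component 0 j.succ) hK hKΩ fun t ht => of1
      (((hsm t ht).1.neg.mul (hsm t ht).2.2.1).sub ((hsm t ht).2.1.mul (hsm t ht).2.2.2))
  have z2 := hasZeroIntegral_space (v := fun j p => pd j.succ (fun q => h q 0 0) p)
    (fun j => (hh.component 0 0).pd j.succ) hK hKΩ fun t ht => of1
      ((contDiffAt_const (c := -(1 / 2 : ℝ))).mul (hsm t ht).1)
  have z3 := hasZeroIntegral_space (v := Gravity.curvatureCovector k h)
    hh.curvatureCovector hK hKΩ fun t ht => of1 (hsm t ht).2.1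
  refine (((z0.add z1).add z2).add z3).congr hK.measurableSet fun p hp => ?_
  rw [hh.spatialDiv_curvatureCovector p]
  have e : (fun i j : Fin n => pd i.succ (fun p => pd 0 (fun q => h q 0 j.succ) p) p)
      = fun i j => (jet h p).2.2 0 i.succ 0 j.succ := by
    funext i j
    exact (hh.isSymm p).comm _ _ _ _
  rw [e]
  simp only [divergencePart]
  generalize spatialCurvatureVariation k (Fin.tail p) (jet h p) = z
  change _ = _ * spatialDiv k (Fin.tail p) (fun j => (jet h p).2.1 0 0 j.succ)
    (fun i j => (jet h p).2.2 0 i.succ 0 j.succ)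
    + _ * spatialDiv k (Fin.tail p) (fun j => (jet h p).1 0 j.succ)
      (fun i j => (jet h p).2.1 i.succ 0 j.succ)
    + _ * spatialDiv k (Fin.tail p) (fun j => (jet h p).2.1 j.succ 0 0)
            (fun i j => (jet h p).2.2 i.succ j.succ 0 0) + _
  ring

/-- The first variation of the action is given by the Euler-Lagrange expressions. -/
theorem IsTestTensor.hasZeroIntegral_densityVariation (hn : 2 ≤ n) (hh : IsTestTensor K h)
    (hc : AdmissibleCurve T k I a F) (hK : IsCompact K) (hKΩ : K ⊆ flrwDomain n k I) :
    HasZeroIntegral K fun p => densityVariation T (jet (flrw k a F) p) (jet h p)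
      - 1 / Real.sqrt (1 - k * radiusSq (Fin.tail p)) *
        (- lapseEquation T k a F (p 0) * h p 0 0
          + scaleEquation T k a F (p 0) * (1 / (2 * n * a (p 0))) * Gravity.traceField k h p) := by
  have hn0 : (n : ℝ) ≠ 0 := by positivity
  have hp := fun t (ht : t ∈ I) => hc.contDiffAt_partial ht
  have sFd : ContDiffOn ℝ ∞ (partialFdot T k a F) I := fun t ht => (hp t ht).2.1.contDiffWithinAt
  have sAd : ContDiffOn ℝ ∞ (partialAdot T k a F) I :=
    fun t ht => (hp t ht).2.2.2.1.contDiffWithinAt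
  have sAdd : ContDiffOn ℝ ∞ (partialAddot T k a F) I :=
    fun t ht => (hp t ht).2.2.2.2.contDiffWithinAt
  have sAdd' := ContDiffOn.deriv_infty hc.isOpen sAdd
  have hβ : ContDiffOn ℝ ∞ (fun t => 1 / (2 * n * a t)) I :=
    contDiffOn_const.div (contDiffOn_const.mul hc.smooth_scale) fun t ht => by
      have := (hc.scale_pos t ht).ne'; positivity
  have dβ : ∀ t ∈ I, HasDerivAt (fun t => 1 / (2 * n * a t)) (- deriv a t / (2 * n * a t ^ 2)) t := by
    intro t ht
    have h0 := (hc.scale_pos t ht).ne'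
    refine ((hasDerivAt_const t (1 : ℝ)).div ((hc.hasDerivAt_scale ht).const_mul (2 * (n : ℝ)))
      (by positivity)).congr_deriv ?_
    field_simp
    ring
  have dβ' : ∀ t ∈ I, HasDerivAt (fun t => - deriv a t / (2 * n * a t ^ 2))
      (- deriv (deriv a) t / (2 * n * a t ^ 2) + deriv a t ^ 2 / (n * a t ^ 3)) t := by
    intro t ht
    have h0 := (hc.scale_pos t ht).ne'
    refine ((hc.hasDerivAt_deriv_scale ht).neg.div (((hc.hasDerivAt_scale ht).fun_pow 2).const_mul
      (2 * (n : ℝ))) (by positivity)).congr_deriv ?_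
    simp only [Pi.neg_apply]
    field_simp
    ring
  have sβ' : ContDiffOn ℝ ∞ (fun t => - deriv a t / (2 * n * a t ^ 2)) I :=
    (ContDiffOn.deriv_infty hc.isOpen hc.smooth_scale).neg.div
      (contDiffOn_const.mul (hc.smooth_scale.pow 2)) fun t ht => by
      have := (hc.scale_pos t ht).ne'; positivity
  have of1 : ∀ {f : ℝ → ℝ}, ContDiffOn ℝ ∞ f I → ∀ t ∈ I, ContDiffAt ℝ 1 f t := fun hf t ht =>
    (hf.contDiffAt (hc.isOpen.mem_nhds ht)).of_le (by norm_cast)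
  have dd : ∀ {f : ℝ → ℝ}, ContDiffOn ℝ ∞ f I → ∀ t ∈ I, HasDerivAt f (deriv f t) t :=
    fun hf t ht => ContDiffOn.hasDerivAt_infty hc.isOpen hf ht
  -- One total time derivative for each order of differentiation. With `δa = β H` and `β = 1/(2na)`,
  -- `z1` removes the derivative from `h_{00}` in the lapse part, and `z2` does the same for `d(β
  -- H)/dt` in the part of `ȧ`.
  have z1 := (hh.component 0 0).hasZeroIntegral_time hK hKΩ (of1 sFd.neg)
    fun t ht => (dd sFd t ht).neg
  have z2 := (hh.traceField (k := k)).hasZeroIntegral_time (k := k) hK hKΩ (of1 (sAd.mul hβ))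
    fun t ht => (dd sAd t ht).mul (dβ t ht)
  -- The part of `ä` needs two integrations by parts: first the derivative of `∂Λ/∂ä β Ḣ`, then that
  -- of `(∂Λ/∂ä β' - (∂Λ/∂ä)' β) H`. What is left over is `(∂Λ/∂ä)'' β H`.
  have z3 := ((hh.traceField (k := k)).pd 0).hasZeroIntegral_time (k := k) hK hKΩ (of1 (sAdd.mul hβ))
    fun t ht => (dd sAdd t ht).mul (dβ t ht)
  have z4 := (hh.traceField (k := k)).hasZeroIntegral_time (k := k) hK hKΩ
    (of1 ((sAdd.mul sβ').sub (sAdd'.mul hβ)))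
    fun t ht => ((dd sAdd t ht).mul (dβ' t ht)).sub ((dd sAdd' t ht).mul (dβ t ht))
  refine ((((z1.add z2).add z3).add z4).add (hh.hasZeroIntegral_divergencePart hc hK hKΩ)).congr
    hK.measurableSet fun p hp => ?_
  rw [hc.densityVariation_eq hn (hKΩ hp) (hh.isSymm p), ← hh.pd_traceField, ← hh.pd_pd_traceField]
  generalize divergencePart T k a F p (jet h p) = z
  change 1 / _ * reducedPart T k a F (p 0) (h p 0 0) (pd 0 (fun q => h q 0 0) p)
    (Gravity.traceField k h p) _ _ + _ - _ = _
  simp only [reducedPart, lapseEquation, scaleEquation]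
  ring

end ReducedVariation

/-! ### Differentiation of the action under the integral sign -/

section UnderIntegral

/-- Compactness is used twice. It keeps the whole line segment in `U` for small `ε` at all points of
`K` simultaneously, and it bounds the derivative on a closed ball times `K`, so that a constant
dominates it. -/
theorem hasDerivAt_integral_comp_add_smul {X E : Type*} [TopologicalSpace X] [MeasurableSpace X]
    [OpensMeasurableSpace X] [T2Space X] {μ : MeasureTheory.Measure X}
    [MeasureTheory.IsFiniteMeasureOnCompacts μ] [NormedAddCommGroup E] [NormedSpace ℝ E]
    {Φ : E → ℝ} {U : Set E} (hU : IsOpen U) (hΦ : ∀ j ∈ U, ContDiffAt ℝ 1 Φ j) {K : Set X}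
    (hK : IsCompact K) {γ η : X → E} (hγ : ContinuousOn γ K) (hη : ContinuousOn η K)
    (hγU : ∀ p ∈ K, γ p ∈ U) :
    (∀ᶠ ε : ℝ in nhds 0, ∀ p ∈ K, γ p + ε • η p ∈ U) ∧
    MeasureTheory.IntegrableOn (fun p => fderiv ℝ Φ (γ p) (η p)) K μ ∧
    HasDerivAt (fun ε : ℝ => ∫ p in K, Φ (γ p + ε • η p) ∂μ)
      (∫ p in K, fderiv ℝ Φ (γ p) (η p) ∂μ) 0 := by
  have hev : ∀ᶠ ε : ℝ in nhds 0, ∀ p ∈ K, γ p + ε • η p ∈ U := by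
    have hc : Continuous fun z : ℝ × K => γ z.2 + z.1 • η z.2 :=
      (hγ.domRestrict.comp continuous_snd).add
        (continuous_fst.smul (hη.domRestrict.comp continuous_snd))
    have : CompactSpace K := isCompact_iff_compactSpace.1 hK
    have h := isCompact_univ.eventually_forall_of_forall_eventually (x₀ := (0 : ℝ))
      (K := (Set.univ : Set K)) (P := fun ε p => γ p + ε • η p ∈ U) fun y _ =>
        hc.continuousAt.preimage_mem_nhds (hU.mem_nhds (by simpa using hγU y y.2))
    filter_upwards [h] with ε hε p hp
    exact hε ⟨p, hp⟩ trivial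
  refine ⟨hev, ?_⟩
  obtain ⟨δ, hδ, hball⟩ := Metric.nhds_basis_closedBall.mem_iff.1 hev
  have hmem : ∀ ε ∈ Metric.closedBall (0 : ℝ) δ, ∀ p ∈ K, γ p + ε • η p ∈ U := hball
  have hcont : ContinuousOn (fun z : ℝ × X => γ z.2 + z.1 • η z.2)
      (Metric.closedBall (0 : ℝ) δ ×ˢ K) :=
    (hγ.comp continuousOn_snd fun z hz => hz.2).add
      (continuousOn_fst.smul (hη.comp continuousOn_snd fun z hz => hz.2))
  have hΦ' : ContinuousOn (fderiv ℝ Φ) U := fun j hj =>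
    ((hΦ j hj).fderiv_right (m := 0) (by norm_num)).continuousAt.continuousWithinAt
  have hΦc : ContinuousOn Φ U := fun j hj => (hΦ j hj).continuousAt.continuousWithinAt
  have hderiv : ContinuousOn (fun z : ℝ × X => fderiv ℝ Φ (γ z.2 + z.1 • η z.2) (η z.2))
      (Metric.closedBall (0 : ℝ) δ ×ˢ K) :=
    (hΦ'.comp hcont fun z hz => hmem z.1 hz.1 z.2 hz.2).clm_apply
      (hη.comp continuousOn_snd fun z hz => hz.2)
  obtain ⟨C, hC⟩ := ((isCompact_closedBall (0 : ℝ) δ).prod hK).exists_bound_of_continuousOn hderiv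
  have hslice : ∀ ε ∈ Metric.closedBall (0 : ℝ) δ, ContinuousOn (fun p => γ p + ε • η p) K :=
    fun ε _ => hγ.add (hη.const_smul ε)
  have h0 : (0 : ℝ) ∈ Metric.closedBall (0 : ℝ) δ := Metric.mem_closedBall_self hδ.le
  have hF : ∀ ε ∈ Metric.closedBall (0 : ℝ) δ, ContinuousOn (fun p => Φ (γ p + ε • η p)) K :=
    fun ε hε => hΦc.comp (hslice ε hε) fun p hp => hmem ε hε p hp
  have hF' : ContinuousOn (fun p => fderiv ℝ Φ (γ p + (0 : ℝ) • η p) (η p)) K :=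
    (hΦ'.comp (hslice 0 h0) fun p hp => hmem 0 h0 p hp).clm_apply hη
  have hm := hK.measurableSet
  have key := hasDerivAt_integral_of_dominated_loc_of_deriv_le (μ := μ.restrict K) (𝕜 := ℝ)
    (F := fun ε p => Φ (γ p + ε • η p)) (x₀ := 0) (s := Metric.closedBall 0 δ)
    (bound := fun _ => C) (F' := fun ε p => fderiv ℝ Φ (γ p + ε • η p) (η p))
    (Metric.closedBall_mem_nhds 0 hδ) ?_ ?_ ?_ ?_ ?_ ?_
  · simpa [MeasureTheory.IntegrableOn] using key
  · filter_upwards [Metric.closedBall_mem_nhds (0 : ℝ) hδ] with ε hε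
    exact ((hF ε hε).integrableOn_compact hK).aestronglyMeasurable
  · exact (hF 0 h0).integrableOn_compact hK
  · exact (hF'.integrableOn_compact (μ := μ) hK).aestronglyMeasurable
  · filter_upwards [MeasureTheory.ae_restrict_mem hm] with p hp ε hε
    exact hC (ε, p) ⟨hε, hp⟩
  · exact MeasureTheory.integrableOn_const hK.measure_lt_top.ne
  · filter_upwards [MeasureTheory.ae_restrict_mem hm] with p hp ε hε
    have h1 : HasDerivAt (fun ε : ℝ => γ p + ε • η p) (η p) ε := by
      simpa using ((hasDerivAt_id ε).smul_const (η p)).const_add (γ p)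
    exact ((hΦ _ (hmem ε hε p hp)).differentiableAt one_ne_zero).hasFDerivAt.comp_hasDerivAt ε h1

variable {n : ℕ} {T : GravityTheory n} {K : Set (Coord n)} {g h : Coord n → Tensor2 n}

theorem continuousAt_jet {p : Coord n} (hg : ∀ a b, ContDiffAt ℝ ∞ (fun q => g q a b) p) :
    ContinuousAt (jet g) p := by
  refine ContinuousAt.prodMk ?_ (ContinuousAt.prodMk ?_ ?_)
  · exact continuousAt_pi.2 fun a => continuousAt_pi.2 fun b => (hg a b).continuousAt
  · exact continuousAt_pi.2 fun c => continuousAt_pi.2 fun a => continuousAt_pi.2 fun b =>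
      (contDiffAt_pd (m := ∞) (hg a b) (by simp) c).continuousAt
  · exact continuousAt_pi.2 fun c => continuousAt_pi.2 fun d => continuousAt_pi.2 fun a =>
      continuousAt_pi.2 fun b => (contDiffAt_pd (m := ∞) (contDiffAt_pd (m := ∞) (hg a b)
        (by simp) d) (by simp) c).continuousAt

theorem fderiv_densityJet {j : Jet n} (hj : j ∈ jetDomain T) (η : Jet n) :
    fderiv ℝ (densityJet T) j η = densityVariation T j η := by
  have h1 : HasDerivAt (fun ε : ℝ => j + ε • η) η 0 := by
    simpa using ((hasDerivAt_id (0 : ℝ)).smul_const η).const_add j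
  have h0 : j + (0 : ℝ) • η = j := by simp
  have h2 : HasFDerivAt (densityJet T) (fderiv ℝ (densityJet T) j) (j + (0 : ℝ) • η) := by
    rw [h0]
    exact ((contDiffAt_densityJet hj).differentiableAt (by simp)).hasFDerivAt
  have h3 : HasDerivAt (densityJet T ∘ fun ε : ℝ => j + ε • η) (densityVariation T j η) 0 :=
    hasDerivAt_densityJet hj
  exact (h2.comp_hasDerivAt 0 h1).unique h3

/-- The first variation of the action. -/
theorem IsTestTensor.hasDerivAt_action {K' : Set (Coord n)} (hh : IsTestTensor K' h)
    (hK : IsCompact K) (hg : ∀ p ∈ K, ∀ a b, ContDiffAt ℝ ∞ (fun q => g q a b) p)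
    (hs : ∀ q a b, g q a b = g q b a) (hT : ∀ p ∈ K, jet g p ∈ jetDomain T) :
    MeasureTheory.IntegrableOn (fun p => densityVariation T (jet g p) (jet h p)) K ∧
    HasDerivAt (fun ε : ℝ => ∫ p in K, density T (fun q => g q + ε • h q) p)
      (∫ p in K, densityVariation T (jet g p) (jet h p)) 0 := by
  have hgc : ContinuousOn (jet g) K := fun p hp => (continuousAt_jet (hg p hp)).continuousWithinAt
  have hhc : ContinuousOn (jet h) K := fun p _ => (continuousAt_jet fun a b =>
    (hh.component a b).smooth.contDiffAt).continuousWithinAt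
  obtain ⟨h1, h2, h3⟩ := hasDerivAt_integral_comp_add_smul (μ := MeasureTheory.volume)
    (isOpen_jetDomain (T := T))
    (fun j hj => (contDiffAt_densityJet hj).of_le (by norm_cast)) hK hgc hhc hT
  have hm := hK.measurableSet
  rw [MeasureTheory.integrableOn_congr_fun (fun p hp => fderiv_densityJet (hT p hp) (jet h p)) hm]
    at h2
  rw [MeasureTheory.setIntegral_congr_fun hm
    fun p hp => fderiv_densityJet (hT p hp) (jet h p)] at h3
  refine ⟨h2, h3.congr_of_eventuallyEq ?_⟩
  filter_upwards [h1] with ε hε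
  refine MeasureTheory.setIntegral_congr_fun hm fun p hp => ?_
  -- The perturbed metric is nondegenerate at `p` because its jet lies in the jet domain, so its
  -- density is again a function of its jet.
  have hg2 : ∀ a b, ContDiffAt ℝ 2 (fun q => g q a b) p := fun a b =>
    (hg p hp a b).of_le (by norm_cast)
  have hj := jet_add_smul hg2 (hh.contDiffAt p) ε
  have hdet : (Matrix.of (g p + ε • h p)).det ≠ 0 := (hε p hp).1
  change density T (fun q => g q + ε • h q) p = _
  rw [← hj]
  refine density_eq_densityJet
    (fun a b => (hg2 a b).add (contDiffAt_const.mul (hh.contDiffAt p a b))) hdet fun q a b => ?_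
  simp [hs q a b, hh.symm q a b]

end UnderIntegral

/-! ### The tensor of the field equations -/

section Uniqueness

variable {n : ℕ} {T : GravityTheory n} {Ω : Set (Coord n)} {g : Coord n → Tensor2 n}

/-- Continuity turns the almost everywhere equality obtained from test functions into equality at
every point. -/
theorem continuousOn_pairing {E h : Coord n → Tensor2 n}
    (hg : ∀ p ∈ Ω, ∀ a b, ContDiffAt ℝ ∞ (fun q => g q a b) p)
    (hdet : ∀ p ∈ Ω, (Matrix.of (g p)).det ≠ 0) (hE : ContinuousOn E Ω) (hh : Continuous h) :
    ContinuousOn (fun p => volumeFactor g p * ∑ a, ∑ b, E p a b * inverseVariation g h p a b)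
      Ω := by
  intro p hp
  have hinv : ∀ a b, ContinuousWithinAt (fun q => inverseMetric g q a b) Ω p := fun a b =>
    (contDiffAt_inv_apply (M := fun q => Matrix.of (g q)) (hg p hp)
      (hdet p hp) a b).continuousAt.continuousWithinAt
  have hEc : ∀ a b, ContinuousWithinAt (fun q => E q a b) Ω p := fun a b =>
    continuousWithinAt_pi.1 (continuousWithinAt_pi.1 (hE p hp) a) b
  have hhc : ∀ a b, ContinuousWithinAt (fun q => h q a b) Ω p := fun a b =>
    (by fun_prop : Continuous fun q => h q a b).continuousWithinAt
  have hvol : ContinuousWithinAt (fun q => volumeFactor g q) Ω p := by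
    have := (contDiffAt_det (M := fun q => Matrix.of (g q)) (hg p hp)).continuousAt
    exact (Real.continuous_sqrt.continuousAt.comp (continuous_abs.continuousAt.comp
      this)).continuousWithinAt
  refine hvol.mul ?_
  refine tendsto_finsetSum _ fun a _ => tendsto_finsetSum _ fun b _ =>
    (hEc a b).mul (ContinuousWithinAt.neg ?_)
  exact tendsto_finsetSum _ fun c _ => tendsto_finsetSum _ fun d _ =>
    ((hinv a c).mul (hinv b d)).mul (hhc c d)

/-- A symmetric tensor is the variation of the inverse metric for some variation of the metric. -/
theorem inverseVariation_lower {p : Coord n} (hdet : (Matrix.of (g p)).det ≠ 0)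
    (M : Tensor2 n) :
    inverseVariation g (fun _ c d => - ∑ e, ∑ f, g p c e * g p d f * M e f) p = M := by
  funext a b
  have h1 := sum_inverseMetric_mul hdet
  simp only [inverseVariation, mul_neg, Finset.sum_neg_distrib, neg_neg]
  calc _ = ∑ c, ∑ d, ∑ e, ∑ f, (inverseMetric g p a c * g p c e) *
        (inverseMetric g p b d * g p d f) * M e f := by
        simp only [Finset.mul_sum]
        exact Finset.sum_congr rfl fun _ _ => Finset.sum_congr rfl fun _ _ =>
          Finset.sum_congr rfl fun _ _ => Finset.sum_congr rfl fun _ _ => by ring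
    _ = ∑ e, ∑ f, ∑ c, ∑ d, (inverseMetric g p a c * g p c e) *
        (inverseMetric g p b d * g p d f) * M e f :=
        (sum_comm_four fun e f c d => (inverseMetric g p a c * g p c e) *
          (inverseMetric g p b d * g p d f) * M e f)
    _ = ∑ e, ∑ f, (if a = e then 1 else 0) * (if b = f then 1 else 0) * M e f := by
        refine Finset.sum_congr rfl fun e _ => Finset.sum_congr rfl fun f _ => ?_
        rw [← h1 a e, ← h1 b f, Finset.sum_mul_sum, Finset.sum_mul]
        exact Finset.sum_congr rfl fun c _ => by rw [Finset.sum_mul]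
    _ = M a b := by simp

/-- The tensor of the field equations is unique. -/
theorem IsFieldEquationTensor.eqOn {E E' : Coord n → Tensor2 n} (hΩ : IsOpen Ω)
    (hg : ∀ p ∈ Ω, ∀ a b, ContDiffAt ℝ ∞ (fun q => g q a b) p)
    (hdet : ∀ p ∈ Ω, (Matrix.of (g p)).det ≠ 0)
    (hE : IsFieldEquationTensor T g Ω E) (hE' : IsFieldEquationTensor T g Ω E') :
    Set.EqOn E E' Ω := by
  have key : ∀ S : Tensor2 n, (∀ a b, S a b = S b a) → ∀ p ∈ Ω,
      volumeFactor g p * ∑ a, ∑ b, E p a b * inverseVariation g (fun _ => S) p a b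
      = volumeFactor g p * ∑ a, ∑ b, E' p a b * inverseVariation g (fun _ => S) p a b := by
    intro S hS
    have c1 := continuousOn_pairing hg hdet hE.continuousOn (continuous_const (y := S))
    have c2 := continuousOn_pairing hg hdet hE'.continuousOn (continuous_const (y := S))
    set u := fun p => volumeFactor g p * ∑ a, ∑ b, E p a b * inverseVariation g (fun _ => S) p a b
      with hu
    set u' := fun p =>
      volumeFactor g p * ∑ a, ∑ b, E' p a b * inverseVariation g (fun _ => S) p a b with hu'
    -- The fundamental lemma of the calculus of variations, with variations `φ S` for a bump
    -- function `φ` and a constant symmetric `S`; the pairing is linear in `φ`, since no derivative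
    -- of the variation occurs.
    have hz := hΩ.ae_eq_zero_of_integral_contDiff_smul_eq_zero
      (f := fun p => u p - u' p) (μ := MeasureTheory.volume)
      ((c1.sub c2).locallyIntegrableOn hΩ.measurableSet) (fun φ hφ hφc hφs => by
        have hKc : IsCompact (tsupport φ) := hφc
        have hsm : ContDiff ℝ ∞ fun q : Coord n => φ q • S := hφ.smul contDiff_const
        have hsup : tsupport (fun q : Coord n => φ q • S) ⊆ tsupport φ :=
          tsupport_smul_subset_left _ _
        have hsym : ∀ (p : Coord n) a b, (φ p • S) a b = (φ p • S) b a := fun p a b => by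
          simp [hS a b]
        have hlin : ∀ (p : Coord n) a b, inverseVariation g (fun q => φ q • S) p a b
            = φ p * inverseVariation g (fun _ => S) p a b := fun p a b => by
          simp only [inverseVariation, Pi.smul_apply, smul_eq_mul, mul_neg, Finset.mul_sum]
          congr 1
          exact Finset.sum_congr rfl fun _ _ => Finset.sum_congr rfl fun _ _ => by ring
        have hpair : ∀ (E : Coord n → Tensor2 n) p, volumeFactor g p * ∑ a, ∑ b, E p a b *
            inverseVariation g (fun q => φ q • S) p a b
            = φ p * (volumeFactor g p * ∑ a, ∑ b, E p a b *
              inverseVariation g (fun _ => S) p a b) := fun E p => by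
          simp only [hlin, Finset.mul_sum]
          exact Finset.sum_congr rfl fun _ _ => Finset.sum_congr rfl fun _ _ => by ring
        have h1 := (hE.firstVariation _ hsm hsym _ hKc hφs hsup).unique
          (hE'.firstVariation _ hsm hsym _ hKc hφs hsup)
        simp only [hpair] at h1
        have i1 : MeasureTheory.IntegrableOn (fun p => φ p * u p) (tsupport φ) :=
          (hφ.continuous.continuousOn.mul (c1.mono hφs)).integrableOn_compact hKc
        have i2 : MeasureTheory.IntegrableOn (fun p => φ p * u' p) (tsupport φ) :=
          (hφ.continuous.continuousOn.mul (c2.mono hφs)).integrableOn_compact hKc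
        rw [← MeasureTheory.setIntegral_eq_integral_of_forall_compl_eq_zero (s := tsupport φ)
          fun p hp => by simp [image_eq_zero_of_notMem_tsupport hp]]
        simp only [smul_eq_mul, mul_sub]
        rw [MeasureTheory.integral_sub i1 i2, sub_eq_zero]
        exact h1)
    refine MeasureTheory.Measure.eqOn_open_of_ae_eq (μ := MeasureTheory.volume) ?_ hΩ c1 c2
    filter_upwards [MeasureTheory.ae_restrict_of_ae hz,
      MeasureTheory.ae_restrict_mem hΩ.measurableSet] with p hp hpΩ
    exact sub_eq_zero.1 (hp hpΩ)
  intro p hp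
  set M : Tensor2 n := fun a b => E p a b - E' p a b with hM
  have hMs : ∀ a b, M a b = M b a := fun a b => by
    simp only [hM]; rw [hE.symm p hp, hE'.symm p hp]
  -- The constant `S` is chosen for the point `p`: it is minus the difference of the two tensors
  -- with its indices contracted with the metric at `p`, so the inverse variation there is the
  -- difference itself.
  have h1 := key (fun c d => - ∑ e, ∑ f, g p c e * g p d f * M e f) (fun a b => by
    rw [Finset.sum_comm]
    congr 1
    refine Finset.sum_congr rfl fun e _ => Finset.sum_congr rfl fun f _ => ?_
    rw [hMs]; ring) p hp
  rw [inverseVariation_lower (hdet p hp)] at h1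
  have hv : volumeFactor g p ≠ 0 := (Real.sqrt_pos.2 (abs_pos.2 (hdet p hp))).ne'
  -- A plain sum of squares of components, so the indefinite signature of the metric is no obstacle.
  have h2 : ∑ a, ∑ b, M a b * M a b = 0 := by
    have := mul_left_cancel₀ hv h1
    rw [← sub_eq_zero, ← Finset.sum_sub_distrib] at this
    rw [← this]
    refine Finset.sum_congr rfl fun a _ => ?_
    rw [← Finset.sum_sub_distrib]
    exact Finset.sum_congr rfl fun b _ => by simp only [hM]; ring
  funext a b
  have h3 := (Finset.sum_eq_zero_iff_of_nonneg fun a _ =>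
    Finset.sum_nonneg fun b _ => mul_self_nonneg (M a b)).1 h2 a (Finset.mem_univ a)
  have h4 := (Finset.sum_eq_zero_iff_of_nonneg fun b _ => mul_self_nonneg (M a b)).1 h3 b
    (Finset.mem_univ b)
  exact sub_eq_zero.1 (mul_self_eq_zero.1 h4)

end Uniqueness

/-! ### The explicit field equation tensor at the FLRW metric -/

section FieldEquations

variable {n : ℕ} {k : ℝ} {T : GravityTheory n} {a F : ℝ → ℝ} {I : Set ℝ}

/-- The component of the field equations obtained by varying the lapse function. -/
noncomputable def temporalComponent (T : GravityTheory n) (k : ℝ) (a F : ℝ → ℝ) (t : ℝ) : ℝ :=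
  F t ^ 2 * lapseEquation T k a F t / (Real.sqrt (F t) * a t ^ n)

/-- The component of the field equations obtained by varying the scale factor. -/
noncomputable def spatialComponent (T : GravityTheory n) (k : ℝ) (a F : ℝ → ℝ) (t : ℝ) : ℝ :=
  - a t * scaleEquation T k a F t / (2 * n * (Real.sqrt (F t) * a t ^ n))

/-- The tensor of the field equations at the FLRW metric. -/
noncomputable def flrwFieldEquations (T : GravityTheory n) (k : ℝ) (a F : ℝ → ℝ) (p : Coord n) :
    Tensor2 n := fun μ ν =>
  (if μ = 0 ∧ ν = 0 then temporalComponent T k a F (p 0)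
    + F (p 0) * spatialComponent T k a F (p 0) else 0)
    + spatialComponent T k a F (p 0) * flrw k a F p μ ν

/-- The inverse metric varies by `δg^{00} = -h_{00}/F²` and `γ_{ij} δg^{ij} = -H/a⁴`. The components
of the tensor are normalized so that these factors and the volume `√F a ^ n` cancel. -/
theorem AdmissibleCurve.pairing_flrw (hn : 2 ≤ n) (hc : AdmissibleCurve T k I a F) {p : Coord n}
    (hp : p ∈ flrwDomain n k I) (h : Coord n → Tensor2 n) :
    volumeFactor (flrw k a F) p * ∑ μ, ∑ ν, flrwFieldEquations T k a F p μ ν *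
        inverseVariation (flrw k a F) h p μ ν
      = 1 / Real.sqrt (1 - k * radiusSq (Fin.tail p)) *
        (- lapseEquation T k a F (p 0) * h p 0 0
          + scaleEquation T k a F (p 0) * (1 / (2 * n * a (p 0))) * traceField k h p) := by
  have ha := (hc.scale_pos _ hp.1).ne'
  have hF := (hc.lapse_pos _ hp.1).ne'
  have hsF := (Real.sqrt_pos.2 (hc.lapse_pos _ hp.1)).ne'
  have hs := (Real.sqrt_pos.2 hp.2).ne'
  have hn0 : (n : ℝ) ≠ 0 := by positivity
  have h00 : inverseVariation (flrw k a F) h p 0 0 = - h p 0 0 / F (p 0) ^ 2 := by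
    simp only [inverseVariation, hc.inverseMetric_flrw hp, Fin.sum_univ_succ, flrwInverse,
      Fin.cons_zero, Fin.cons_succ, zero_mul, mul_zero, Finset.sum_const_zero, add_zero]
    field_simp
  have hij : ∑ i : Fin n, ∑ j : Fin n, spatialMetric k (Fin.tail p) i j *
      inverseVariation (flrw k a F) h p i.succ j.succ = - traceField k h p / a (p 0) ^ 4 := by
    rw [traceField, ← sum_spatialMetric_mul_inverse hp.2.ne', neg_div, Finset.sum_div,
      ← Finset.sum_neg_distrib]
    refine Finset.sum_congr rfl fun i _ => ?_
    rw [Finset.sum_div, ← Finset.sum_neg_distrib]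
    refine Finset.sum_congr rfl fun j _ => ?_
    simp only [inverseVariation, hc.inverseMetric_flrw hp, Fin.sum_univ_succ, flrwInverse,
      Fin.cons_zero, Fin.cons_succ, zero_mul, mul_zero, Finset.sum_const_zero, zero_add]
    rw [mul_div_assoc, Finset.sum_div, ← mul_neg]
    congr 2
    refine Finset.sum_congr rfl fun c _ => ?_
    rw [Finset.sum_div]
    refine Finset.sum_congr rfl fun d _ => ?_
    rw [spatialInverse_symm k _ j d]
    field_simp
  have hsum : ∑ μ, ∑ ν, flrwFieldEquations T k a F p μ ν *
      inverseVariation (flrw k a F) h p μ ν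
      = temporalComponent T k a F (p 0) * inverseVariation (flrw k a F) h p 0 0
        + spatialComponent T k a F (p 0) * a (p 0) ^ 2 *
          ∑ i : Fin n, ∑ j : Fin n, spatialMetric k (Fin.tail p) i j *
            inverseVariation (flrw k a F) h p i.succ j.succ := by
    simp only [Fin.sum_univ_succ, flrwFieldEquations, flrw_zero_zero, flrw_zero_succ,
      flrw_succ_zero, flrw_succ_succ, Fin.succ_ne_zero, false_and, and_false, if_false, and_self,
      if_true, mul_zero, add_zero, zero_mul, zero_add, Finset.sum_const_zero, Finset.mul_sum]
    congr 1
    · ring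
    · exact Finset.sum_congr rfl fun i _ => Finset.sum_congr rfl fun j _ => by ring
  rw [hsum, h00, hij, hc.volumeFactor_flrw hp, temporalComponent, spatialComponent]
  field_simp

theorem AdmissibleCurve.continuousOn_components (hn : 2 ≤ n) (hc : AdmissibleCurve T k I a F) :
    ContinuousOn (temporalComponent T k a F) I ∧ ContinuousOn (spatialComponent T k a F) I := by
  have hp := fun t (ht : t ∈ I) => hc.contDiffAt_partial ht
  have sFd : ContDiffOn ℝ ∞ (partialFdot T k a F) I := fun t ht => (hp t ht).2.1.contDiffWithinAt
  have sAd : ContDiffOn ℝ ∞ (partialAdot T k a F) I :=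
    fun t ht => (hp t ht).2.2.2.1.contDiffWithinAt
  have sAdd : ContDiffOn ℝ ∞ (partialAddot T k a F) I :=
    fun t ht => (hp t ht).2.2.2.2.contDiffWithinAt
  have hV : ContinuousOn (fun t => Real.sqrt (F t) * a t ^ n) I :=
    hc.smooth_lapse.continuousOn.sqrt.mul (hc.smooth_scale.continuousOn.pow n)
  have hV0 : ∀ t ∈ I, Real.sqrt (F t) * a t ^ n ≠ 0 := fun t ht => by
    have h1 := hc.scale_pos t ht
    have h2 := Real.sqrt_pos.2 (hc.lapse_pos t ht)
    positivity
  have hn0 : (n : ℝ) ≠ 0 := by positivity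
  constructor
  · refine ((hc.smooth_lapse.continuousOn.pow 2).mul (ContinuousOn.sub (fun t ht =>
      (hp t ht).1.continuousAt.continuousWithinAt)
      (ContDiffOn.deriv_infty hc.isOpen sFd).continuousOn)).div hV hV0
  · refine (hc.smooth_scale.continuousOn.neg.mul ((ContinuousOn.sub (fun t ht =>
      (hp t ht).2.2.1.continuousAt.continuousWithinAt)
      (ContDiffOn.deriv_infty hc.isOpen sAd).continuousOn).add (ContDiffOn.deriv_infty hc.isOpen
        (ContDiffOn.deriv_infty hc.isOpen sAdd)).continuousOn)).div
      (continuousOn_const.mul hV) fun t ht => mul_ne_zero (by positivity) (hV0 t ht)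

/-- The tensor of the field equations at the FLRW metric exists. -/
theorem AdmissibleCurve.isFieldEquationTensor (hn : 2 ≤ n) (hc : AdmissibleCurve T k I a F) :
    IsFieldEquationTensor T (flrw k a F) (flrwDomain n k I) (flrwFieldEquations T k a F) where
  symm p _ μ ν := by
    simp only [flrwFieldEquations, and_comm (a := μ = 0)]
    rw [flrw_symm]
  continuousOn := by
    obtain ⟨h1, h2⟩ := hc.continuousOn_components hn
    have h0 : ContinuousOn (fun p : Coord n => p 0) (flrwDomain n k I) :=
      (continuous_apply 0).continuousOn
    have hm : Set.MapsTo (fun p : Coord n => p 0) (flrwDomain n k I) I := fun p hp => hp.1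
    have g1 := h1.comp h0 hm
    have g2 := h2.comp h0 hm
    have g3 := hc.smooth_lapse.continuousOn.comp h0 hm
    refine continuousOn_pi.2 fun μ => continuousOn_pi.2 fun ν => ?_
    refine ContinuousOn.add ?_ (g2.mul fun p hp =>
      (hc.contDiffAt_flrw hp μ ν).continuousAt.continuousWithinAt)
    by_cases h : μ = 0 ∧ ν = 0
    · simp only [h, and_self, if_true]
      exact g1.add (g3.mul g2)
    · simp only [h, if_false]
      exact continuousOn_const
  firstVariation h hsm hsym K hK hKΩ hsup := by
    have hh : IsTestTensor K h := by
      refine ⟨fun μ ν => ⟨by fun_prop, ?_⟩, hsym⟩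
      refine (closure_mono (s := Function.support fun q => h q μ ν) (t := Function.support h)
        fun q hq hz => hq ?_).trans hsup
      simp [hz]
    have hjet : ∀ p ∈ K, jet (flrw k a F) p ∈ jetDomain T := by
      intro p hp
      refine ⟨hc.det_flrw_ne_zero (hKΩ hp), ?_⟩
      rw [← curvatureData_eq_curvatureJet (fun μ ν => (hc.contDiffAt_flrw (hKΩ hp) μ ν).of_le
        (by norm_cast)) (hc.det_flrw_ne_zero (hKΩ hp)) flrw_symm, hc.curvatureData_flrw (hKΩ hp)]
      exact flrwPair_mem_domain (hc.scale_pos _ (hKΩ hp).1) (hc.lapse_pos _ (hKΩ hp).1) (hKΩ hp).2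
        (hc.mem_domain _ (hKΩ hp).1)
    obtain ⟨h1, h2⟩ := hh.hasDerivAt_action hK (fun p hp => hc.contDiffAt_flrw (hKΩ hp)) flrw_symm
      hjet
    have h3 := hh.hasZeroIntegral_densityVariation hn hc hK hKΩ
    refine h2.congr_deriv ?_
    have h4 := h3.integral_eq
    rw [MeasureTheory.setIntegral_congr_fun hK.measurableSet
      fun p hp => hc.pairing_flrw hn (hKΩ hp) h]
    -- Integrability comes for free, as the difference of two functions already known to be
    -- integrable; it is needed to split the vanishing integral.
    have h5 : MeasureTheory.IntegrableOn (fun p => 1 / Real.sqrt (1 - k * radiusSq (Fin.tail p)) *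
        (- lapseEquation T k a F (p 0) * h p 0 0
          + scaleEquation T k a F (p 0) * (1 / (2 * n * a (p 0))) * traceField k h p)) K := by
      refine (h1.sub h3.integrableOn).congr_fun (fun p _ => ?_) hK.measurableSet
      simp
    rw [MeasureTheory.integral_sub h1 h5] at h4
    exact sub_eq_zero.1 h4

end FieldEquations

/-! ### Assembly of the statement -/

section Final

variable {n : ℕ} {k : ℝ} {T : GravityTheory n} {a F : ℝ → ℝ} {I : Set ℝ}

theorem ScaleLapse.admissibleCurve (h : ScaleLapse I a F)
    (hdom : ∀ p ∈ flrwDomain n k I, curvatureData (flrw k a F) p ∈ T.domain) :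
    AdmissibleCurve T k I a F where
  toScaleLapse := h
  mem_domain t ht := by
    -- The spatial origin satisfies `1 - k r² > 0` for every `k`, so each time in `I` is reached by
    -- a point of the chart.
    have hp : (Fin.cons t 0 : Coord n) ∈ flrwDomain n k I :=
      ⟨ht, by simp [radiusSq]⟩
    have h1 := hdom _ hp
    rw [h.curvatureData_flrw hp] at h1
    exact stdPair_mem_domain (h.scale_pos t ht) (h.lapse_pos t ht) hp.2 h1

theorem AdmissibleCurve.eulerLagrangeF_eq_component (hc : AdmissibleCurve T k I a F) {p : Coord n}
    (hp : p ∈ flrwDomain n k I) :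
    eulerLagrangeF (reducedLagrangian T k (Fin.tail p)) a F (p 0)
      = volumeFactor (flrw k a F) p * (1 / F (p 0) ^ 2) * temporalComponent T k a F (p 0) := by
  have ha := (hc.scale_pos _ hp.1).ne'
  have hF := (hc.lapse_pos _ hp.1).ne'
  have hsF := (Real.sqrt_pos.2 (hc.lapse_pos _ hp.1)).ne'
  rw [hc.eulerLagrangeF_eq hp.1 hp.2, hc.volumeFactor_flrw hp, temporalComponent, lapseEquation]
  field_simp

theorem AdmissibleCurve.eulerLagrangeA_eq_component (hn : 2 ≤ n) (hc : AdmissibleCurve T k I a F)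
    {p : Coord n} (hp : p ∈ flrwDomain n k I) :
    eulerLagrangeA (reducedLagrangian T k (Fin.tail p)) a F (p 0)
      = volumeFactor (flrw k a F) p * (-2 * n / a (p 0)) * spatialComponent T k a F (p 0) := by
  have ha := (hc.scale_pos _ hp.1).ne'
  have hsF := (Real.sqrt_pos.2 (hc.lapse_pos _ hp.1)).ne'
  have hn0 : (n : ℝ) ≠ 0 := by positivity
  rw [hc.eulerLagrangeA_eq hp.1 hp.2, hc.volumeFactor_flrw hp, spatialComponent, scaleEquation]
  field_simp

/-- Each Euler-Lagrange expression is a non-zero multiple of one component, so it remains to recover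
both components from the tensor. -/
theorem AdmissibleCurve.flrwFieldEquations_eq_zero_iff (hn : 2 ≤ n)
    (hc : AdmissibleCurve T k I a F) {p : Coord n} (hp : p ∈ flrwDomain n k I) :
    (∀ μ ν, flrwFieldEquations T k a F p μ ν = 0) ↔
      eulerLagrangeF (reducedLagrangian T k (Fin.tail p)) a F (p 0) = 0 ∧
      eulerLagrangeA (reducedLagrangian T k (Fin.tail p)) a F (p 0) = 0 := by
  have ha := (hc.scale_pos _ hp.1).ne'
  have hF := (hc.lapse_pos _ hp.1).ne'
  have hv : volumeFactor (flrw k a F) p ≠ 0 :=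
    (Real.sqrt_pos.2 (abs_pos.2 (hc.det_flrw_ne_zero hp))).ne'
  have hn0 : (n : ℝ) ≠ 0 := by positivity
  have e1 : eulerLagrangeF (reducedLagrangian T k (Fin.tail p)) a F (p 0) = 0 ↔
      temporalComponent T k a F (p 0) = 0 := by
    rw [hc.eulerLagrangeF_eq_component hp]
    simp [hv, hF]
  have e2 : eulerLagrangeA (reducedLagrangian T k (Fin.tail p)) a F (p 0) = 0 ↔
      spatialComponent T k a F (p 0) = 0 := by
    rw [hc.eulerLagrangeA_eq_component hn hp]
    simp [hv, ha, hn0]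
  rw [e1, e2]
  constructor
  · intro h
    constructor
    -- In the time-time component the two multiples of the spatial coefficient cancel because
    -- `g_{00} = -F`.
    · have h0 := h 0 0
      simp only [flrwFieldEquations, and_self, if_true, flrw_zero_zero] at h0
      linarith
    · have h1 : ∀ i j : Fin n, spatialComponent T k a F (p 0) * a (p 0) ^ 2 *
          spatialMetric k (Fin.tail p) i j = 0 := fun i j => by
        have := h i.succ j.succ
        simp only [flrwFieldEquations, Fin.succ_ne_zero, false_and, if_false, zero_add,
          flrw_succ_succ] at this
        rw [← this]; ring
      -- Taking the trace avoids singling out an entry of `γ`: the trace of `γ` with its own inverse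
      -- is `n ≠ 0`.
      have h2 : spatialComponent T k a F (p 0) * a (p 0) ^ 2 * n = 0 := by
        rw [← spatialTrace_metric hp.2.ne',
          ← spatialTrace_const_mul (spatialComponent T k a F (p 0) * a (p 0) ^ 2)]
        simp [h1, spatialTrace]
      simpa [ha, hn0] using h2
  · rintro ⟨h1, h2⟩ μ ν
    simp [flrwFieldEquations, h1, h2]

end Final

end Gravity

theorem proposition1 (n : ℕ) (hn : 2 ≤ n) (T : Gravity.GravityTheory n)
    (k : ℝ) (hk : k = -1 ∨ k = 0 ∨ k = 1)
    (I : Set ℝ) (hIo : IsOpen I) (hIc : I.OrdConnected) (a F : ℝ → ℝ)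
    (ha : ContDiffOn ℝ ∞ a I) (hF : ContDiffOn ℝ ∞ F I)
    (ha0 : ∀ t ∈ I, 0 < a t) (hF0 : ∀ t ∈ I, 0 < F t)
    (hdom : ∀ p ∈ Gravity.flrwDomain n k I,
      Gravity.curvatureData (Gravity.flrw k a F) p ∈ T.domain) :
    -- the density on the ansatz is a function of `a, ȧ, ä, F, Ḟ` and of the spatial point
    (∀ p ∈ Gravity.flrwDomain n k I, Gravity.density T (Gravity.flrw k a F) p =
      Gravity.reducedLagrangian T k (Fin.tail p) (a (p 0)) (deriv a (p 0))
        (deriv (deriv a) (p 0)) (F (p 0)) (deriv F (p 0))) ∧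
    -- the field equations exist
    (∃ E, Gravity.IsFieldEquationTensor T (Gravity.flrw k a F) (Gravity.flrwDomain n k I) E) ∧
    (∀ E, Gravity.IsFieldEquationTensor T (Gravity.flrw k a F) (Gravity.flrwDomain n k I) E →
      -- their two independent components are the two Euler-Lagrange expressions
      (∃ s₁ s₂ : ℝ → ℝ, ∀ p ∈ Gravity.flrwDomain n k I,
        (∀ μ ν, E p μ ν =
          (if μ = 0 ∧ ν = 0 then s₁ (p 0) + F (p 0) * s₂ (p 0) else 0)
            + s₂ (p 0) * Gravity.flrw k a F p μ ν) ∧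
        Gravity.eulerLagrangeF (Gravity.reducedLagrangian T k (Fin.tail p)) a F (p 0) =
          Gravity.volumeFactor (Gravity.flrw k a F) p * (1 / F (p 0) ^ 2) * s₁ (p 0) ∧
        Gravity.eulerLagrangeA (Gravity.reducedLagrangian T k (Fin.tail p)) a F (p 0) =
          Gravity.volumeFactor (Gravity.flrw k a F) p * (-2 * n / a (p 0)) * s₂ (p 0)) ∧
      -- the full field equations are equivalent to the reduced Euler-Lagrange equations
      ((∀ p ∈ Gravity.flrwDomain n k I, ∀ μ ν, E p μ ν = 0) ↔
        ∀ p ∈ Gravity.flrwDomain n k I,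
          Gravity.eulerLagrangeF (Gravity.reducedLagrangian T k (Fin.tail p)) a F (p 0) = 0 ∧
          Gravity.eulerLagrangeA (Gravity.reducedLagrangian T k (Fin.tail p)) a F (p 0) = 0)) ∧
    -- time can be reparametrized, after the variation, so that `F = 1`
    (∃ τ b : ℝ → ℝ, ContDiffOn ℝ ∞ τ I ∧ StrictMonoOn τ I ∧
      (∀ t ∈ I, deriv τ t = Real.sqrt (F t)) ∧ IsOpen (τ '' I) ∧
      ContDiffOn ℝ ∞ b (τ '' I) ∧ (∀ t ∈ I, b (τ t) = a t) ∧
      ∀ p ∈ Gravity.flrwDomain n k I,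
        (Gravity.eulerLagrangeF (Gravity.reducedLagrangian T k (Fin.tail p)) a F (p 0) = 0 ↔
          Gravity.eulerLagrangeF (Gravity.reducedLagrangian T k (Fin.tail p)) b
            (fun _ => 1) (τ (p 0)) = 0) ∧
        (Gravity.eulerLagrangeA (Gravity.reducedLagrangian T k (Fin.tail p)) a F (p 0) = 0 ↔
          Gravity.eulerLagrangeA (Gravity.reducedLagrangian T k (Fin.tail p)) b
            (fun _ => 1) (τ (p 0)) = 0)) := by
  have hs : Gravity.ScaleLapse I a F := ⟨hIo, ha, hF, ha0, hF0⟩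
  have hc : Gravity.AdmissibleCurve T k I a F := hs.admissibleCurve hdom
  have hE := hc.isFieldEquationTensor hn
  refine ⟨fun p hp => ?_, ⟨_, hE⟩, fun E hE' => ?_, ?_⟩
  · rw [hs.density_flrw hp (hc.mem_domain _ hp.1), hc.reducedLagrangian_eq hp.1 hp.2]
  -- By uniqueness an arbitrary field equation tensor agrees on the chart with the explicit one, for
  -- which the remaining claims are known pointwise.
  · have heq := hE'.eqOn (Gravity.isOpen_flrwDomain hIo) (fun p hp => hs.contDiffAt_flrw hp)
      (fun p hp => hs.det_flrw_ne_zero hp) hE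
    refine ⟨⟨Gravity.temporalComponent T k a F, Gravity.spatialComponent T k a F, fun p hp =>
      ⟨fun μ ν => ?_, hc.eulerLagrangeF_eq_component hp, hc.eulerLagrangeA_eq_component hn hp⟩⟩, ?_⟩
    · rw [heq hp]
      rfl
    · refine forall₂_congr fun p hp => ?_
      rw [heq hp, hc.flrwFieldEquations_eq_zero_iff hn hp]
  · obtain ⟨τ, b, h1, h2, h3⟩ := hs.exists_properTime hIc
    exact ⟨τ, b, h1, h2, fun t ht => (h3.hasDerivAt t ht).deriv, h3.isOpen_image, h3.smooth, h3.eq,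
      fun p hp => ⟨h3.eulerLagrangeF_iff hc hp.1 hp.2, h3.eulerLagrangeA_iff hc hp.1 hp.2⟩⟩
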